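/- **Setting.** Let $d\ge 1$, let $(\Omega,\mathcal F,P)$ be a complete and separable probability space with expectation $\langle\cdot\rangle$, and let $\tau=\{\tau_x\}_{x\in\mathbb R^d}$ be measurable maps $\tau_x:\Omega\to\Omega$ that preserve $P$, with $\tau_0=\mathrm{Id}$, $\tau_{x+y}=\tau_x\circ\tau_y$, and such that $(\omega,x)\mapsto\tau_x\omega$ is measurable with respect to the completion of $\mathcal F\otimes\mathcal B(\mathbb R^d)$ under $P\otimes dx$ (in particular this holds if it is $\mathcal F\otimes\mathcal L(\mathbb R^d)$-measurable, $\mathcal L$ denoting the Lebesgue $\sigma$-algebra). Ergodicity is not assumed. Let $p\in(1,\infty)$ and let $Q\subset\mathbb R^d$ be open and bounded. Let $U_x\varphi=\varphi\circ\tau_x$ on $L^p(\Omega)$, let $L^p_{\rm inv}(\Omega)=\{\varphi\in L^p(\Omega):U_x\varphi=\varphi\ \forall x\in\mathbb R^d\}$, let $D_i$ be the generator of the group $h\mapsto U_{he_i}$ on $L^p(\Omega)$, let $D=(D_1,\dots,D_d)$ on $\bigcap_i\operatorname{dom}D_i$, and let $L^p_{\rm pot}(\Omega)$ be the closure of the range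 of $D$ in $L^p(\Omega)^d$. For subspaces $X$ of $L^p(\Omega)$ or $L^p(\Omega)^d$ and $Y$ of $L^p(Q)$ or $W^{1,p}(Q)$, $X\otimes Y$ is the closure of the span of the products $\varphi(\omega)\eta(x)$ ($\varphi\in X$, $\eta\in Y$) in $L^p(\Omega\times Q)$, $L^p(\Omega\times Q)^d$ or $L^p(\Omega;W^{1,p}(Q))$, respectively; $W^{1,p}_0(Q)$ is the closure of $C_c^\infty(Q)$ in $W^{1,p}(Q)$. For $\varepsilon>0$ let $(\mathcal T_\varepsilon u)(\omega,x)=u(\tau_{-x/\varepsilon}\omega,x)$ on $L^p(\Omega\times Q)$ and on $L^p(\Omega\times Q)^d$. One says that $u_\varepsilon$ two-scale converges in the mean to $u$, weakly (written $u_\varepsilon\overset{2}{\rightharpoonup}u$) or strongly (written $u_\varepsilon\overset{2}{\to}u$), if $\mathcal T_\varepsilon u_\varepsilon\to u$ weakly, respectively strongly, in $L^p$. Let $V:\Omega\times Q\times\mathbb R^d\to\mathbb R$ be such that $V(\cdot,\cdot,F)$ is measurable up to null sets for every $F\in\mathbb R^d$; $V(\omega,x,\cdot)$ is convex for a.e.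 $(\omega,x)$; and for some $C>0$, for a.e. $(\omega,x)$ and all $F\in\mathbb R^d$, $$\tfrac1C|F|^p-C\le V(\omega,x,F)\le C(|F|^p+1).$$ Define $$\mathcal E_\varepsilon(u)=\Big\langle\int_Q V(\tau_{x/\varepsilon}\omega,x,\nabla u(\omega,x))\,dx\Big\rangle,\qquad u\in L^p(\Omega)\otimes W^{1,p}_0(Q),$$ $$\mathcal E_0(u,\chi)=\Big\langle\int_Q V(\omega,x,\nabla u(\omega,x)+\chi(\omega,x))\,dx\Big\rangle,\qquad (u,\chi)\in\big(L^p_{\rm inv}(\Omega)\otimes W^{1,p}_0(Q)\big)\times\big(L^p_{\rm pot}(\Omega)\otimes L^p(Q)\big).$$ **Theorem (two-scale homogenization).** The integrands in $\mathcal E_\varepsilon(u)$ and $\mathcal E_0(u,\chi)$ are integrable on $\Omega\times Q$ for all such $\varepsilon$, $u$, $\chi$, and: (i) (Compactness and liminf inequality.) Let $\varepsilon_n>0$, $\varepsilon_n\to0$, and let $u_n\in L^p(\Omega)\otimes W^{1,p}_0(Q)$ satisfy $\limsup_{n\to\infty}\mathcal E_{\varepsilon_n}(u_n)<\infty$. Then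 there are $u\in L^p_{\rm inv}(\Omega)\otimes W^{1,p}_0(Q)$, $\chi\in L^p_{\rm pot}(\Omega)\otimes L^p(Q)$ and a subsequence along which $u_n\overset{2}{\rightharpoonup}u$, $\nabla u_n\overset{2}{\rightharpoonup}\nabla u+\chi$ (with respect to $\varepsilon_n$), and $\liminf\mathcal E_{\varepsilon_n}(u_n)\ge\mathcal E_0(u,\chi)$. (ii) (Recovery sequences.) For all $u\in L^p_{\rm inv}(\Omega)\otimes W^{1,p}_0(Q)$ and $\chi\in L^p_{\rm pot}(\Omega)\otimes L^p(Q)$ there are $u_\varepsilon\in L^p(\Omega)\otimes W^{1,p}_0(Q)$, $\varepsilon>0$, such that, as $\varepsilon\to0^+$, $u_\varepsilon\overset{2}{\to}u$, $\nabla u_\varepsilon\overset{2}{\to}\nabla u+\chi$, $\limsup_{\varepsilon\to0}\mathcal E_\varepsilon(u_\varepsilon)\le\mathcal E_0(u,\chi)$, and in fact $\lim_{\varepsilon\to0}\mathcal E_\varepsilon(u_\varepsilon)=\mathcal E_0(u,\chi)$. -/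

import Mathlib

open MeasureTheory Filter Topology
open scoped ENNReal ContDiff

namespace TwoScale

/-- The physical space `ℝ^d` with its Euclidean norm. -/
abbrev Space (d : ℕ) : Type := EuclideanSpace ℝ (Fin d)

/-- A measure preserving action `τ = {τ_x}` of the additive group `ℝ^d` on `(Ω, P)`.

Joint measurability of `(ω, x) ↦ τ_x ω` is required up to `P ⊗ dx`-null sets: every preimage of a
measurable set is measurable for the completion of the product measure. This contains the case of a
map that is measurable for the product of the σ-algebra of `Ω` with the Lebesgue σ-algebra. -/
structure ShiftGroup (d : ℕ) {Ω : Type*} [MeasurableSpace Ω] (P : Measure Ω) where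
  /-- The map `τ_x`. -/
  shift : Space d → Ω → Ω
  shift_zero : shift 0 = id
  shift_add : ∀ x y, shift (x + y) = shift x ∘ shift y
  measurePreserving : ∀ x, MeasurePreserving (shift x) P P
  nullMeasurable : NullMeasurable (fun z : Ω × Space d => shift z.2 z.1) (P.prod volume)

section Spaces

variable {d : ℕ} {Ω : Type*} [MeasurableSpace Ω] {P : Measure Ω}

/-- The product measure `P ⊗ dx` on `Ω × Q`; Lebesgue measure is restricted to `Q`. -/
noncomputable abbrev prodMeasure (P : Measure Ω) (Q : Set (Space d)) : Measure (Ω × Space d) :=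
  P.prod (volume.restrict Q)

/-- The isometry `U_x φ = φ ∘ τ_x` of `L^p(Ω)`. -/
noncomputable def shiftOp (τ : ShiftGroup d P) (p : ℝ≥0∞) [Fact (1 ≤ p)] (x : Space d) :
    Lp ℝ p P →ₗᵢ[ℝ] Lp ℝ p P :=
  Lp.compMeasurePreservingₗᵢ ℝ (τ.shift x) (τ.measurePreserving x)

/-- `HasStochDeriv τ p i φ g`: `φ` lies in the domain of the generator `D_i` of the one-parameter
group `h ↦ U_{h e_i}` on `L^p(Ω)` and `D_i φ = g`; the limit is taken in the norm of `L^p(Ω)`. -/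
def HasStochDeriv (τ : ShiftGroup d P) (p : ℝ≥0∞) [Fact (1 ≤ p)] (i : Fin d)
    (φ g : Lp ℝ p P) : Prop :=
  Tendsto (fun h : ℝ => h⁻¹ • (shiftOp τ p (EuclideanSpace.single i h) φ - φ)) (𝓝[≠] 0) (𝓝 g)

/-- The range of the stochastic gradient `D = (D_1, …, D_d)`, a subspace of `L^p(Ω)^d`. -/
def stochGradRange (τ : ShiftGroup d P) (p : ℝ≥0∞) [Fact (1 ≤ p)] :
    Submodule ℝ (Lp (Space d) p P) where
  carrier := {G | ∃ φ : Lp ℝ p P, ∀ i : Fin d,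
    HasStochDeriv τ p i φ ((EuclideanSpace.proj i : Space d →L[ℝ] ℝ).compLpL p P G)}
  zero_mem' := ⟨0, fun i => by simp [HasStochDeriv]⟩
  add_mem' := by
    rintro G H ⟨φ, hφ⟩ ⟨ψ, hψ⟩
    refine ⟨φ + ψ, fun i => ?_⟩
    have := (hφ i).add (hψ i)
    rw [← map_add] at this
    refine this.congr fun h => ?_
    rw [map_add, ← smul_add]
    congr 1
    abel
  smul_mem' := by
    rintro c G ⟨φ, hφ⟩
    refine ⟨c • φ, fun i => ?_⟩
    have := (hφ i).const_smul c
    rw [← map_smul] at this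
    refine this.congr fun h => ?_
    rw [map_smul, ← smul_sub, smul_comm]

/-- `L^p_pot(Ω)`, the closure of the range of the stochastic gradient in `L^p(Ω)^d`. -/
noncomputable def LpPot (τ : ShiftGroup d P) (p : ℝ≥0∞) [Fact (1 ≤ p)] :
    Submodule ℝ (Lp (Space d) p P) :=
  (stochGradRange τ p).topologicalClosure

/-- `L^p_inv(Ω)`, the shift invariant elements of `L^p(Ω)`. -/
def LpInv (τ : ShiftGroup d P) (p : ℝ≥0∞) [Fact (1 ≤ p)] : Submodule ℝ (Lp ℝ p P) where
  carrier := {φ | ∀ x, shiftOp τ p x φ = φ}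
  zero_mem' := fun x => map_zero _
  add_mem' := fun {φ ψ} hφ hψ x => by rw [map_add, hφ x, hψ x]
  smul_mem' := fun c φ hφ x => by rw [map_smul, hφ x]

/-- `W^{1,p}_0(Q)`: the closure in `W^{1,p}(Q)` of the smooth functions with compact support in `Q`,
an element `η` being represented by the pair `(η, ∇η) ∈ L^p(Q) × L^p(Q)^d`. -/
noncomputable def sobolevZero (p : ℝ≥0∞) [Fact (1 ≤ p)] (Q : Set (Space d)) :
    Submodule ℝ (Lp ℝ p (volume.restrict Q) × Lp (Space d) p (volume.restrict Q)) :=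
  (Submodule.span ℝ {w | ∃ η : Space d → ℝ, ContDiff ℝ ∞ η ∧ HasCompactSupport η ∧ tsupport η ⊆ Q ∧
    w.1 =ᵐ[volume.restrict Q] η ∧ w.2 =ᵐ[volume.restrict Q] gradient η}).topologicalClosure

/-- `X ⊗ W^{1,p}_0(Q)` for a subspace `X` of `L^p(Ω)`: the closure of the span of the products
`φ(ω) η(x)` in `L^p(Ω; W^{1,p}(Q))`. An element `u` is represented by the pair
`(u, ∇u) ∈ L^p(Ω × Q) × L^p(Ω × Q)^d`. -/
noncomputable def randomSobolevZero (p : ℝ≥0∞) [Fact (1 ≤ p)] (Q : Set (Space d))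
    (X : Submodule ℝ (Lp ℝ p P)) :
    Submodule ℝ (Lp ℝ p (prodMeasure P Q) × Lp (Space d) p (prodMeasure P Q)) :=
  (Submodule.span ℝ {w | ∃ φ ∈ X, ∃ η ∈ sobolevZero p Q,
    w.1 =ᵐ[prodMeasure P Q] (fun z => φ z.1 * η.1 z.2) ∧
    w.2 =ᵐ[prodMeasure P Q] (fun z => φ z.1 • η.2 z.2)}).topologicalClosure

/-- `Y ⊗ L^p(Q)` for a subspace `Y` of `L^p(Ω)^d`: the closure of the span of the products
`ψ(ω) η(x)` in `L^p(Ω × Q)^d`. -/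
noncomputable def vectorTensorLp (p : ℝ≥0∞) [Fact (1 ≤ p)] (Q : Set (Space d))
    (Y : Submodule ℝ (Lp (Space d) p P)) :
    Submodule ℝ (Lp (Space d) p (prodMeasure P Q)) :=
  (Submodule.span ℝ {w : Lp (Space d) p (prodMeasure P Q) |
    ∃ ψ ∈ Y, ∃ η : Lp ℝ p (volume.restrict Q),
      w =ᵐ[prodMeasure P Q] (fun z => η z.2 • ψ z.1)}).topologicalClosure

end Spaces

section Unfolding

variable {d : ℕ} {Ω : Type*} [MeasurableSpace Ω] {P : Measure Ω}

/-- The map `(ω, x) ↦ (τ_{-x/ε} ω, x)`. -/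
noncomputable def unfoldMap (τ : ShiftGroup d P) (ε : ℝ) (z : Ω × Space d) : Ω × Space d :=
  (τ.shift (-(ε⁻¹ • z.2)) z.1, z.2)

theorem nullMeasurable_unfoldMap [IsProbabilityMeasure P] (τ : ShiftGroup d P) (Q : Set (Space d))
    (ε : ℝ) : NullMeasurable (unfoldMap τ ε) (prodMeasure P Q) := by
  have h1 : NullMeasurable (fun z : Ω × Space d => τ.shift (-(ε⁻¹ • z.2)) z.1)
      (prodMeasure P Q) := by
    rcases eq_or_ne ε 0 with rfl | hε
    · simp only [inv_zero, zero_smul, neg_zero, τ.shift_zero, id]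
      exact measurable_fst.nullMeasurable
    · have hq : Measure.QuasiMeasurePreserving (fun x : Space d => -(ε⁻¹ • x))
          (volume.restrict Q) volume := by
        refine ⟨by fun_prop, ?_⟩
        have h2 : (fun x : Space d => -(ε⁻¹ • x)) = fun x => (-ε⁻¹) • x := by
          funext x; rw [neg_smul]
        have h3 : (volume : Measure (Space d)).map (fun x => -(ε⁻¹ • x)) ≪ volume := by
          rw [h2, Measure.map_addHaar_smul volume (neg_ne_zero.2 (inv_ne_zero hε))]
          exact Measure.smul_absolutelyContinuous
        exact (Measure.absolutelyContinuous_of_le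
          (Measure.map_mono Measure.restrict_le_self (by fun_prop))).trans h3
      have hq' : Measure.QuasiMeasurePreserving
          (Prod.map id (fun x : Space d => -(ε⁻¹ • x)) : Ω × Space d → Ω × Space d)
          (P.prod (volume.restrict Q)) (P.prod volume) :=
        ⟨measurable_id.prodMap hq.measurable, by
          rw [← Measure.map_prod_map _ _ measurable_id hq.measurable, Measure.map_id]
          exact Measure.AbsolutelyContinuous.rfl.prod hq.absolutelyContinuous⟩
      exact τ.nullMeasurable.comp_quasiMeasurePreserving hq'
  have h1' : @Measurable (NullMeasurableSpace (Ω × Space d) (prodMeasure P Q)) Ω _ _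
      (fun z => τ.shift (-(ε⁻¹ • z.2)) z.1) := fun s hs => h1 hs
  have h2' : @Measurable (NullMeasurableSpace (Ω × Space d) (prodMeasure P Q)) (Space d) _ _
      (fun z => z.2) := fun s hs => (measurable_snd.nullMeasurable (μ := prodMeasure P Q)) hs
  exact fun s hs => (h1'.prodMk h2') hs

theorem lintegral_unfoldMap [IsProbabilityMeasure P] (τ : ShiftGroup d P) (Q : Set (Space d))
    (ε : ℝ) {h : Ω × Space d → ℝ≥0∞} (hh : Measurable h) :
    ∫⁻ z, h (unfoldMap τ ε z) ∂(prodMeasure P Q) = ∫⁻ z, h z ∂(prodMeasure P Q) := by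
  have hm : AEMeasurable (fun z => h (unfoldMap τ ε z)) (prodMeasure P Q) :=
    NullMeasurable.aemeasurable fun s hs => nullMeasurable_unfoldMap τ Q ε (hh hs)
  rw [lintegral_prod_symm _ hm, lintegral_prod_symm _ hh.aemeasurable]
  refine lintegral_congr fun x => ?_
  exact (τ.measurePreserving (-(ε⁻¹ • x))).lintegral_comp (hh.comp measurable_prodMk_right)

theorem ae_unfoldMap [IsProbabilityMeasure P] (τ : ShiftGroup d P) (Q : Set (Space d))
    (ε : ℝ) {q : Ω × Space d → Prop} (hq : ∀ᵐ z ∂(prodMeasure P Q), q z) :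
    ∀ᵐ z ∂(prodMeasure P Q), q (unfoldMap τ ε z) := by
  obtain ⟨t, hqt, ht, ht0⟩ := exists_measurable_superset_of_null hq
  have h1 := lintegral_unfoldMap τ Q ε
    ((measurable_const (a := (1 : ℝ≥0∞))).indicator ht)
  have h2 : ∀ z, t.indicator (fun _ => (1 : ℝ≥0∞)) (unfoldMap τ ε z) =
      (unfoldMap τ ε ⁻¹' t).indicator (fun _ => (1 : ℝ≥0∞)) z := fun z => rfl
  simp_rw [h2] at h1
  rw [lintegral_indicator_const₀ (nullMeasurable_unfoldMap τ Q ε ht),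
    lintegral_indicator_const₀ ht.nullMeasurableSet, one_mul, one_mul, ht0] at h1
  refine measure_mono_null (fun z hz => ?_) h1
  exact hqt hz

theorem memLp_unfoldMap [IsProbabilityMeasure P] (τ : ShiftGroup d P) (Q : Set (Space d))
    (ε : ℝ) {F : Type*} [NormedAddCommGroup F] {p : ℝ≥0∞} (hp : p ≠ ⊤)
    {u : Ω × Space d → F} (hu : MemLp u p (prodMeasure P Q)) :
    MemLp (fun z => u (unfoldMap τ ε z)) p (prodMeasure P Q) := by
  borelize F
  obtain ⟨v, hv, huv⟩ := hu.1
  have hae : (fun z => v (unfoldMap τ ε z)) =ᵐ[prodMeasure P Q] fun z => u (unfoldMap τ ε z) :=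
    ae_unfoldMap τ Q ε (huv.mono fun z hz => hz.symm)
  refine MemLp.ae_eq hae ⟨?_, ?_⟩
  · rw [aestronglyMeasurable_iff_nullMeasurable_separable]
    refine ⟨fun s hs => nullMeasurable_unfoldMap τ Q ε (hv.measurable hs), Set.range v,
      hv.isSeparable_range, Eventually.of_forall fun z => Set.mem_range_self _⟩
  · have hv2 : eLpNorm v p (prodMeasure P Q) < ⊤ := (hu.ae_eq huv).2
    rcases eq_or_ne p 0 with rfl | hp0
    · simp
    · rw [eLpNorm_lt_top_iff_lintegral_rpow_enorm_lt_top hp0 hp] at hv2 ⊢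
      have := lintegral_unfoldMap τ Q ε (h := fun z => ‖v z‖ₑ ^ p.toReal)
        (hv.enorm.pow_const _)
      rwa [this]

/-- The stochastic unfolding operator, `(T_ε u)(ω, x) = u(τ_{-x/ε} ω, x)`, on `L^p(Ω × Q; F)`. -/
noncomputable def unfold [IsProbabilityMeasure P] (τ : ShiftGroup d P) (Q : Set (Space d))
    {p : ℝ≥0∞} (hp : p ≠ ⊤) (ε : ℝ) {F : Type*} [NormedAddCommGroup F]
    (u : Lp F p (prodMeasure P Q)) : Lp F p (prodMeasure P Q) :=
  (memLp_unfoldMap τ Q ε hp (Lp.memLp u)).toLp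

/-- Weak two-scale convergence in the mean along a filter: `T_ε u_ε` converges to `u₀` weakly in
`L^p(Ω × Q; F)`, that is, against every continuous linear functional. -/
def WeakTwoScale [IsProbabilityMeasure P] (τ : ShiftGroup d P) (Q : Set (Space d))
    {p : ℝ≥0∞} [Fact (1 ≤ p)] (hp : p ≠ ⊤) {F : Type*} [NormedAddCommGroup F] [NormedSpace ℝ F]
    {ι : Type*} (l : Filter ι) (ε : ι → ℝ) (u : ι → Lp F p (prodMeasure P Q))
    (u₀ : Lp F p (prodMeasure P Q)) : Prop :=
  ∀ f : StrongDual ℝ (Lp F p (prodMeasure P Q)),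
    Tendsto (fun i => f (unfold τ Q hp (ε i) (u i))) l (𝓝 (f u₀))

/-- Strong two-scale convergence in the mean along a filter: `T_ε u_ε` converges to `u₀` in the norm
of `L^p(Ω × Q; F)`. -/
def StrongTwoScale [IsProbabilityMeasure P] (τ : ShiftGroup d P) (Q : Set (Space d))
    {p : ℝ≥0∞} [Fact (1 ≤ p)] (hp : p ≠ ⊤) {F : Type*} [NormedAddCommGroup F]
    {ι : Type*} (l : Filter ι) (ε : ι → ℝ) (u : ι → Lp F p (prodMeasure P Q))
    (u₀ : Lp F p (prodMeasure P Q)) : Prop :=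
  Tendsto (fun i => unfold τ Q hp (ε i) (u i)) l (𝓝 u₀)

end Unfolding

section Energies

variable {d : ℕ} {Ω : Type*} [MeasurableSpace Ω] {P : Measure Ω}

/-- The assumptions on the integrand `V(ω, x, F)`: measurability in `(ω, x)` (up to null sets),
convexity in `F`, and growth of order `p` from above and below. -/
structure IsConvexIntegrand (P : Measure Ω) (Q : Set (Space d)) (p : ℝ≥0∞)
    (V : Ω → Space d → Space d → ℝ) : Prop where
  aemeasurable : ∀ F, AEMeasurable (fun z : Ω × Space d => V z.1 z.2 F) (prodMeasure P Q)
  convex : ∀ᵐ z ∂(prodMeasure P Q), ConvexOn ℝ Set.univ (V z.1 z.2)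
  growth : ∃ C : ℝ, 0 < C ∧ ∀ᵐ z ∂(prodMeasure P Q), ∀ F : Space d,
    1 / C * ‖F‖ ^ p.toReal - C ≤ V z.1 z.2 F ∧ V z.1 z.2 F ≤ C * (‖F‖ ^ p.toReal + 1)

/-- The integrand `V(τ_{x/ε} ω, x, ∇u(ω, x))` of the oscillating energy, in terms of `G = ∇u`. -/
noncomputable def oscDensity (τ : ShiftGroup d P) (V : Ω → Space d → Space d → ℝ) (ε : ℝ)
    (G : Ω × Space d → Space d) (z : Ω × Space d) : ℝ :=
  V (τ.shift (ε⁻¹ • z.2) z.1) z.2 (G z)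

/-- The oscillating energy `E_ε(u) = ⟨∫_Q V(τ_{x/ε} ω, x, ∇u(ω, x)) dx⟩`, for `u` given as the pair
`(u, ∇u)`. -/
noncomputable def oscEnergy (τ : ShiftGroup d P) (Q : Set (Space d)) {p : ℝ≥0∞}
    (V : Ω → Space d → Space d → ℝ) (ε : ℝ)
    (u : Lp ℝ p (prodMeasure P Q) × Lp (Space d) p (prodMeasure P Q)) : ℝ :=
  ∫ z, oscDensity τ V ε u.2 z ∂(prodMeasure P Q)

/-- The integrand `V(ω, x, ∇u(ω, x) + χ(ω, x))` of the two-scale energy, in terms of `G = ∇u`. -/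
def twoScaleDensity (V : Ω → Space d → Space d → ℝ) (G χ : Ω × Space d → Space d)
    (z : Ω × Space d) : ℝ :=
  V z.1 z.2 (G z + χ z)

/-- The two-scale energy `E_0(u, χ) = ⟨∫_Q V(ω, x, ∇u(ω, x) + χ(ω, x)) dx⟩`, for `u` given as the
pair `(u, ∇u)`. -/
noncomputable def twoScaleEnergy (Q : Set (Space d)) {p : ℝ≥0∞} (V : Ω → Space d → Space d → ℝ)
    (u : Lp ℝ p (prodMeasure P Q) × Lp (Space d) p (prodMeasure P Q))
    (χ : Lp (Space d) p (prodMeasure P Q)) : ℝ :=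
  ∫ z, twoScaleDensity V u.2 χ z ∂(prodMeasure P Q)

end Energies

end TwoScale

open TwoScale

/-! Unfolding turns the oscillating problem into one with a fixed integrand. The map (ω, x) ↦
(τ_{-x/ε} ω, x) preserves integrals, so `oscEnergy_eq` writes E_ε(u) as I(T_ε ∇u), where I(G) = ⟨∫_Q
V(ω, x, G) dx⟩ is a convex and continuous functional on L^p. Weak limits of T_ε ∇u_ε then give the
liminf inequality, because closed convex sets are weakly closed, and strong limits give convergence
of the energies. It remains to identify the weak limits of (T_ε u_ε, T_ε ∇u_ε) and to reach each of
them strongly.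

Compactness rests on one identity. For a test function η let M_η u = ∫_Q η(x) u(·, x) dx, an element
of L^p(Ω). Unfolding acts on the slice at x as U_{-x/ε}, and an integration by parts in x gives D_i
M_η(T_ε u) = ε (M_η(T_ε ∂_i u) + M_{∂_i η}(T_ε u)), which is `hasStochDeriv_testAvg_tensorPair`. Let
(v, G) be the weak limit of a bounded sequence. The right side is O(ε), so the averages of v are
shift invariant (`testAvg_mem_LpInv_of_weakTendsto`). Divided by ε, the identity says that the
vector with components M_η(T_ε ∂_i u) + M_{∂_i η}(T_ε u) lies in L^p_pot
(`sum_incl_testedDeriv_mem_LpPot`), and this survives weak limits. The mean ergodic projection A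
onto L^p_inv (`exists_invariantProjection`) does not see shifts, so, applied slicewise, A T_ε u_ε =
A u_ε. Hence A(v, G) is an element (u, ∇u) of L^p_inv ⊗ W^{1,p}_0 with u = v. As u can be integrated
by parts against η, M_η(G - ∇u) is exactly the vector known to be in L^p_pot, so χ = G - ∇u is the
second part of the limit (`exists_twoScale_limit`). Bounds come from the growth of V and Poincaré's
inequality; weak subsequences come from the Riesz representation of the dual of L^p and
Banach-Alaoglu.

For recovery, u itself is fixed by T_ε. For χ = η Dφ the corrector is ε η(x) φ(τ_{x/ε} ω). To place
it in L^p ⊗ W^{1,p}_0, φ is first mollified along the action, with a kernel g at scale c, and the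
corrector is then a superposition over y of the products φ(τ_{cy} ω) η(x) g(y - x/(cε)); this is
`exists_unfoldPair_eq`. The fields that can be approximated in this way form a closed subspace,
`correctable`, and density gives all of L^p_pot ⊗ L^p(Q). -/

namespace TwoScale

/-! ### Riesz representation and weak sequential compactness in L^p of a finite measure. -/

section Duality

variable {α : Type*} [MeasurableSpace α] {μ : Measure α} [IsFiniteMeasure μ]

/-- This convergence of sets makes the indicators of finite unions converge in L^p, which is
countable additivity of A ↦ f(1_A). -/
theorem tendsto_measure_biUnion_symmDiff_iUnion {A : ℕ → Set α} (hA : ∀ i, MeasurableSet (A i))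
    (hd : Pairwise (Function.onFun Disjoint A)) :
    Tendsto (fun F : Finset ℕ => μ (symmDiff (⋃ i ∈ F, A i) (⋃ i, A i))) atTop (𝓝 0) := by
  have h1 : Tendsto (fun F : Finset ℕ => μ (⋃ i ∈ F, A i)) atTop (𝓝 (μ (⋃ i, A i))) := by
    rw [measure_iUnion hd hA]
    refine Tendsto.congr (fun F => ?_) (ENNReal.summable (f := fun i => μ (A i))).hasSum
    rw [measure_biUnion_finset (fun i _ j _ hij => hd hij) (fun i _ => hA i)]
  have h2 : Tendsto (fun F : Finset ℕ => μ (⋃ i, A i) - μ (⋃ i ∈ F, A i)) atTop (𝓝 0) := by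
    have := ENNReal.Tendsto.sub (tendsto_const_nhds (x := μ (⋃ i, A i))) h1
      (Or.inl (measure_ne_top _ _))
    simpa using this
  refine h2.congr fun F => ?_
  have hsub : (⋃ i ∈ F, A i) ⊆ ⋃ i, A i := Set.iUnion₂_subset_iUnion _ _
  rw [← measure_sdiff hsub (Finset.measurableSet_biUnion _ fun i _ => hA i).nullMeasurableSet
    (measure_ne_top _ _)]
  congr 1
  rw [Set.symmDiff_def, Set.sdiff_eq_empty.2 hsub, Set.empty_union]

open Classical in
/-- The signed measure `A ↦ f (1_A)` of a continuous functional on `L^p`. -/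
noncomputable def functionalMeasure {p : ℝ≥0∞} [Fact (1 ≤ p)] (hp : p ≠ ⊤)
    (f : StrongDual ℝ (Lp ℝ p μ)) : SignedMeasure α where
  measureOf' A := if hA : MeasurableSet A then
    f (indicatorConstLp p hA (measure_ne_top μ A) (1 : ℝ)) else 0
  empty' := by simp [indicatorConstLp_empty]
  not_measurable' := fun A hA => by simp [hA]
  m_iUnion' := fun A hA hd => by
    have hU : MeasurableSet (⋃ i, A i) := MeasurableSet.iUnion hA
    have hF : ∀ F : Finset ℕ, MeasurableSet (⋃ i ∈ F, A i) := fun F =>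
      Finset.measurableSet_biUnion _ fun i _ => hA i
    have h1 := tendsto_indicatorConstLp_set (p := p) (μ := μ) (c := (1 : ℝ)) hp
      (ht := hF) (hμt := fun F => measure_ne_top μ _) (hs := hU) (hμs := measure_ne_top μ _)
      (tendsto_measure_biUnion_symmDiff_iUnion hA hd)
    have h2 := (f.continuous.tendsto _).comp h1
    simp only [hU, hA, dif_pos]
    refine Tendsto.congr (fun F => ?_) h2
    simp only [Function.comp]
    have : indicatorConstLp p (hF F) (measure_ne_top μ _) (1 : ℝ) =
        ∑ i ∈ F, indicatorConstLp p (hA i) (measure_ne_top μ _) (1 : ℝ) := by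
      induction F using Finset.induction_on with
      | empty =>
        simp [indicatorConstLp_empty]
      | insert a s has ih =>
        rw [Finset.sum_insert has, ← ih, ← indicatorConstLp_disjoint_union]
        · congr 1
          simp
        · rw [Set.disjoint_iUnion₂_right]
          intro j hj
          exact hd (by rintro rfl; exact has hj)
    rw [this, map_sum]

theorem functionalMeasure_apply {p : ℝ≥0∞} [Fact (1 ≤ p)] (hp : p ≠ ⊤)
    (f : StrongDual ℝ (Lp ℝ p μ)) {A : Set α} (hA : MeasurableSet A) :
    functionalMeasure hp f A = f (indicatorConstLp p hA (measure_ne_top μ A) (1 : ℝ)) := by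
  exact dif_pos hA

/-- The signed measure A ↦ f(1_A) is absolutely continuous, since the indicator of a null set is
zero in L^p. The density is its Radon-Nikodym derivative; linearity extends the formula to simple
functions. -/
theorem exists_integrable_density {p : ℝ≥0∞} [Fact (1 ≤ p)] (hp : p ≠ ⊤)
    (f : StrongDual ℝ (Lp ℝ p μ)) :
    ∃ g : α → ℝ, Measurable g ∧ Integrable g μ ∧
      ∀ (u : SimpleFunc α ℝ) (hu : MemLp u p μ), f (hu.toLp u) = ∫ x, u x * g x ∂μ := by
  set s := functionalMeasure hp f with hs
  have hac : s ≪ᵥ μ.toENNRealVectorMeasure := by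
    refine VectorMeasure.AbsolutelyContinuous.mk fun A hA h0 => ?_
    rw [Measure.toENNRealVectorMeasure_apply_measurable hA] at h0
    rw [hs, functionalMeasure_apply hp f hA]
    have : indicatorConstLp p hA (measure_ne_top μ A) (1 : ℝ) = 0 := by
      rw [Lp.eq_zero_iff_ae_eq_zero]
      refine indicatorConstLp_coeFn.trans ?_
      exact indicator_meas_zero h0
    rw [this, map_zero]
  have hg := SignedMeasure.integrable_rnDeriv s μ
  have hd := SignedMeasure.withDensityᵥ_rnDeriv_eq s μ hac
  refine ⟨s.rnDeriv μ, SignedMeasure.measurable_rnDeriv s μ, hg, fun u => ?_⟩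
  have hbd : ∀ v : SimpleFunc α ℝ, Integrable (fun x => v x * s.rnDeriv μ x) μ := by
    intro v
    obtain ⟨C, hC⟩ := v.exists_forall_norm_le
    exact hg.bdd_mul v.stronglyMeasurable.aestronglyMeasurable (c := C)
      (Eventually.of_forall hC)
  induction u using SimpleFunc.induction with
  | const c hA =>
    rename_i A
    intro hu
    have h1 : hu.toLp _ = c • indicatorConstLp p hA (measure_ne_top μ A) (1 : ℝ) := by
      rw [indicatorConstLp, ← MemLp.toLp_const_smul]
      refine MemLp.toLp_congr _ _ (Eventually.of_forall fun x => ?_)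
      by_cases hx : x ∈ A <;> simp [hx]
    rw [h1, map_smul, ← functionalMeasure_apply hp f hA, ← hs, ← hd,
      withDensityᵥ_apply hg hA, smul_eq_mul, ← integral_const_mul, ← integral_indicator hA, hd]
    refine integral_congr_ae (Eventually.of_forall fun x => ?_)
    by_cases hx : x ∈ A <;> simp [hx]
  | add hdis hu hv =>
    rename_i u v
    intro huv
    have hu' : MemLp u p μ := u.memLp_of_isFiniteMeasure p μ
    have hv' : MemLp v p μ := v.memLp_of_isFiniteMeasure p μ
    have h1 : huv.toLp _ = hu'.toLp u + hv'.toLp v := by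
      rw [← MemLp.toLp_add]; rfl
    rw [h1, map_add, hu hu', hv hv', ← integral_add (hbd u) (hbd v)]
    refine integral_congr_ae (Eventually.of_forall fun x => ?_)
    simp [add_mul]

/-- Classically one tests f with g|g|^{q-2}, which need not be in L^p. Here simple functions s_n
approximating g take its place: s_n|s_n|^{q-2} is a legitimate test function, and it bounds the L^q
norm of s_n by 2‖f‖ uniformly in n. -/
theorem memLp_of_functional_density {p q : ℝ≥0∞} [Fact (1 ≤ p)] [Fact (1 ≤ q)]
    [hpq : ENNReal.HolderConjugate p q] (hp : p ≠ ⊤) (hq : q ≠ ⊤)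
    (f : StrongDual ℝ (Lp ℝ p μ)) {g : α → ℝ} (hgm : Measurable g) (hg : Integrable g μ)
    (hfg : ∀ (u : SimpleFunc α ℝ) (hu : MemLp u p μ), f (hu.toLp u) = ∫ x, u x * g x ∂μ) :
    MemLp g q μ := by
  have hconj : p.toReal.HolderConjugate q.toReal :=
    ENNReal.HolderConjugate.toReal_of_ne_top hp hq
  have hp0 : p ≠ 0 := fun h => by simpa [h] using hconj.pos
  have hq0 : q ≠ 0 := fun h => by simpa [h] using hconj.symm.pos
  -- The base point 0 of the approximation is what yields |s_n - g| ≤ |g|.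
  set s : ℕ → SimpleFunc α ℝ := fun n => SimpleFunc.approxOn g hgm Set.univ 0 (Set.mem_univ _) n
  have hs : ∀ n x, |s n x - g x| ≤ |g x| := by
    intro n x
    have := SimpleFunc.edist_approxOn_le hgm (Set.mem_univ (0 : ℝ)) x n
    rw [edist_dist, edist_dist, ENNReal.ofReal_le_ofReal_iff dist_nonneg] at this
    simpa [Real.dist_eq] using this
  have hbound : ∀ n, eLpNorm (s n) q μ ≤ ENNReal.ofReal (2 * ‖f‖) := by
    intro n
    set φ : ℝ → ℝ := fun t => t * |t| ^ (q.toReal - 2) with hφ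
    have hφ2 : ∀ t, φ t * t = |t| ^ q.toReal := by
      intro t
      rcases eq_or_ne t 0 with rfl | ht
      · simp [hφ, Real.zero_rpow hconj.symm.pos.ne']
      · have h0 : 0 < |t| := abs_pos.2 ht
        have h2 : t * t = |t| ^ (2 : ℝ) := by
          rw [Real.rpow_two, sq_abs, sq]
        calc φ t * t = |t| ^ (q.toReal - 2) * (t * t) := by simp only [hφ]; ring
          _ = |t| ^ q.toReal := by rw [h2, ← Real.rpow_add h0]; congr 1; ring
    have hφp : ∀ t, |φ t| ^ p.toReal = |t| ^ q.toReal := by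
      intro t
      rcases eq_or_ne t 0 with rfl | ht
      · simp [hφ, Real.zero_rpow hconj.symm.pos.ne', Real.zero_rpow hconj.pos.ne']
      · have h0 : 0 < |t| := abs_pos.2 ht
        have h1 : |φ t| = |t| ^ (q.toReal - 1) := by
          simp only [hφ]
          rw [abs_mul, abs_of_nonneg (Real.rpow_nonneg h0.le _)]
          nth_rewrite 1 [← Real.rpow_one |t|]
          rw [← Real.rpow_add h0]
          congr 1; ring
        rw [h1, ← Real.rpow_mul h0.le, hconj.symm.sub_one_mul_conj]
    set u : SimpleFunc α ℝ := (s n).map φ with hu_def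
    have hu : MemLp u p μ := u.memLp_of_isFiniteMeasure p μ
    have hsn : MemLp (s n) q μ := (s n).memLp_of_isFiniteMeasure q μ
    set A := ∫ x, ‖s n x‖ ^ q.toReal ∂μ with hA
    have hA0 : 0 ≤ A := integral_nonneg fun x => by positivity
    have h1 : f (hu.toLp u) ≤ ‖f‖ * A ^ p.toReal⁻¹ := by
      refine (le_abs_self _).trans ((f.le_opNorm _).trans (le_of_eq ?_))
      rw [Lp.norm_toLp, hu.eLpNorm_eq_integral_rpow_norm hp0 hp,
        ENNReal.toReal_ofReal (by positivity)]
      congr 2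
      refine integral_congr_ae (Eventually.of_forall fun x => ?_)
      simpa [hu_def] using hφp (s n x)
    have h2 : A / 2 ≤ f (hu.toLp u) := by
      rw [hfg, ← integral_div]
      refine integral_mono ?_ ?_ fun x => ?_
      · exact (hsn.integrable_norm_rpow hq0 hq).div_const 2
      · obtain ⟨C, hC⟩ := u.exists_forall_norm_le
        exact hg.bdd_mul u.stronglyMeasurable.aestronglyMeasurable (c := C)
          (Eventually.of_forall hC)
      -- (s_n - g)² ≤ g² expands to s_n² ≤ 2 s_n g, so replacing g by s_n in the pairing costs only
      -- a factor 2.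
      · have h3 := sq_le_sq.2 (hs n x)
        have h4 : 0 ≤ |s n x| ^ (q.toReal - 2) := by positivity
        have h5 : s n x * s n x ≤ 2 * (s n x * g x) := by nlinarith
        have h6 := mul_le_mul_of_nonneg_left h5 h4
        have h7 := hφ2 (s n x)
        simp only [hu_def, SimpleFunc.map_apply, Real.norm_eq_abs, ← h7]
        simp only [hφ]
        nlinarith
    rw [hsn.eLpNorm_eq_integral_rpow_norm hq0 hq]
    refine ENNReal.ofReal_le_ofReal ?_
    change A ^ q.toReal⁻¹ ≤ _
    rcases hA0.eq_or_lt with h0 | h0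
    · rw [← h0, Real.zero_rpow (inv_ne_zero hconj.symm.pos.ne')]
      positivity
    · have h3 : A = A ^ p.toReal⁻¹ * A ^ q.toReal⁻¹ := by
        rw [← Real.rpow_add h0, hconj.inv_add_inv_eq_one, Real.rpow_one]
      have h4 : 0 < A ^ p.toReal⁻¹ := Real.rpow_pos_of_pos h0 _
      have h5 : A ^ p.toReal⁻¹ * A ^ q.toReal⁻¹ ≤ A ^ p.toReal⁻¹ * (2 * ‖f‖) := by
        rw [← h3]; linarith
      exact le_of_mul_le_mul_left h5 h4
  refine ⟨hgm.aestronglyMeasurable, ?_⟩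
  -- Fatou's lemma carries the uniform bound to the pointwise limit g.
  refine (Lp.eLpNorm_lim_le_liminf_eLpNorm (f := fun n => s n)
    (fun n => (s n).stronglyMeasurable.aestronglyMeasurable) g
    (Eventually.of_forall fun x => SimpleFunc.tendsto_approxOn hgm (Set.mem_univ _)
      (by simp))).trans_lt ?_
  exact lt_of_le_of_lt (liminf_le_of_frequently_le' (Frequently.of_forall hbound))
    ENNReal.ofReal_lt_top

/-- A continuous functional on `L^p` of a finite measure is the integral against a function in the
conjugate space `L^q`. -/
theorem exists_lpPairing_eq {p q : ℝ≥0∞} [Fact (1 ≤ p)] [Fact (1 ≤ q)]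
    [hpq : ENNReal.HolderConjugate q p] (hp : p ≠ ⊤) (hq : q ≠ ⊤)
    (f : StrongDual ℝ (Lp ℝ p μ)) :
    ∃ g : Lp ℝ q μ, (ContinuousLinearMap.mul ℝ ℝ).lpPairing μ q p g = f := by
  have : ENNReal.HolderConjugate p q := hpq.symm
  obtain ⟨g, hgm, hg, hfg⟩ := exists_integrable_density hp f
  have hgq := memLp_of_functional_density hp hq f hgm hg hfg
  refine ⟨hgq.toLp g, ?_⟩
  ext u
  refine Lp.induction hp (fun u => (ContinuousLinearMap.mul ℝ ℝ).lpPairing μ q p (hgq.toLp g) u =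
    f u) ?_ ?_ ?_ u
  · intro c s hs hμs
    set v : SimpleFunc α ℝ := SimpleFunc.piecewise s hs (SimpleFunc.const α c)
      (SimpleFunc.const α 0)
    have hv : MemLp v p μ := v.memLp_of_isFiniteMeasure p μ
    have h1 : (Lp.simpleFunc.indicatorConst p hs hμs.ne c : Lp ℝ p μ) = hv.toLp v := by
      rw [Lp.simpleFunc.coe_indicatorConst, indicatorConstLp]
      refine MemLp.toLp_congr _ _ (Eventually.of_forall fun x => ?_)
      by_cases hx : x ∈ s <;> simp [v, hx]
    rw [h1, hfg, ContinuousLinearMap.lpPairing_eq_integral]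
    refine integral_congr_ae ?_
    filter_upwards [hgq.coeFn_toLp, hv.coeFn_toLp] with x h2 h3
    rw [h2, h3, ContinuousLinearMap.mul_apply', mul_comm]
  · intro u v hu hv _ h1 h2
    rw [map_add, map_add, h1, h2]
  · exact isClosed_eq (ContinuousLinearMap.continuous _) f.continuous

/-- Bounded sequences in `L^p` have weakly convergent subsequences. -/
theorem exists_weak_subseq {p q : ℝ≥0∞} [Fact (1 ≤ p)] [Fact (1 ≤ q)]
    [hpq : ENNReal.HolderConjugate p q] (hp : p ≠ ⊤) (hq : q ≠ ⊤)
    [TopologicalSpace.SeparableSpace (Lp ℝ q μ)]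
    (u : ℕ → Lp ℝ p μ) {C : ℝ} (hu : ∀ n, ‖u n‖ ≤ C) :
    ∃ (v : Lp ℝ p μ) (k : ℕ → ℕ), StrictMono k ∧
      ∀ f : StrongDual ℝ (Lp ℝ p μ), Tendsto (fun n => f (u (k n))) atTop (𝓝 (f v)) := by
  have : ENNReal.HolderConjugate q p := hpq.symm
  set B := (ContinuousLinearMap.mul ℝ ℝ).lpPairing μ p q
  -- L^p is viewed inside the dual of L^q, whose balls are weak-* sequentially compact because L^q
  -- is separable. The limit functional is an element of L^p by Riesz with the exponents exchanged,
  -- and Riesz again turns weak-* into weak convergence.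
  have hsc := WeakDual.isSeqCompact_closedBall ℝ (Lp ℝ q μ) 0 (‖B‖ * C)
  obtain ⟨Λ, -, k, hk, hlim⟩ := hsc (x := fun n => StrongDual.toWeakDual (B (u n))) (fun n => by
    simp only [Set.mem_preimage, mem_closedBall_zero_iff]
    exact (B.le_opNorm _).trans (mul_le_mul_of_nonneg_left (hu n) (norm_nonneg _)))
  obtain ⟨v, hv⟩ := exists_lpPairing_eq (q := p) hq hp (WeakDual.toStrongDual Λ)
  refine ⟨v, k, hk, fun f => ?_⟩
  obtain ⟨g, hg⟩ := exists_lpPairing_eq (q := q) hp hq f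
  have hfB : ∀ w, f w = B w g := by
    intro w
    rw [← hg, ContinuousLinearMap.lpPairing_eq_integral, ContinuousLinearMap.lpPairing_eq_integral]
    refine integral_congr_ae (Eventually.of_forall fun x => ?_)
    simp [mul_comm]
  have h1 := ((WeakDual.eval_continuous g).tendsto Λ).comp hlim
  simp only [hfB]
  have h2 : B v g = Λ g := by rw [hv]; rfl
  rw [h2]
  exact h1

end Duality

/-! ### Weak convergence in normed spaces. -/

section WeakConvergence

variable {E F : Type*} [NormedAddCommGroup E] [NormedSpace ℝ E]
  [NormedAddCommGroup F] [NormedSpace ℝ F]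

/-- Weak convergence in a normed space. -/
def WeakTendsto {ι : Type*} (u : ι → E) (l : Filter ι) (v : E) : Prop :=
  ∀ f : StrongDual ℝ E, Tendsto (fun i => f (u i)) l (𝓝 (f v))

theorem WeakTendsto.map {ι : Type*} {u : ι → E} {l : Filter ι} {v : E} (h : WeakTendsto u l v)
    (A : E →L[ℝ] F) : WeakTendsto (fun i => A (u i)) l (A v) :=
  fun f => h (f.comp A)

theorem WeakTendsto.add {ι : Type*} {u u' : ι → E} {l : Filter ι} {v v' : E}
    (h : WeakTendsto u l v) (h' : WeakTendsto u' l v') :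
    WeakTendsto (fun i => u i + u' i) l (v + v') := fun f => by
  simpa using (h f).add (h' f)

theorem WeakTendsto.comp {ι κ : Type*} {u : ι → E} {l : Filter ι} {l' : Filter κ} {v : E}
    (h : WeakTendsto u l v) {k : κ → ι} (hk : Tendsto k l' l) :
    WeakTendsto (u ∘ k) l' v := fun f => (h f).comp hk

theorem WeakTendsto.prodMk {ι : Type*} {u : ι → E} {w : ι → F} {l : Filter ι} {v : E} {z : F}
    (h : WeakTendsto u l v) (h' : WeakTendsto w l z) :
    WeakTendsto (fun i => (u i, w i)) l (v, z) := by
  have := (h.map (ContinuousLinearMap.inl ℝ E F)).add (h'.map (ContinuousLinearMap.inr ℝ E F))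
  simpa using this

theorem _root_.Filter.Tendsto.weakTendsto {ι : Type*} {u : ι → E} {l : Filter ι} {v : E}
    (h : Tendsto u l (𝓝 v)) : WeakTendsto u l v :=
  fun f => (f.continuous.tendsto v).comp h

/-- Mazur: a functional that strictly separates v from s would eventually keep u away from s. Every
passage of a linear or convex constraint to a weak limit below goes through this. -/
theorem WeakTendsto.mem_of_frequently {ι : Type*} {u : ι → E} {l : Filter ι} {v : E}
    (h : WeakTendsto u l v) {s : Set E} (hs : Convex ℝ s) (hc : IsClosed s)
    (hmem : ∃ᶠ i in l, u i ∈ s) : v ∈ s := by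
  by_contra hv
  obtain ⟨f, c, h1, h2⟩ := geometric_hahn_banach_closed_point hs hc hv
  have h3 : ∀ᶠ i in l, c < f (u i) := (h f).eventually (lt_mem_nhds h2)
  obtain ⟨i, hi, hi'⟩ := (hmem.and_eventually h3).exists
  exact (h1 _ hi).not_gt hi'

theorem WeakTendsto.unique {ι : Type*} {u : ι → E} {l : Filter ι} [l.NeBot] {v w : E}
    (h : WeakTendsto u l v) (h' : WeakTendsto u l w) : v = w := by
  by_contra hne
  obtain ⟨f, hf⟩ := geometric_hahn_banach_point_point (E := E) hne
  exact hf.ne (tendsto_nhds_unique (h f) (h' f))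

end WeakConvergence

/-! ### A measurability criterion through distances. -/

/-- By second countability an open set is a countable union of balls, and the preimage of a ball is
null measurable because the distance to its centre is. It applies to L^p(Ω)-valued maps, whose
distances are integrals and hence measurable by Tonelli. -/
theorem aestronglyMeasurable_of_edist {Y X : Type*} [MeasurableSpace Y] {ν : Measure Y}
    [PseudoMetricSpace X] [SecondCountableTopology X] {f : Y → X}
    (hf : ∀ a, AEMeasurable (fun y => edist (f y) a) ν) : AEStronglyMeasurable f ν := by
  borelize X
  refine AEMeasurable.aestronglyMeasurable ?_
  refine NullMeasurable.aemeasurable ?_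
  have h : @Measurable (NullMeasurableSpace Y ν) X _ _ f := by
    refine measurable_of_isOpen fun s hs => ?_
    change NullMeasurableSet (f ⁻¹' s) ν
    have h1 : ∀ x : s, ∃ r : ℝ≥0∞, 0 < r ∧ Metric.eball (x : X) r ⊆ s := fun x =>
      EMetric.isOpen_iff.1 hs x x.2
    choose r hr0 hr using h1
    obtain ⟨T, hTc, hT⟩ := TopologicalSpace.isOpen_iUnion_countable
      (fun x : s => Metric.eball (x : X) (r x)) fun x => Metric.isOpen_eball
    have h2 : s = ⋃ x ∈ T, Metric.eball (x : X) (r x) := by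
      rw [hT]
      refine Set.Subset.antisymm (fun x hx => ?_) (Set.iUnion_subset hr)
      exact Set.mem_iUnion.2 ⟨⟨x, hx⟩, Metric.mem_eball_self (hr0 _)⟩
    rw [h2, Set.preimage_iUnion₂]
    exact NullMeasurableSet.biUnion hTc fun x _ =>
      (hf x).nullMeasurable (measurableSet_Iio (a := r x))
  exact fun s hs => h hs

/-! ### The isomorphism L^p(Ω × Y) ≃ L^p(Y; L^p(Ω)). -/

section Slice

variable {Ω Y E : Type*} [MeasurableSpace Ω] [MeasurableSpace Y] {P : Measure Ω} {ν : Measure Y}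
  [SFinite P] [SFinite ν] [NormedAddCommGroup E]
  {p : ℝ≥0∞} [Fact (1 ≤ p)] [Fact (p ≠ ⊤)]

theorem exponent_ne_zero (p : ℝ≥0∞) [h : Fact (1 ≤ p)] : p ≠ 0 := (zero_lt_one.trans_le h.out).ne'

theorem exponent_toReal_pos (p : ℝ≥0∞) [Fact (1 ≤ p)] [h : Fact (p ≠ ⊤)] : 0 < p.toReal :=
  ENNReal.toReal_pos (exponent_ne_zero p) h.out

open Classical in
/-- The slice `u(·, y)` as an element of `L^p(Ω)`. -/
noncomputable def sliceFun (u : Lp E p (P.prod ν)) (y : Y) : Lp E p P :=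
  if h : MemLp (fun w => u (w, y)) p P then h.toLp _ else 0

theorem ae_memLp_slice {u : Ω × Y → E} (hu : MemLp u p (P.prod ν)) :
    ∀ᵐ y ∂ν, MemLp (fun w => u (w, y)) p P := by
  have h1 : ∀ᵐ y ∂ν, AEStronglyMeasurable (fun w => u (w, y)) P :=
    hu.1.prod_swap.prodMk_left
  have h2 := hu.2
  rw [eLpNorm_lt_top_iff_lintegral_rpow_enorm_lt_top (exponent_ne_zero p) (Fact.out),
    lintegral_prod_symm _ (hu.1.enorm.pow_const _)] at h2
  have h3 := ae_lt_top' ((hu.1.enorm.pow_const p.toReal).prod_swap.lintegral_prod_right') h2.ne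
  filter_upwards [h1, h3] with y hy1 hy3
  refine ⟨hy1, ?_⟩
  rw [eLpNorm_lt_top_iff_lintegral_rpow_enorm_lt_top (exponent_ne_zero p) (Fact.out)]
  exact hy3

theorem ae_ae_of_ae_prod_swap {q : Ω × Y → Prop} (h : ∀ᵐ z ∂(P.prod ν), q z) :
    ∀ᵐ y ∂ν, ∀ᵐ w ∂P, q (w, y) := by
  have h1 : ∀ᵐ z ∂(ν.prod P), q z.swap := by
    have := (Measure.measurePreserving_swap (μ := ν) (ν := P)).quasiMeasurePreserving.ae h
    exact this
  exact Measure.ae_ae_of_ae_prod h1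

theorem sliceFun_coeFn (u : Lp E p (P.prod ν)) :
    ∀ᵐ y ∂ν, sliceFun u y =ᵐ[P] fun w => u (w, y) := by
  filter_upwards [ae_memLp_slice (Lp.memLp u)] with y hy
  rw [sliceFun, dif_pos hy]
  exact hy.coeFn_toLp

theorem sliceFun_ae_eq {u : Lp E p (P.prod ν)} {f : Y → Lp E p P}
    (h : ∀ᵐ y ∂ν, (fun w => u (w, y)) =ᵐ[P] f y) : sliceFun u =ᵐ[ν] f := by
  filter_upwards [h, sliceFun_coeFn u] with y h1 h2
  exact Lp.ext (h2.trans h1)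

theorem enorm_rpow_eq_lintegral (φ : Lp E p P) :
    ‖φ‖ₑ ^ p.toReal = ∫⁻ w, ‖φ w‖ₑ ^ p.toReal ∂P := by
  rw [Lp.enorm_def, eLpNorm_eq_lintegral_rpow_enorm_toReal (exponent_ne_zero p) (Fact.out),
    ← ENNReal.rpow_mul, one_div_mul_cancel (exponent_toReal_pos p).ne', ENNReal.rpow_one]

theorem aestronglyMeasurable_sliceFun [SecondCountableTopology (Lp E p P)]
    (u : Lp E p (P.prod ν)) : AEStronglyMeasurable (sliceFun u) ν := by
  refine aestronglyMeasurable_of_edist fun a => ?_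
  have h1 : (fun y => edist (sliceFun u y) a) =ᵐ[ν]
      fun y => (∫⁻ w, ‖u (w, y) - a w‖ₑ ^ p.toReal ∂P) ^ (1 / p.toReal) := by
    filter_upwards [sliceFun_coeFn u] with y hy
    rw [edist_eq_enorm_sub, Lp.enorm_def,
      eLpNorm_eq_lintegral_rpow_enorm_toReal (exponent_ne_zero p) (Fact.out)]
    congr 1
    refine lintegral_congr_ae ?_
    filter_upwards [hy, Lp.coeFn_sub (sliceFun u y) a] with w h2 h3
    rw [h3, Pi.sub_apply, h2]
  refine AEMeasurable.congr ?_ h1.symm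
  refine AEMeasurable.pow_const ?_ _
  have h2 : AEStronglyMeasurable (fun z : Ω × Y => u z - a z.1) (P.prod ν) :=
    (Lp.aestronglyMeasurable u).sub (Lp.aestronglyMeasurable a).comp_fst
  exact (h2.enorm.pow_const p.toReal).prod_swap.lintegral_prod_right'

theorem eLpNorm_sliceFun (u : Lp E p (P.prod ν)) :
    eLpNorm (sliceFun u) p ν = eLpNorm u p (P.prod ν) := by
  rw [eLpNorm_eq_lintegral_rpow_enorm_toReal (exponent_ne_zero p) (Fact.out),
    eLpNorm_eq_lintegral_rpow_enorm_toReal (exponent_ne_zero p) (Fact.out),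
    lintegral_prod_symm _ ((Lp.aestronglyMeasurable u).enorm.pow_const _)]
  congr 1
  refine lintegral_congr_ae ?_
  filter_upwards [sliceFun_coeFn u] with y hy
  rw [enorm_rpow_eq_lintegral]
  refine lintegral_congr_ae ?_
  filter_upwards [hy] with w h1
  rw [h1]

variable [SecondCountableTopology (Lp E p P)]

theorem memLp_sliceFun (u : Lp E p (P.prod ν)) : MemLp (sliceFun u) p ν :=
  ⟨aestronglyMeasurable_sliceFun u, by rw [eLpNorm_sliceFun]; exact Lp.eLpNorm_lt_top u⟩

variable [NormedSpace ℝ E]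

/-- The isometric embedding `L^p(Ω × Y; E) → L^p(Y; L^p(Ω; E))`. -/
noncomputable def sliceₗᵢ : Lp E p (P.prod ν) →ₗᵢ[ℝ] Lp (Lp E p P) p ν where
  toFun u := (memLp_sliceFun u).toLp _
  map_add' u v := by
    rw [← MemLp.toLp_add]
    refine MemLp.toLp_congr _ _ (sliceFun_ae_eq ?_)
    filter_upwards [ae_ae_of_ae_prod_swap (Lp.coeFn_add u v), sliceFun_coeFn u, sliceFun_coeFn v]
      with y h1 h2 h3
    filter_upwards [h1, h2, h3, Lp.coeFn_add (sliceFun u y) (sliceFun v y)] with w h1 h2 h3 h4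
    rw [h1, Pi.add_apply, Pi.add_apply, h4, Pi.add_apply, h2, h3]
  map_smul' c u := by
    simp only [RingHom.id_apply]
    rw [← MemLp.toLp_const_smul]
    refine MemLp.toLp_congr _ _ (sliceFun_ae_eq ?_)
    filter_upwards [ae_ae_of_ae_prod_swap (Lp.coeFn_smul c u), sliceFun_coeFn u]
      with y h1 h2
    filter_upwards [h1, h2, Lp.coeFn_smul c (sliceFun u y)] with w h1 h2 h4
    rw [h1, Pi.smul_apply, Pi.smul_apply, h4, Pi.smul_apply, h2]
  norm_map' u := by
    change ‖(memLp_sliceFun u).toLp _‖ = _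
    rw [Lp.norm_toLp, eLpNorm_sliceFun, Lp.norm_def]

theorem sliceₗᵢ_coeFn (u : Lp E p (P.prod ν)) : sliceₗᵢ u =ᵐ[ν] sliceFun u :=
  (memLp_sliceFun u).coeFn_toLp

theorem memLp_tensor (φ : Lp E p P) (η : Lp ℝ p ν) :
    MemLp (fun z : Ω × Y => η z.2 • φ z.1) p (P.prod ν) := by
  refine ⟨(Lp.aestronglyMeasurable η).comp_snd.smul (Lp.aestronglyMeasurable φ).comp_fst, ?_⟩
  have hm : AEStronglyMeasurable (fun z : Ω × Y => η z.2 • φ z.1) (P.prod ν) :=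
    (Lp.aestronglyMeasurable η).comp_snd.smul (Lp.aestronglyMeasurable φ).comp_fst
  rw [eLpNorm_lt_top_iff_lintegral_rpow_enorm_lt_top (exponent_ne_zero p) (Fact.out),
    lintegral_prod_symm _ (hm.enorm.pow_const _)]
  simp only [enorm_smul, ENNReal.mul_rpow_of_nonneg _ _ (exponent_toReal_pos p).le]
  have h1 : ∀ y, ∫⁻ w, ‖η y‖ₑ ^ p.toReal * ‖φ w‖ₑ ^ p.toReal ∂P =
      ‖η y‖ₑ ^ p.toReal * ‖φ‖ₑ ^ p.toReal := by
    intro y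
    rw [lintegral_const_mul'' _ ((Lp.aestronglyMeasurable φ).enorm.pow_const _),
      enorm_rpow_eq_lintegral]
  simp only [h1]
  rw [lintegral_mul_const'' _ ((Lp.aestronglyMeasurable η).enorm.pow_const _),
    ← enorm_rpow_eq_lintegral]
  exact ENNReal.mul_lt_top (ENNReal.rpow_lt_top_of_nonneg (exponent_toReal_pos p).le (by simp))
    (ENNReal.rpow_lt_top_of_nonneg (exponent_toReal_pos p).le (by simp))

/-- The product `φ(w) η(y)` as an element of `L^p(Ω × Y; E)`. -/
noncomputable def tensor (φ : Lp E p P) (η : Lp ℝ p ν) : Lp E p (P.prod ν) :=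
  (memLp_tensor φ η).toLp _

theorem tensor_coeFn (φ : Lp E p P) (η : Lp ℝ p ν) :
    tensor φ η =ᵐ[P.prod ν] fun z => η z.2 • φ z.1 := MemLp.coeFn_toLp _

theorem slice_ae_eq_of_ae {u : Lp E p (P.prod ν)} {φ : Lp E p P} {η : Y → ℝ}
    (h : u =ᵐ[P.prod ν] fun z => η z.2 • φ z.1) : sliceₗᵢ u =ᵐ[ν] fun y => η y • φ := by
  refine (sliceₗᵢ_coeFn u).trans (sliceFun_ae_eq ?_)
  filter_upwards [ae_ae_of_ae_prod_swap h] with y hy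
  filter_upwards [hy, Lp.coeFn_smul (η y) φ] with w h1 h2
  rw [h1, h2, Pi.smul_apply]

theorem slice_tensor (φ : Lp E p P) (η : Lp ℝ p ν) :
    sliceₗᵢ (tensor φ η) =ᵐ[ν] fun y => η y • φ := slice_ae_eq_of_ae (tensor_coeFn φ η)

/-- The range is closed, being that of an isometry on a complete space, and it contains the
L^p(Ω)-valued step functions, which are slices of products φ(ω) 1_s(y). -/
theorem sliceₗᵢ_surjective [CompleteSpace E] :
    Function.Surjective (sliceₗᵢ : Lp E p (P.prod ν) →ₗᵢ[ℝ] Lp (Lp E p P) p ν) := by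
  intro f
  refine Lp.induction (Fact.out : p ≠ ⊤)
    (fun f => ∃ u, (sliceₗᵢ : Lp E p (P.prod ν) →ₗᵢ[ℝ] Lp (Lp E p P) p ν) u = f) ?_ ?_ ?_ f
  · intro φ s hs hμs
    refine ⟨tensor φ (indicatorConstLp p hs hμs.ne 1), Lp.ext ?_⟩
    refine (slice_tensor _ _).trans ?_
    rw [Lp.simpleFunc.coe_indicatorConst]
    filter_upwards [indicatorConstLp_coeFn (p := p) (hs := hs) (hμs := hμs.ne) (c := (1 : ℝ)),
      indicatorConstLp_coeFn (p := p) (hs := hs) (hμs := hμs.ne) (c := φ)] with y h1 h2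
    rw [h1, h2]
    by_cases hy : y ∈ s <;> simp [hy]
  · rintro f g hf hg _ ⟨u, hu⟩ ⟨v, hv⟩
    exact ⟨u + v, by rw [map_add, hu, hv]⟩
  · exact (sliceₗᵢ.isometry.isClosedEmbedding).isClosed_range

/-- The isometric isomorphism `L^p(Ω × Y; E) ≃ L^p(Y; L^p(Ω; E))`. -/
noncomputable def slice [CompleteSpace E] : Lp E p (P.prod ν) ≃ₗᵢ[ℝ] Lp (Lp E p P) p ν :=
  LinearIsometryEquiv.ofSurjective sliceₗᵢ sliceₗᵢ_surjective

theorem slice_coeFn [CompleteSpace E] (u : Lp E p (P.prod ν)) :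
    ∀ᵐ y ∂ν, (slice u : Lp (Lp E p P) p ν) y =ᵐ[P] fun w => u (w, y) := by
  filter_upwards [sliceₗᵢ_coeFn u, sliceFun_coeFn u] with y h1 h2
  have h3 : (slice u : Lp (Lp E p P) p ν) y = (sliceₗᵢ u : Lp (Lp E p P) p ν) y := rfl
  rw [h3, h1]
  exact h2

theorem slice_ae_eq [CompleteSpace E] {u : Lp E p (P.prod ν)} {f : Y → Lp E p P}
    (h : ∀ᵐ y ∂ν, (fun w => u (w, y)) =ᵐ[P] f y) :
    (slice u : Lp (Lp E p P) p ν) =ᵐ[ν] f :=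
  (sliceₗᵢ_coeFn u).trans (sliceFun_ae_eq h)

/-- Fibrewise comparison of two elements of `L^p(Ω × Y)` with different values. -/
theorem slice_ae_eq_map [CompleteSpace E] {F : Type*} [NormedAddCommGroup F] [NormedSpace ℝ F]
    [CompleteSpace F] [SecondCountableTopology (Lp F p P)] {u : Lp E p (P.prod ν)}
    (A : E →L[ℝ] F) :
    (slice (A.compLpL p (P.prod ν) u) : Lp (Lp F p P) p ν) =ᵐ[ν]
      fun y => A.compLpL p P ((slice u : Lp (Lp E p P) p ν) y) := by
  refine slice_ae_eq ?_
  filter_upwards [slice_coeFn u, ae_ae_of_ae_prod_swap (A.coeFn_compLpL (p := p) u)] with y h1 h2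
  filter_upwards [h1, h2, A.coeFn_compLpL ((slice u : Lp (Lp E p P) p ν) y)] with w h1 h2 h3
  rw [h2, h3, h1]

end Slice

/-! ### Integral functionals with convex integrand of p-growth. -/

section Integrand

variable {Z E : Type*} [MeasurableSpace Z] {μ : Measure Z} [IsFiniteMeasure μ]
  [NormedAddCommGroup E] [NormedSpace ℝ E] [FiniteDimensional ℝ E]
  {p : ℝ≥0∞} [Fact (1 ≤ p)] [Fact (p ≠ ⊤)] {W : Z → E → ℝ} {C : ℝ}

/-- A finite convex function on a finite dimensional space is continuous, so W is a Carathéodory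
integrand: along simple approximations of G the composition is a finite sum of measurable pieces and
converges pointwise. -/
theorem aemeasurable_integrand_comp (hm : ∀ F, AEMeasurable (fun z => W z F) μ)
    (hc : ∀ᵐ z ∂μ, ConvexOn ℝ Set.univ (W z)) {G : Z → E} (hG : AEStronglyMeasurable G μ) :
    AEMeasurable (fun z => W z (G z)) μ := by
  obtain ⟨G', hG', hGG'⟩ := hG
  refine AEMeasurable.congr (f := fun z => W z (G' z)) ?_ (by
    filter_upwards [hGG'] with z hz; rw [hz])
  refine aemeasurable_of_tendsto_metrizable_ae (u := atTop)
    (f := fun n z => W z (hG'.approx n z)) (fun n => ?_) ?_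
  · have h1 : (fun z => W z (hG'.approx n z)) = fun z =>
        ∑ c ∈ (hG'.approx n).range, ((hG'.approx n) ⁻¹' {c}).indicator (fun z => W z c) z := by
      funext z
      rw [Finset.sum_eq_single (hG'.approx n z)]
      · simp
      · intro b _ hb
        simp [hb.symm]
      · intro h
        exact absurd ((hG'.approx n).mem_range_self z) h
    rw [h1]
    exact Finset.aemeasurable_fun_sum _ fun c _ =>
      (hm c).indicator ((hG'.approx n).measurableSet_preimage _)
  · filter_upwards [hc] with z hz
    have hcont : Continuous (W z) := hz.locallyLipschitz.continuous
    exact (hcont.tendsto _).comp (hG'.tendsto_approx z)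

theorem integrable_integrand_comp (hm : ∀ F, AEMeasurable (fun z => W z F) μ)
    (hc : ∀ᵐ z ∂μ, ConvexOn ℝ Set.univ (W z)) (hC : 0 < C)
    (hg : ∀ᵐ z ∂μ, ∀ F, 1 / C * ‖F‖ ^ p.toReal - C ≤ W z F ∧ W z F ≤ C * (‖F‖ ^ p.toReal + 1))
    {G : Z → E} (hG : MemLp G p μ) : Integrable (fun z => W z (G z)) μ := by
  have hi := hG.integrable_norm_rpow (exponent_ne_zero p) (Fact.out)
  refine Integrable.mono' ((hi.add (integrable_const 1)).const_mul C)
    (aemeasurable_integrand_comp hm hc hG.1).aestronglyMeasurable ?_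
  filter_upwards [hg] with z hz
  obtain ⟨h1, h2⟩ := hz (G z)
  have h3 : 0 ≤ ‖G z‖ ^ p.toReal := by positivity
  have h4 : 0 ≤ 1 / C * ‖G z‖ ^ p.toReal := by positivity
  have h5 : 0 ≤ C * ‖G z‖ ^ p.toReal := by positivity
  rw [Real.norm_eq_abs, abs_le]
  simp only [Pi.add_apply]
  constructor <;> linarith

theorem norm_rpow_eq_integral (G : Lp E p μ) : ‖G‖ ^ p.toReal = ∫ z, ‖G z‖ ^ p.toReal ∂μ := by
  have hp := exponent_toReal_pos p
  have h0 : 0 ≤ ∫ z, ‖G z‖ ^ p.toReal ∂μ := integral_nonneg fun z => by positivity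
  rw [Lp.norm_def, (Lp.memLp G).eLpNorm_eq_integral_rpow_norm (exponent_ne_zero p) (Fact.out),
    ENNReal.toReal_ofReal (by positivity), Real.rpow_inv_rpow h0 hp.ne']

/-- The integral functional `G ↦ ∫ W(z, G(z)) dz` on `L^p`. -/
noncomputable def integralFunctional (μ : Measure Z) (p : ℝ≥0∞) (W : Z → E → ℝ)
    (G : Lp E p μ) : ℝ := ∫ z, W z (G z) ∂μ

theorem integralFunctional_le (hm : ∀ F, AEMeasurable (fun z => W z F) μ)
    (hc : ∀ᵐ z ∂μ, ConvexOn ℝ Set.univ (W z)) (hC : 0 < C)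
    (hg : ∀ᵐ z ∂μ, ∀ F, 1 / C * ‖F‖ ^ p.toReal - C ≤ W z F ∧ W z F ≤ C * (‖F‖ ^ p.toReal + 1))
    (G : Lp E p μ) :
    integralFunctional μ p W G ≤ C * (‖G‖ ^ p.toReal + μ.real Set.univ) := by
  have hi := (Lp.memLp G).integrable_norm_rpow (exponent_ne_zero p) (Fact.out)
  rw [norm_rpow_eq_integral]
  have h1 : ∫ z, C * (‖G z‖ ^ p.toReal + 1) ∂μ =
      C * (∫ z, ‖G z‖ ^ p.toReal ∂μ + μ.real Set.univ) := by
    rw [integral_const_mul, integral_add hi (integrable_const 1)]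
    simp
  rw [← h1]
  refine integral_mono_ae (integrable_integrand_comp hm hc hC hg (Lp.memLp G))
    ((hi.add (integrable_const 1)).const_mul C) ?_
  filter_upwards [hg] with z hz using (hz _).2

theorem le_integralFunctional (hm : ∀ F, AEMeasurable (fun z => W z F) μ)
    (hc : ∀ᵐ z ∂μ, ConvexOn ℝ Set.univ (W z)) (hC : 0 < C)
    (hg : ∀ᵐ z ∂μ, ∀ F, 1 / C * ‖F‖ ^ p.toReal - C ≤ W z F ∧ W z F ≤ C * (‖F‖ ^ p.toReal + 1))
    (G : Lp E p μ) :
    1 / C * ‖G‖ ^ p.toReal - C * μ.real Set.univ ≤ integralFunctional μ p W G := by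
  have hi := (Lp.memLp G).integrable_norm_rpow (exponent_ne_zero p) (Fact.out)
  rw [norm_rpow_eq_integral]
  have h1 : ∫ z, (1 / C * ‖G z‖ ^ p.toReal - C) ∂μ =
      1 / C * (∫ z, ‖G z‖ ^ p.toReal ∂μ) - C * μ.real Set.univ := by
    rw [integral_sub (hi.const_mul _) (integrable_const C), integral_const_mul]
    simp [mul_comm]
  rw [← h1]
  refine integral_mono_ae ((hi.const_mul _).sub (integrable_const C))
    (integrable_integrand_comp hm hc hC hg (Lp.memLp G)) ?_
  filter_upwards [hg] with z hz using (hz _).1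

theorem convexOn_integralFunctional (hm : ∀ F, AEMeasurable (fun z => W z F) μ)
    (hc : ∀ᵐ z ∂μ, ConvexOn ℝ Set.univ (W z)) (hC : 0 < C)
    (hg : ∀ᵐ z ∂μ, ∀ F, 1 / C * ‖F‖ ^ p.toReal - C ≤ W z F ∧ W z F ≤ C * (‖F‖ ^ p.toReal + 1)) :
    ConvexOn ℝ Set.univ (integralFunctional μ p W) := by
  refine ⟨convex_univ, fun G _ H _ a b ha hb hab => ?_⟩
  have h1 := integrable_integrand_comp hm hc hC hg (Lp.memLp G)
  have h2 := integrable_integrand_comp hm hc hC hg (Lp.memLp H)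
  rw [smul_eq_mul, smul_eq_mul, integralFunctional, integralFunctional, integralFunctional,
    ← integral_const_mul, ← integral_const_mul, ← integral_add (h1.const_mul a) (h2.const_mul b)]
  refine integral_mono_ae (integrable_integrand_comp hm hc hC hg (Lp.memLp _))
    ((h1.const_mul a).add (h2.const_mul b)) ?_
  filter_upwards [hc, Lp.coeFn_add (a • G) (b • H), Lp.coeFn_smul a G, Lp.coeFn_smul b H]
    with z hz h3 h4 h5
  rw [h3, Pi.add_apply, h4, h5]
  exact hz.2 (Set.mem_univ _) (Set.mem_univ _) ha hb hab

/-- A convex function that is bounded above near one point is continuous on the whole space; the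
upper growth bound provides this on the unit ball. -/
theorem continuous_integralFunctional (hm : ∀ F, AEMeasurable (fun z => W z F) μ)
    (hc : ∀ᵐ z ∂μ, ConvexOn ℝ Set.univ (W z)) (hC : 0 < C)
    (hg : ∀ᵐ z ∂μ, ∀ F, 1 / C * ‖F‖ ^ p.toReal - C ≤ W z F ∧ W z F ≤ C * (‖F‖ ^ p.toReal + 1)) :
    Continuous (integralFunctional μ p W) := by
  rw [← continuousOn_univ]
  have h := (convexOn_integralFunctional hm hc hC hg).continuousOn_tfae isOpen_univ
    Set.univ_nonempty
  have h13 : ContinuousOn (integralFunctional μ p W) Set.univ ↔ ∃ x₀ ∈ Set.univ,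
      (𝓝 x₀).IsBoundedUnder (· ≤ ·) (integralFunctional μ p W) := h.out 1 3
  refine h13.2 ⟨0, Set.mem_univ _, C * (1 ^ p.toReal + μ.real Set.univ), ?_⟩
  rw [eventually_map]
  filter_upwards [Metric.ball_mem_nhds (0 : Lp E p μ) one_pos] with G hG
  refine (integralFunctional_le hm hc hC hg G).trans ?_
  have h1 : ‖G‖ ≤ 1 := (mem_ball_zero_iff.1 hG).le
  have h2 := exponent_toReal_pos p
  gcongr

/-- Convex continuous functionals are weakly sequentially lower semicontinuous. -/
theorem le_liminf_of_weakTendsto {X : Type*} [NormedAddCommGroup X] [NormedSpace ℝ X]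
    {I : X → ℝ} (hI : ConvexOn ℝ Set.univ I) (hc : Continuous I) {ι : Type*} {l : Filter ι}
    {u : ι → X} {v : X} (h : WeakTendsto u l v) :
    (I v : EReal) ≤ liminf (fun i => (I (u i) : EReal)) l := by
  refine le_of_forall_lt fun c hcv => ?_
  obtain ⟨r, hcr, hrv⟩ := EReal.lt_iff_exists_real_btwn.1 hcv
  have hev : ∀ᶠ i in l, (r : EReal) ≤ (I (u i) : EReal) := ?_
  · exact hcr.trans_le (le_liminf_of_le (by isBoundedDefault) hev)
  -- Otherwise u frequently enters the closed convex sublevel set {I ≤ r}, which must then contain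
  -- v, against r < I v.
  by_contra hn
  rw [not_eventually] at hn
  have hmem : v ∈ {x | I x ≤ r} := by
    refine h.mem_of_frequently ?_ (isClosed_le hc continuous_const) (hn.mono fun i hi => ?_)
    · simpa using hI.convex_le r
    · exact (EReal.coe_lt_coe_iff.1 (not_le.1 hi)).le
  exact (EReal.coe_lt_coe_iff.1 hrv).not_ge hmem

end Integrand

/-! ### Unfolding as a change of variables, and the energies as integral functionals. -/

section Unfold

variable {d : ℕ} {Ω : Type*} [MeasurableSpace Ω] {P : Measure Ω} [IsProbabilityMeasure P]
  (τ : ShiftGroup d P) (Q : Set (Space d)) {p : ℝ≥0∞}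

theorem unfold_coeFn (hp : p ≠ ⊤) (ε : ℝ) {F : Type*} [NormedAddCommGroup F]
    (u : Lp F p (prodMeasure P Q)) :
    unfold τ Q hp ε u =ᵐ[prodMeasure P Q] fun z => u (unfoldMap τ ε z) := MemLp.coeFn_toLp _

theorem unfoldMap_neg_unfoldMap (ε : ℝ) (z : Ω × Space d) :
    unfoldMap τ (-ε) (unfoldMap τ ε z) = z := by
  have h1 := congrFun (τ.shift_add (-((-ε)⁻¹ • z.2)) (-(ε⁻¹ • z.2))) z.1
  have h2 : -((-ε)⁻¹ • z.2) + -(ε⁻¹ • z.2) = 0 := by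
    rw [inv_neg, neg_smul]; abel
  rw [h2, τ.shift_zero] at h1
  simp only [unfoldMap]
  exact Prod.ext h1.symm rfl

theorem integrable_unfoldMap (ε : ℝ) {h : Ω × Space d → ℝ}
    (hh : Integrable h (prodMeasure P Q)) :
    Integrable (fun z => h (unfoldMap τ ε z)) (prodMeasure P Q) :=
  memLp_one_iff_integrable.1
    (memLp_unfoldMap τ Q ε ENNReal.one_ne_top (memLp_one_iff_integrable.2 hh))

theorem lintegral_unfoldMap_of_aemeasurable (ε : ℝ) {g : Ω × Space d → ℝ≥0∞}
    (hg : AEMeasurable g (prodMeasure P Q)) :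
    ∫⁻ z, g (unfoldMap τ ε z) ∂(prodMeasure P Q) = ∫⁻ z, g z ∂(prodMeasure P Q) := by
  obtain ⟨g', hg', hgg'⟩ := hg
  rw [lintegral_congr_ae hgg', ← lintegral_unfoldMap τ Q ε hg']
  exact lintegral_congr_ae (ae_unfoldMap τ Q ε hgg')

/-- Unfolding is only null measurable, so the integral is split into its positive and negative
parts, where invariance of the lower Lebesgue integral applies. -/
theorem integral_unfoldMap (ε : ℝ) {h : Ω × Space d → ℝ}
    (hh : Integrable h (prodMeasure P Q)) :
    ∫ z, h (unfoldMap τ ε z) ∂(prodMeasure P Q) = ∫ z, h z ∂(prodMeasure P Q) := by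
  rw [integral_eq_lintegral_pos_part_sub_lintegral_neg_part hh,
    integral_eq_lintegral_pos_part_sub_lintegral_neg_part (integrable_unfoldMap τ Q ε hh),
    lintegral_unfoldMap_of_aemeasurable τ Q ε (g := fun z => ENNReal.ofReal (h z))
      hh.1.aemeasurable.ennreal_ofReal,
    lintegral_unfoldMap_of_aemeasurable τ Q ε (g := fun z => ENNReal.ofReal (-h z))
      hh.1.aemeasurable.neg.ennreal_ofReal]

/-- The shift τ_{x/ε} in V is the unfolding with parameter -ε, which is inverse to the one with
parameter ε. So the oscillating density is a non-oscillating one, with unfolded gradient, pulled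
back by a transformation that preserves integrals. -/
theorem oscDensity_eq (V : Ω → Space d → Space d → ℝ) (ε : ℝ)
    (G : Ω × Space d → Space d) (z : Ω × Space d) :
    oscDensity τ V ε G z = (fun z => V z.1 z.2 (G (unfoldMap τ ε z))) (unfoldMap τ (-ε) z) := by
  have h1 := unfoldMap_neg_unfoldMap τ (-ε) z
  rw [neg_neg] at h1
  simp only [h1]
  simp only [oscDensity, unfoldMap, inv_neg, neg_smul, neg_neg]

variable {Q} [Fact (1 ≤ p)] [Fact (p ≠ ⊤)] [IsFiniteMeasure (volume.restrict Q)]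
  {V : Ω → Space d → Space d → ℝ}

theorem integrable_unfolded_density (hp : p ≠ ⊤) (hV : IsConvexIntegrand P Q p V) (ε : ℝ)
    (G : Lp (Space d) p (prodMeasure P Q)) :
    Integrable (fun z : Ω × Space d => V z.1 z.2 (G (unfoldMap τ ε z))) (prodMeasure P Q) := by
  obtain ⟨C, hC, hg⟩ := hV.growth
  exact integrable_integrand_comp (W := fun z : Ω × Space d => V z.1 z.2)
    hV.aemeasurable hV.convex hC hg
    (memLp_unfoldMap τ Q ε hp (Lp.memLp G))

theorem integrable_oscDensity (hp : p ≠ ⊤) (hV : IsConvexIntegrand P Q p V) (ε : ℝ)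
    (G : Lp (Space d) p (prodMeasure P Q)) :
    Integrable (oscDensity τ V ε G) (prodMeasure P Q) := by
  have h := integrable_unfoldMap τ Q (-ε) (integrable_unfolded_density τ hp hV ε G)
  exact h.congr (Eventually.of_forall fun z => (oscDensity_eq τ V ε G z).symm)

/-- After this the parameter ε enters only through the argument of a fixed functional. -/
theorem oscEnergy_eq (hp : p ≠ ⊤) (hV : IsConvexIntegrand P Q p V) (ε : ℝ)
    (u : Lp ℝ p (prodMeasure P Q) × Lp (Space d) p (prodMeasure P Q)) :
    oscEnergy τ Q V ε u = integralFunctional (prodMeasure P Q) p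
      (fun z : Ω × Space d => V z.1 z.2) (unfold τ Q hp ε u.2) := by
  have h1 := integral_unfoldMap τ Q (-ε) (integrable_unfolded_density τ hp hV ε u.2)
  have h2 : oscEnergy τ Q V ε u = ∫ z : Ω × Space d, V z.1 z.2 (u.2 (unfoldMap τ ε z))
      ∂(prodMeasure P Q) :=
    (integral_congr_ae (Eventually.of_forall fun z => oscDensity_eq τ V ε u.2 z)).trans h1
  rw [h2]
  refine integral_congr_ae ?_
  filter_upwards [unfold_coeFn τ Q hp ε u.2] with z hz
  simp only [hz]

theorem integrable_twoScaleDensity (hV : IsConvexIntegrand P Q p V)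
    (G χ : Lp (Space d) p (prodMeasure P Q)) :
    Integrable (twoScaleDensity V G χ) (prodMeasure P Q) := by
  obtain ⟨C, hC, hg⟩ := hV.growth
  exact integrable_integrand_comp (W := fun z : Ω × Space d => V z.1 z.2)
    hV.aemeasurable hV.convex hC hg ((Lp.memLp G).add (Lp.memLp χ))

theorem twoScaleEnergy_eq (u : Lp ℝ p (prodMeasure P Q) × Lp (Space d) p (prodMeasure P Q))
    (χ : Lp (Space d) p (prodMeasure P Q)) :
    twoScaleEnergy Q V u χ = integralFunctional (prodMeasure P Q) p
      (fun z : Ω × Space d => V z.1 z.2) (u.2 + χ) := by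
  refine integral_congr_ae ?_
  filter_upwards [Lp.coeFn_add u.2 χ] with z hz
  simp only [hz, twoScaleDensity, Pi.add_apply]

end Unfold

theorem single_add_single {d : ℕ} (i : Fin d) (s t : ℝ) :
    EuclideanSpace.single i s + EuclideanSpace.single i t = EuclideanSpace.single i (s + t) := by
  ext j
  by_cases h : j = i <;> simp [h]

theorem single_zero_eq {d : ℕ} (i : Fin d) : EuclideanSpace.single i (0 : ℝ) = 0 := by
  ext j
  by_cases h : j = i <;> simp [h]

/-! ### The group of shifts on L^p(Ω): strong continuity and generators. -/

section Shift

variable {d : ℕ} {Ω : Type*} [MeasurableSpace Ω] {P : Measure Ω}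
  {τ : ShiftGroup d P} {p : ℝ≥0∞} [Fact (1 ≤ p)]

theorem shiftOp_coeFn (x : Space d) (φ : Lp ℝ p P) :
    shiftOp τ p x φ =ᵐ[P] fun w => φ (τ.shift x w) :=
  Lp.coeFn_compMeasurePreserving φ (τ.measurePreserving x)

theorem shiftOp_zero (φ : Lp ℝ p P) : shiftOp τ p 0 φ = φ := by
  refine Lp.ext ((shiftOp_coeFn 0 φ).trans (Eventually.of_forall fun w => ?_))
  simp [τ.shift_zero]

theorem shiftOp_shiftOp (x y : Space d) (φ : Lp ℝ p P) :
    shiftOp τ p x (shiftOp τ p y φ) = shiftOp τ p (x + y) φ := by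
  refine Lp.ext ((shiftOp_coeFn x _).trans ?_)
  have h1 := (τ.measurePreserving x).quasiMeasurePreserving.ae_eq_comp (shiftOp_coeFn (τ := τ) y φ)
  refine EventuallyEq.trans h1 ((shiftOp_coeFn (x + y) φ).trans
    (Eventually.of_forall fun w => ?_)).symm
  simp only [Function.comp]
  rw [add_comm x y, τ.shift_add]
  rfl

theorem norm_shiftOp (x : Space d) (φ : Lp ℝ p P) : ‖shiftOp τ p x φ‖ = ‖φ‖ :=
  (shiftOp τ p x).norm_map φ

theorem shiftOp_comm (x y : Space d) (φ : Lp ℝ p P) :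
    shiftOp τ p x (shiftOp τ p y φ) = shiftOp τ p y (shiftOp τ p x φ) := by
  rw [shiftOp_shiftOp, shiftOp_shiftOp, add_comm]

/-- A property of points of `ℝ^d` that is additive and holds on the coordinate axes holds
everywhere. -/
theorem space_induction {q : Space d → Prop} (h0 : q 0) (hadd : ∀ x y, q x → q y → q (x + y))
    (hs : ∀ i h, q (EuclideanSpace.single i h)) (x : Space d) : q x := by
  have h1 : x = ∑ i, EuclideanSpace.single i (x i) := by
    ext j
    simp
  rw [h1]
  refine Finset.sum_induction _ q hadd h0 fun i _ => hs i _

theorem mem_LpInv_of_single {φ : Lp ℝ p P}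
    (h : ∀ i s, shiftOp τ p (EuclideanSpace.single i s) φ = φ) : φ ∈ LpInv τ p := by
  refine space_induction (q := fun x => shiftOp τ p x φ = φ) (shiftOp_zero φ) ?_ h
  intro x y hx hy
  rw [← shiftOp_shiftOp, hy, hx]

theorem shiftOp_sub_mem_of_single {R : Submodule ℝ (Lp ℝ p P)}
    (h : ∀ i s φ, shiftOp τ p (EuclideanSpace.single i s) φ - φ ∈ R) (x : Space d) :
    ∀ φ, shiftOp τ p x φ - φ ∈ R := by
  refine space_induction (q := fun x => ∀ φ, shiftOp τ p x φ - φ ∈ R) ?_ ?_ h x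
  · intro φ
    rw [shiftOp_zero, sub_self]
    exact R.zero_mem
  · intro x y hx hy φ
    rw [← shiftOp_shiftOp]
    have := R.add_mem (hx (shiftOp τ p y φ)) (hy φ)
    rwa [sub_add_sub_cancel] at this

variable [Fact (p ≠ ⊤)] [IsProbabilityMeasure P]

theorem aestronglyMeasurable_shiftOp [SecondCountableTopology (Lp ℝ p P)] (φ : Lp ℝ p P) :
    AEStronglyMeasurable (fun x => shiftOp τ p x φ) volume := by
  refine aestronglyMeasurable_of_edist fun a => ?_
  have h1 : (fun x => edist (shiftOp τ p x φ) a) =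
      fun x => (∫⁻ w, ‖φ (τ.shift x w) - a w‖ₑ ^ p.toReal ∂P) ^ (1 / p.toReal) := by
    funext x
    rw [edist_eq_enorm_sub, Lp.enorm_def,
      eLpNorm_eq_lintegral_rpow_enorm_toReal (exponent_ne_zero p) (Fact.out)]
    congr 1
    refine lintegral_congr_ae ?_
    filter_upwards [shiftOp_coeFn (τ := τ) x φ, Lp.coeFn_sub (shiftOp τ p x φ) a] with w h2 h3
    rw [h3, Pi.sub_apply, h2]
  rw [h1]
  refine AEMeasurable.pow_const ?_ _
  have h3 : AEMeasurable (fun z : Ω × Space d => φ (τ.shift z.2 z.1)) (P.prod volume) :=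
    NullMeasurable.aemeasurable fun s hs =>
      τ.nullMeasurable ((Lp.stronglyMeasurable φ).measurable hs)
  have h2 : AEMeasurable (fun z : Ω × Space d => φ (τ.shift z.2 z.1) - a z.1)
      (P.prod volume) :=
    h3.sub ((Lp.stronglyMeasurable a).measurable.comp measurable_fst).aemeasurable
  exact (h2.enorm.pow_const p.toReal).prod_swap.lintegral_prod_right'

/-- Measurability of the action forces strong continuity of the group `U`. -/
theorem continuous_shiftOp [SecondCountableTopology (Lp ℝ p P)] (φ : Lp ℝ p P) :
    Continuous fun x => shiftOp τ p x φ := by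
  have h0 : ContinuousAt (fun x => shiftOp τ p x φ) 0 := by
    rw [ContinuousAt, shiftOp_zero, Metric.tendsto_nhds]
    intro δ hδ
    obtain ⟨D, hDc, hD⟩ := TopologicalSpace.exists_countable_dense (Lp ℝ p P)
    set A : Lp ℝ p P → Set (Space d) := fun a => {x | dist (shiftOp τ p x φ) a < δ / 2}
    have hAm : ∀ a, NullMeasurableSet (A a) volume := fun a =>
      ((aestronglyMeasurable_shiftOp (τ := τ) φ).dist
        aestronglyMeasurable_const).aemeasurable.nullMeasurable measurableSet_Iio
    have hcov : (⋃ a ∈ D, A a) = Set.univ := by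
      refine Set.eq_univ_of_forall fun x => ?_
      obtain ⟨a, ha, hxa⟩ := hD.exists_dist_lt (shiftOp τ p x φ) (half_pos hδ)
      exact Set.mem_biUnion ha hxa
    -- Countably many of these sets cover ℝ^d, so one of them has positive measure.
    have hpos : ∃ a ∈ D, volume (A a) ≠ 0 := by
      by_contra! hcon
      have := (measure_biUnion_null_iff (μ := (volume : Measure (Space d))) hDc).2 hcon
      rw [hcov] at this
      exact NeZero.ne (volume : Measure (Space d)) (Measure.measure_univ_eq_zero.1 this)
    obtain ⟨a, -, ha⟩ := hpos
    obtain ⟨t, htA, htm, hteq⟩ := (hAm a).exists_measurable_subset_ae_eq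
    have htpos : 0 < volume t := by
      rw [measure_congr hteq]
      exact pos_iff_ne_zero.2 ha
    -- Steinhaus: the difference set of a set of positive measure is a neighbourhood of 0. For y, z
    -- in this set U_y φ and U_z φ are both within δ/2 of a, and the isometry U_z transfers the
    -- estimate to U_{y-z} φ and φ.
    have hn := Measure.sub_mem_nhds_zero_of_addHaar_pos volume t htm htpos
    filter_upwards [hn] with x hx
    obtain ⟨y, hy, z, hz, rfl⟩ := hx
    have h1 : dist (shiftOp τ p y φ) (shiftOp τ p z φ) < δ := by
      have h2 : dist (shiftOp τ p y φ) a < δ / 2 := htA hy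
      have h3 : dist (shiftOp τ p z φ) a < δ / 2 := htA hz
      calc dist (shiftOp τ p y φ) (shiftOp τ p z φ)
          ≤ dist (shiftOp τ p y φ) a + dist (shiftOp τ p z φ) a := dist_triangle_right _ _ _
        _ < δ := by linarith
    have h4 : dist (shiftOp τ p (y - z) φ) φ = dist (shiftOp τ p y φ) (shiftOp τ p z φ) := by
      rw [← (shiftOp τ p z).dist_map, shiftOp_shiftOp, add_sub_cancel]
    change dist (shiftOp τ p (y - z) φ) φ < δ
    rw [h4]
    exact h1
  refine continuous_iff_continuousAt.2 fun x => ?_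
  have h1 : (fun y => shiftOp τ p y φ) = fun y => shiftOp τ p x (shiftOp τ p (y - x) φ) := by
    funext y
    rw [shiftOp_shiftOp, add_sub_cancel]
  rw [h1]
  refine (shiftOp τ p x).continuous.continuousAt.comp ?_
  have h2 : ContinuousAt (fun y : Space d => y - x) x := by fun_prop
  refine ContinuousAt.comp (g := fun y => shiftOp τ p y φ) ?_ h2
  simpa using h0

theorem continuous_shiftOp_smul [SecondCountableTopology (Lp ℝ p P)] (c : ℝ) (φ : Lp ℝ p P) :
    Continuous fun x : Space d => shiftOp τ p (c • x) φ :=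
  (continuous_shiftOp φ).comp (continuous_const_smul c)

theorem continuous_shiftOp_uncurry [SecondCountableTopology (Lp ℝ p P)] {T : Type*}
    [TopologicalSpace T] {f : T → Space d} {g : T → Lp ℝ p P} (hf : Continuous f)
    (hg : Continuous g) : Continuous fun t => shiftOp τ p (f t) (g t) := by
  refine continuous_iff_continuousAt.2 fun t => ?_
  rw [ContinuousAt, tendsto_iff_dist_tendsto_zero]
  have h1 : Tendsto (fun s => dist (g s) (g t) + dist (shiftOp τ p (f s) (g t))
      (shiftOp τ p (f t) (g t))) (𝓝 t) (𝓝 (0 + 0)) := by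
    refine Tendsto.add ?_ ?_
    · exact tendsto_iff_dist_tendsto_zero.1 hg.continuousAt
    · exact tendsto_iff_dist_tendsto_zero.1
        ((continuous_shiftOp (τ := τ) (g t)).comp hf).continuousAt
  rw [add_zero] at h1
  refine squeeze_zero (fun s => dist_nonneg) (fun s => ?_) h1
  refine (dist_triangle _ (shiftOp τ p (f s) (g t)) _).trans ?_
  rw [(shiftOp τ p (f s)).dist_map]

/-- The mean value inequality for the generator `D_i`. -/
theorem HasStochDeriv.norm_shiftOp_sub_le {i : Fin d} {φ g : Lp ℝ p P}
    (h : HasStochDeriv τ p i φ g) (s : ℝ) :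
    ‖shiftOp τ p (EuclideanSpace.single i s) φ - φ‖ ≤ |s| * ‖g‖ := by
  -- By the group law the orbit is differentiable everywhere as soon as it is at 0, with derivative
  -- of constant norm ‖g‖.
  have hd : ∀ t : ℝ, HasDerivAt (fun t : ℝ => shiftOp τ p (EuclideanSpace.single i t) φ)
      (shiftOp τ p (EuclideanSpace.single i t) g) t := by
    intro t
    rw [hasDerivAt_iff_tendsto_slope_zero]
    have h1 := ((shiftOp τ p (EuclideanSpace.single i t)).continuous.tendsto g).comp h
    refine h1.congr fun r => ?_
    simp only [Function.comp, map_smul, map_sub, shiftOp_shiftOp]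
    rw [single_add_single]
  have h2 := Convex.norm_image_sub_le_of_norm_hasDerivWithin_le (s := Set.univ)
    (C := ‖g‖) (fun t _ => (hd t).hasDerivWithinAt) (fun t _ => (norm_shiftOp _ g).le)
    convex_univ (Set.mem_univ 0) (Set.mem_univ s)
  rw [single_zero_eq, shiftOp_zero, sub_zero, Real.norm_eq_abs, mul_comm] at h2
  exact h2

end Shift

/-! ### Integrals in closed subspaces, mollifiers and partial derivatives. -/

/-- A functional separating the integral from N would be nonpositive on N, hence on the integral,
yet at least a positive constant there. -/
theorem integral_mem_submodule {α X : Type*} [MeasurableSpace α] {μ : Measure α}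
    [NormedAddCommGroup X] [NormedSpace ℝ X] [CompleteSpace X] {N : Submodule ℝ X}
    (hN : IsClosed (N : Set X)) {f : α → X} (hf : ∀ᵐ x ∂μ, f x ∈ N) : ∫ x, f x ∂μ ∈ N := by
  by_cases hint : Integrable f μ
  swap
  · rw [integral_undef hint]
    exact N.zero_mem
  by_contra hz
  obtain ⟨F, u, h1, h2⟩ := geometric_hahn_banach_closed_point (s := (N : Set X))
    (Submodule.convex N) hN hz
  have h0 : 0 < u := by simpa using h1 0 N.zero_mem
  have h3 : ∀ a ∈ N, F a ≤ 0 := by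
    intro a ha
    by_contra! hpos
    have := h1 ((u / F a) • a) (N.smul_mem _ ha)
    rw [map_smul, smul_eq_mul, div_mul_cancel₀ _ hpos.ne'] at this
    exact lt_irrefl _ this
  rw [← F.integral_comp_comm hint] at h2
  have h4 : ∫ x, F (f x) ∂μ ≤ 0 := integral_nonpos_of_ae (hf.mono fun x hx => h3 _ hx)
  linarith

theorem exists_mollifier (d : ℕ) : ∃ g : Space d → ℝ, ContDiff ℝ ∞ g ∧ HasCompactSupport g ∧
    (∀ x, 0 ≤ g x) ∧ ∫ x, g x = 1 := by
  let b : ContDiffBump (0 : Space d) := ⟨1, 2, one_pos, one_lt_two⟩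
  exact ⟨b.normed volume, b.contDiff_normed, b.hasCompactSupport_normed,
    b.nonneg_normed, b.integral_normed⟩

/-- The partial derivative `∂_i g`. -/
noncomputable def partialDeriv {d : ℕ} (i : Fin d) (g : Space d → ℝ) (x : Space d) : ℝ :=
  fderiv ℝ g x (EuclideanSpace.single i 1)

theorem gradient_apply {d : ℕ} (i : Fin d) (g : Space d → ℝ) (x : Space d) :
    gradient g x i = partialDeriv i g x := by
  rw [partialDeriv, ← InnerProductSpace.toDual_symm_apply (𝕜 := ℝ) (y := fderiv ℝ g x),
    real_inner_comm, EuclideanSpace.inner_single_left]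
  simp [gradient]

theorem hasCompactSupport_partialDeriv {d : ℕ} (i : Fin d) {g : Space d → ℝ}
    (hg : HasCompactSupport g) : HasCompactSupport (partialDeriv i g) :=
  (hg.fderiv ℝ).comp_left (g := fun L : Space d →L[ℝ] ℝ => L (EuclideanSpace.single i 1))
    (by simp)

/-! ### Averages of L^p(Ω) functions along the action. -/

section Conv

variable {d : ℕ} {Ω : Type*} [MeasurableSpace Ω] {P : Measure Ω}
  {τ : ShiftGroup d P} {p : ℝ≥0∞} [Fact (1 ≤ p)]

variable (τ p) in
/-- The average `∫ g(x) U_{cx} φ dx`. -/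
noncomputable def conv (c : ℝ) (g : Space d → ℝ) (φ : Lp ℝ p P) : Lp ℝ p P :=
  ∫ x, g x • shiftOp τ p (c • x) φ

variable [Fact (p ≠ ⊤)] [IsProbabilityMeasure P] [SecondCountableTopology (Lp ℝ p P)]
  {g : Space d → ℝ} {c : ℝ}

theorem integrable_conv (c : ℝ) (hg : Continuous g) (hgs : HasCompactSupport g) (φ : Lp ℝ p P) :
    Integrable fun x => g x • shiftOp τ p (c • x) φ :=
  (hg.smul (continuous_shiftOp_smul c φ)).integrable_of_hasCompactSupport hgs.smul_right

theorem norm_conv_le (c : ℝ) (g : Space d → ℝ) (φ : Lp ℝ p P) :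
    ‖conv τ p c g φ‖ ≤ (∫ x, ‖g x‖) * ‖φ‖ := by
  refine (norm_integral_le_integral_norm _).trans (le_of_eq ?_)
  simp only [norm_smul, norm_shiftOp]
  rw [integral_mul_const]

variable (τ p) in
/-- The operator `φ ↦ ∫ g(x) U_{cx} φ dx`. -/
noncomputable def convL (c : ℝ) (hg : Continuous g) (hgs : HasCompactSupport g) :
    Lp ℝ p P →L[ℝ] Lp ℝ p P :=
  LinearMap.mkContinuous
    { toFun := conv τ p c g
      map_add' := fun φ ψ => by
        simp only [conv, map_add, smul_add]
        exact integral_add (integrable_conv c hg hgs φ) (integrable_conv c hg hgs ψ)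
      map_smul' := fun a φ => by
        simp only [conv, map_smul, RingHom.id_apply]
        rw [← integral_smul]
        refine integral_congr_ae (Eventually.of_forall fun x => ?_)
        simp only
        rw [smul_comm] }
    (∫ x, ‖g x‖) fun φ => norm_conv_le c g φ

theorem shiftOp_conv (hg : Continuous g) (hgs : HasCompactSupport g) (y : Space d)
    (φ : Lp ℝ p P) : shiftOp τ p y (conv τ p c g φ) = conv τ p c g (shiftOp τ p y φ) := by
  have h1 := (shiftOp τ p y).toContinuousLinearMap.integral_comp_comm
    (integrable_conv (τ := τ) c hg hgs φ)
  simp only [LinearIsometry.coe_toContinuousLinearMap, map_smul] at h1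
  rw [conv, ← h1]
  simp only [conv, shiftOp_comm y]

theorem conv_of_mem_LpInv {φ : Lp ℝ p P} (hφ : φ ∈ LpInv τ p) :
    conv τ p c g φ = (∫ x, g x) • φ := by
  have h1 : ∀ x, shiftOp τ p x φ = φ := hφ
  simp only [conv, h1]
  exact integral_smul_const g φ

/-- The substitution x ↦ x - y moves the shift from φ onto the kernel g, so the average inherits the
smoothness of g whatever φ is. -/
theorem shiftOp_smul_conv (hg : Continuous g) (hgs : HasCompactSupport g) (y : Space d)
    (φ : Lp ℝ p P) :
    shiftOp τ p (c • y) (conv τ p c g φ) = ∫ x, g (x - y) • shiftOp τ p (c • x) φ := by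
  have h1 := (shiftOp τ p (c • y)).toContinuousLinearMap.integral_comp_comm
    (integrable_conv (τ := τ) c hg hgs φ)
  simp only [LinearIsometry.coe_toContinuousLinearMap, map_smul, shiftOp_shiftOp] at h1
  rw [conv, ← h1, ← integral_sub_right_eq_self _ y]
  refine integral_congr_ae (Eventually.of_forall fun x => ?_)
  simp only [← smul_add, add_sub_cancel]

theorem hasFDerivAt_shiftOp_conv (hg : ContDiff ℝ 1 g) (hgs : HasCompactSupport g)
    (φ : Lp ℝ p P) : ∃ L : Space d →L[ℝ] Lp ℝ p P,
      HasFDerivAt (fun y => shiftOp τ p (c • y) (conv τ p c g φ)) L 0 ∧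
      ∀ v, L v = - ∫ x, (fderiv ℝ g x v) • shiftOp τ p (c • x) φ := by
  set f : Space d → Lp ℝ p P := fun x => shiftOp τ p (c • x) φ with hf
  have hfc : Continuous f := continuous_shiftOp_smul c φ
  set B : Lp ℝ p P →L[ℝ] ℝ →L[ℝ] Lp ℝ p P := (ContinuousLinearMap.lsmul ℝ ℝ).flip
  -- Reflecting the kernel makes ∫ g(x - y) f(x) dx a convolution in y, which can be differentiated
  -- on the smooth factor.
  set g' : Space d → ℝ := fun x => g (-x) with hg'
  have hg'c : ContDiff ℝ 1 g' := hg.comp contDiff_neg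
  have hg's : HasCompactSupport g' := hgs.comp_homeomorph (Homeomorph.neg (Space d))
  have h1 := hg's.hasFDerivAt_convolution_right B (μ := volume) hfc.locallyIntegrable hg'c 0
  refine ⟨_, h1.congr_of_eventuallyEq (Eventually.of_forall fun y => ?_), fun v => ?_⟩
  · simp only
    rw [shiftOp_smul_conv hg.continuous hgs, convolution_def]
    refine integral_congr_ae (Eventually.of_forall fun x => ?_)
    simp [B, hf, hg']
  · rw [convolution_precompR_apply B hfc.locallyIntegrable (hg's.fderiv ℝ)
      (hg'c.continuous_fderiv one_ne_zero), convolution_def, ← integral_neg]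
    refine integral_congr_ae (Eventually.of_forall fun x => ?_)
    have h2 : fderiv ℝ g' (0 - x) v = - fderiv ℝ g x v := by
      have h3 : HasFDerivAt g (fderiv ℝ g x) (-(0 - x)) := by
        rw [zero_sub, neg_neg]
        exact (hg.differentiable one_ne_zero x).hasFDerivAt
      have h4 := h3.comp (0 - x) (hasFDerivAt_id (0 - x)).neg
      have h5 : HasFDerivAt g' ((fderiv ℝ g x).comp (-ContinuousLinearMap.id ℝ (Space d)))
        (0 - x) := h4
      rw [h5.fderiv]
      simp
    simp only [B, ContinuousLinearMap.flip_apply, ContinuousLinearMap.lsmul_apply, h2, hf, neg_smul]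

/-- The factor c⁻¹ works at both ends: for c = -1/ε it is the small factor of two-scale compactness,
for large c the decay in the mean ergodic theorem. -/
theorem hasStochDeriv_conv (hc : c ≠ 0) (hg : ContDiff ℝ 1 g) (hgs : HasCompactSupport g)
    (i : Fin d) (φ : Lp ℝ p P) :
    HasStochDeriv τ p i (conv τ p c g φ) (-(c⁻¹ • conv τ p c (partialDeriv i g) φ)) := by
  obtain ⟨L, hL, hLv⟩ := hasFDerivAt_shiftOp_conv (τ := τ) (c := c) hg hgs φ
  -- Normalised so that c γ(h) = h e_i.
  set γ : ℝ → Space d := fun h => c⁻¹ • EuclideanSpace.single i h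
  have hγ : HasDerivAt γ (c⁻¹ • EuclideanSpace.single i 1) 0 := by
    have h1 : γ = fun h : ℝ => h • (c⁻¹ • EuclideanSpace.single i (1 : ℝ)) := by
      funext h
      ext j
      by_cases hj : j = i <;> simp [γ, hj, mul_comm]
    rw [h1]
    simpa using (hasDerivAt_id (0 : ℝ)).smul_const (c⁻¹ • EuclideanSpace.single i (1 : ℝ))
  have hγ0 : γ 0 = 0 := by simp [γ, single_zero_eq]
  have h2 : HasDerivAt (fun h : ℝ => shiftOp τ p (c • γ h) (conv τ p c g φ))
      (L (c⁻¹ • EuclideanSpace.single i 1)) 0 :=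
    HasFDerivAt.comp_hasDerivAt (0 : ℝ) (f := γ)
      (l := fun y => shiftOp τ p (c • y) (TwoScale.conv τ p c g φ)) (by rw [hγ0]; exact hL) hγ
  rw [hasDerivAt_iff_tendsto_slope_zero] at h2
  rw [map_smul, hLv, smul_neg] at h2
  refine h2.congr fun h => ?_
  rw [zero_add, hγ0, smul_zero, shiftOp_zero]
  simp only [γ, smul_smul, mul_inv_cancel₀ hc, one_smul]

theorem HasStochDeriv.map {i : Fin d} {φ ψ : Lp ℝ p P} (h : HasStochDeriv τ p i φ ψ)
    (A : Lp ℝ p P →L[ℝ] Lp ℝ p P) (hA : ∀ x φ, shiftOp τ p x (A φ) = A (shiftOp τ p x φ)) :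
    HasStochDeriv τ p i (A φ) (A ψ) := by
  refine ((A.continuous.tendsto ψ).comp h).congr fun s => ?_
  simp only [Function.comp, map_smul, map_sub, hA]

theorem HasStochDeriv.conv {i : Fin d} {φ ψ : Lp ℝ p P} (h : HasStochDeriv τ p i φ ψ)
    (hg : Continuous g) (hgs : HasCompactSupport g) :
    HasStochDeriv τ p i (conv τ p c g φ) (TwoScale.conv τ p c g ψ) :=
  h.map (convL τ p c hg hgs) fun x φ => shiftOp_conv hg hgs x φ

/-- Averages over small sets approximate the identity. -/
theorem tendsto_conv_zero (hg : Continuous g) (hgs : HasCompactSupport g) (hg1 : ∫ x, g x = 1)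
    (φ : Lp ℝ p P) : Tendsto (fun c => conv τ p c g φ) (𝓝 0) (𝓝 φ) := by
  have h1 : φ = ∫ x, g x • shiftOp τ p ((0 : ℝ) • x) φ := by
    simp only [zero_smul, shiftOp_zero]
    rw [integral_smul_const, hg1, one_smul]
  nth_rewrite 2 [h1]
  refine tendsto_integral_filter_of_dominated_convergence (fun x => ‖g x‖ * ‖φ‖)
    (Eventually.of_forall fun c => (integrable_conv c hg hgs φ).1)
    (Eventually.of_forall fun c => Eventually.of_forall fun x => ?_)
    ((hg.integrable_of_hasCompactSupport hgs).norm.mul_const _)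
    (Eventually.of_forall fun x => ?_)
  · rw [norm_smul, norm_shiftOp]
  · have h2 : Continuous fun c : ℝ => g x • shiftOp τ p (c • x) φ :=
      ((continuous_shiftOp φ).comp (continuous_id.smul continuous_const)).const_smul (g x)
    exact h2.tendsto 0

end Conv

/-! ### The mean ergodic theorem. -/

section Ergodic

variable {d : ℕ} {Ω : Type*} [MeasurableSpace Ω] {P : Measure Ω} [IsProbabilityMeasure P]
  (τ : ShiftGroup d P) (p : ℝ≥0∞) [Fact (1 ≤ p)] [Fact (p ≠ ⊤)]
  [SecondCountableTopology (Lp ℝ p P)]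

theorem isClosed_setOf_tendsto_zero {X Y : Type*} [NormedAddCommGroup X] [NormedSpace ℝ X]
    [NormedAddCommGroup Y] [NormedSpace ℝ Y] {ι : Type*} {l : Filter ι} (A : ι → X →L[ℝ] Y)
    {C : ℝ} (hA : ∀ n x, ‖A n x‖ ≤ C * ‖x‖) :
    IsClosed {x | Tendsto (fun n => A n x) l (𝓝 0)} := by
  refine isClosed_of_closure_subset fun x hx => ?_
  rw [Set.mem_ofPred_eq, Metric.tendsto_nhds]
  intro δ hδ
  have hC : 0 < |C| + 1 := by positivity
  obtain ⟨y, hy, hxy⟩ := Metric.mem_closure_iff.1 hx (δ / 2 / (|C| + 1)) (by positivity)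
  filter_upwards [(Metric.tendsto_nhds.1 hy) (δ / 2) (half_pos hδ)] with n hn
  rw [dist_zero_right] at hn ⊢
  have h1 : ‖A n (x - y)‖ < δ / 2 := by
    refine (hA n (x - y)).trans_lt ?_
    rw [dist_eq_norm, lt_div_iff₀ hC] at hxy
    refine lt_of_le_of_lt ?_ hxy
    have := le_abs_self C
    nlinarith [norm_nonneg (x - y)]
  calc ‖A n x‖ = ‖A n (x - y) + A n y‖ := by rw [← map_add, sub_add_cancel]
    _ ≤ ‖A n (x - y)‖ + ‖A n y‖ := norm_add_le _ _
    _ < δ := by linarith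

/-- The mean ergodic theorem: there is a bounded projection onto `L^p_inv` that does not see
shifts. -/
theorem exists_invariantProjection {q : ℝ≥0∞} [Fact (1 ≤ q)] [ENNReal.HolderConjugate p q]
    (hq : q ≠ ⊤) [TopologicalSpace.SeparableSpace (Lp ℝ q P)] :
    ∃ A : Lp ℝ p P →L[ℝ] Lp ℝ p P, (∀ φ, A φ ∈ LpInv τ p) ∧ (∀ φ ∈ LpInv τ p, A φ = φ) ∧
      ∀ x φ, A (shiftOp τ p x φ) = A φ := by
  obtain ⟨g, hg, hgs, hg0, hg1⟩ := exists_mollifier d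
  have hgn : ∫ x, ‖g x‖ = 1 := by
    rw [← hg1]
    exact integral_congr_ae (Eventually.of_forall fun x => Real.norm_of_nonneg (hg0 x))
  -- Averages at scale n + 1, nonzero also for n = 0. Their generators are O(1/(n+1)), so they
  -- become shift invariant in the limit.
  set A : ℕ → Lp ℝ p P →L[ℝ] Lp ℝ p P := fun n => convL τ p ((n : ℝ) + 1) hg.continuous hgs
  have hA : ∀ n φ, A n φ = conv τ p ((n : ℝ) + 1) g φ := fun n φ => rfl
  have hAn : ∀ n φ, ‖A n φ‖ ≤ 1 * ‖φ‖ := fun n φ => by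
    rw [hA, ← hgn]
    exact norm_conv_le _ _ _
  have hAU : ∀ n x φ, shiftOp τ p x (A n φ) = A n (shiftOp τ p x φ) := fun n x φ =>
    shiftOp_conv hg.continuous hgs x φ
  have hsingle : ∀ i s φ, Tendsto
      (fun n => shiftOp τ p (EuclideanSpace.single i s) (A n φ) - A n φ) atTop (𝓝 0) := by
    intro i s φ
    have h1 : ∀ n : ℕ, ‖shiftOp τ p (EuclideanSpace.single i s) (A n φ) - A n φ‖ ≤
        ((n : ℝ) + 1)⁻¹ * (|s| * ((∫ x, ‖partialDeriv i g x‖) * ‖φ‖)) := by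
      intro n
      have hn : (0 : ℝ) < (n : ℝ) + 1 := by positivity
      have h2 := (hasStochDeriv_conv (τ := τ) hn.ne' (hg.of_le (by simp)) hgs i
        φ).norm_shiftOp_sub_le s
      refine h2.trans ?_
      rw [norm_neg, norm_smul, Real.norm_of_nonneg (inv_nonneg.2 hn.le)]
      have h3 := norm_conv_le (τ := τ) ((n : ℝ) + 1) (partialDeriv i g) φ
      calc |s| * (((n : ℝ) + 1)⁻¹ * ‖conv τ p ((n : ℝ) + 1) (partialDeriv i g) φ‖)
          = ((n : ℝ) + 1)⁻¹ * (|s| * ‖conv τ p ((n : ℝ) + 1) (partialDeriv i g) φ‖) := by ring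
        _ ≤ _ := by gcongr
    refine squeeze_zero_norm h1 ?_
    have h4 := (tendsto_one_div_add_atTop_nhds_zero_nat (𝕜 := ℝ)).mul_const
      (|s| * ((∫ x, ‖partialDeriv i g x‖) * ‖φ‖))
    simpa using h4
  -- The closed span of the coboundaries U_x φ - φ. The averages tend to zero on R, fix L^p_inv, and
  -- φ - A_n φ is an average of coboundaries, hence in R.
  set R : Submodule ℝ (Lp ℝ p P) :=
    (Submodule.span ℝ {ψ | ∃ i s φ, ψ = shiftOp τ p (EuclideanSpace.single i s) φ - φ}
      ).topologicalClosure
  have hRU : ∀ x φ, shiftOp τ p x φ - φ ∈ R := shiftOp_sub_mem_of_single fun i s φ =>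
    Submodule.le_topologicalClosure _ (Submodule.subset_span ⟨i, s, φ, rfl⟩)
  have hR : ∀ ψ ∈ R, Tendsto (fun n => A n ψ) atTop (𝓝 0) := by
    intro ψ hψ
    refine closure_minimal (t := {ψ | Tendsto (fun n => A n ψ) atTop (𝓝 0)}) ?_
      (isClosed_setOf_tendsto_zero A hAn) hψ
    intro ψ hψ
    induction hψ using Submodule.span_induction with
    | mem ψ hψ =>
      obtain ⟨i, s, φ, rfl⟩ := hψ
      refine (hsingle i s φ).congr fun n => ?_
      rw [map_sub, hAU]
    | zero => simp
    | add ψ ψ' _ _ h h' =>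
      have := Tendsto.add h h'
      rw [add_zero] at this
      exact this.congr fun n => (map_add _ _ _).symm
    | smul c ψ _ h =>
      have := Tendsto.const_smul h c
      rw [smul_zero] at this
      exact this.congr fun n => (map_smul _ _ _).symm
  have hInv : ∀ n, ∀ φ ∈ LpInv τ p, A n φ = φ := fun n φ hφ => by
    rw [hA, conv_of_mem_LpInv hφ, hg1, one_smul]
  have hsub : ∀ n φ, φ - A n φ ∈ R := by
    intro n φ
    have h1 : φ - A n φ = ∫ x, g x • (φ - shiftOp τ p (((n : ℝ) + 1) • x) φ) := by
      simp only [smul_sub]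
      rw [integral_sub ((hg.continuous.integrable_of_hasCompactSupport hgs).smul_const φ)
        (integrable_conv _ hg.continuous hgs φ), integral_smul_const, hg1, one_smul]
      rfl
    rw [h1]
    refine integral_mem_submodule (Submodule.isClosed_topologicalClosure _)
      (Eventually.of_forall fun x => R.smul_mem _ ?_)
    rw [← neg_sub]
    exact R.neg_mem (hRU _ _)
  have hlim : ∀ φ, ∃ ψ ∈ LpInv τ p, Tendsto (fun n => A n φ) atTop (𝓝 ψ) := by
    intro φ
    obtain ⟨ψ, k, hk, hψ⟩ := exists_weak_subseq (p := p) (q := q) Fact.out hq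
      (fun n => A n φ) (C := 1 * ‖φ‖) fun n => hAn n φ
    have hψ' : WeakTendsto (fun n => A (k n) φ) atTop ψ := hψ
    have hψi : ψ ∈ LpInv τ p := by
      refine mem_LpInv_of_single fun i s => ?_
      have h1 := hψ'.map (shiftOp τ p (EuclideanSpace.single i s)).toContinuousLinearMap
      have h2 := (((hsingle i s φ).comp hk.tendsto_atTop).weakTendsto).add hψ'
      rw [zero_add] at h2
      refine h1.unique ?_
      simpa using h2
    have hψR : φ - ψ ∈ R := by
      have h1 := ((tendsto_const_nhds (x := φ) (f := atTop (α := ℕ))).weakTendsto).add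
        (hψ'.map (-ContinuousLinearMap.id ℝ (Lp ℝ p P)))
      have h2 := h1.mem_of_frequently (s := (R : Set (Lp ℝ p P))) (Submodule.convex R)
        (Submodule.isClosed_topologicalClosure _) (Frequently.of_forall fun n => by
          have := hsub (k n) φ
          simpa [sub_eq_add_neg] using this)
      simpa [sub_eq_add_neg] using h2
    refine ⟨ψ, hψi, ?_⟩
    -- With ψ a weak limit point that is invariant and satisfies φ - ψ ∈ R, A_n φ = ψ + A_n(φ - ψ)
    -- converges strongly, along the full sequence.
    have h3 := (hR _ hψR).const_add ψ
    rw [add_zero] at h3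
    refine h3.congr fun n => ?_
    rw [map_sub, hInv n ψ hψi, add_sub_cancel]
  choose B hB hBlim using hlim
  have hBt : Tendsto (fun n x => A n x) atTop (𝓝 B) := tendsto_pi_nhds.2 hBlim
  refine ⟨continuousLinearMapOfTendsto A hBt, hB, fun φ hφ => ?_, fun x φ => ?_⟩
  · change B φ = φ
    refine tendsto_nhds_unique (hBlim φ) ?_
    simp only [hInv _ φ hφ]
    exact tendsto_const_nhds
  · change B _ = B φ
    have h1 := (hR _ (hRU x φ)).add (hBlim φ)
    rw [zero_add] at h1
    refine tendsto_nhds_unique (hBlim _) (h1.congr fun n => ?_)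
    rw [map_sub, sub_add_cancel]

end Ergodic

/-! ### Vector fields through their components. -/

section Coordinates

variable {Z : Type*} [MeasurableSpace Z] {μ : Measure Z} {p : ℝ≥0∞} [Fact (1 ≤ p)] {d : ℕ}

/-- The `i`-th component of a vector field. -/
noncomputable def coord (μ : Measure Z) (p : ℝ≥0∞) [Fact (1 ≤ p)] (i : Fin d) :
    Lp (Space d) p μ →L[ℝ] Lp ℝ p μ :=
  (EuclideanSpace.proj i : Space d →L[ℝ] ℝ).compLpL p μ

/-- The vector field `u e_i`. -/
noncomputable def incl (μ : Measure Z) (p : ℝ≥0∞) [Fact (1 ≤ p)] (i : Fin d) :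
    Lp ℝ p μ →L[ℝ] Lp (Space d) p μ :=
  (ContinuousLinearMap.toSpanSingleton ℝ (EuclideanSpace.single i (1 : ℝ))).compLpL p μ

theorem coord_coeFn (i : Fin d) (G : Lp (Space d) p μ) :
    coord μ p i G =ᵐ[μ] fun z => G z i :=
  (EuclideanSpace.proj i : Space d →L[ℝ] ℝ).coeFn_compLpL G

theorem incl_coeFn (i : Fin d) (u : Lp ℝ p μ) :
    incl μ p i u =ᵐ[μ] fun z => EuclideanSpace.single i (u z) := by
  refine ((ContinuousLinearMap.toSpanSingleton ℝ
    (EuclideanSpace.single i (1 : ℝ))).coeFn_compLpL u).trans (Eventually.of_forall fun z => ?_)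
  ext j
  by_cases h : j = i <;> simp [h]

theorem coord_incl (i j : Fin d) (u : Lp ℝ p μ) :
    coord μ p i (incl μ p j u) = if i = j then u else 0 := by
  refine Lp.ext ?_
  split_ifs with h
  · subst h
    filter_upwards [coord_coeFn i (incl μ p i u), incl_coeFn i u] with z h1 h2
    rw [h1, h2]
    simp
  · filter_upwards [coord_coeFn i (incl μ p j u), incl_coeFn j u, Lp.coeFn_zero ℝ p μ]
      with z h1 h2 h3
    rw [h1, h2, h3]
    simp [h]

theorem coord_sum_incl (i : Fin d) (u : Fin d → Lp ℝ p μ) :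
    coord μ p i (∑ j, incl μ p j (u j)) = u i := by
  rw [map_sum]
  simp [coord_incl]

theorem ext_coord {G H : Lp (Space d) p μ} (h : ∀ i, coord μ p i G = coord μ p i H) : G = H := by
  refine Lp.ext ?_
  have h1 : ∀ᵐ z ∂μ, ∀ i, G z i = H z i := by
    rw [ae_all_iff]
    intro i
    filter_upwards [coord_coeFn i G, coord_coeFn i H] with z h1 h2
    rw [← h1, ← h2, h i]
  filter_upwards [h1] with z hz
  ext i
  exact hz i

theorem sum_incl_coord (G : Lp (Space d) p μ) : ∑ i, incl μ p i (coord μ p i G) = G :=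
  ext_coord fun i => coord_sum_incl i _

theorem norm_coord_le (i : Fin d) (G : Lp (Space d) p μ) : ‖coord μ p i G‖ ≤ ‖G‖ := by
  refine Lp.norm_le_norm_of_ae_le ?_
  filter_upwards [coord_coeFn i G] with z hz
  rw [hz]
  exact PiLp.norm_apply_le (G z) i

end Coordinates

/-! ### Tensor products and slicewise operators. -/

section Tensor

variable {Ω Y E : Type*} [MeasurableSpace Ω] [MeasurableSpace Y] {P : Measure Ω} {ν : Measure Y}
  [SFinite P] [SFinite ν] [NormedAddCommGroup E] [NormedSpace ℝ E] [CompleteSpace E]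
  {p : ℝ≥0∞} [Fact (1 ≤ p)] [Fact (p ≠ ⊤)] [SecondCountableTopology (Lp E p P)]

variable (E P ν p) in
/-- The continuous bilinear map `(φ, η) ↦ φ(w) η(y)`. -/
noncomputable def tensorL : Lp E p P →L[ℝ] Lp ℝ p ν →L[ℝ] Lp E p (P.prod ν) :=
  (ContinuousLinearMap.compL ℝ (Lp ℝ p ν) (Lp (Lp E p P) p ν) (Lp E p (P.prod ν))
    (slice (E := E) (P := P) (ν := ν) (p := p)).symm.toContinuousLinearEquiv.toContinuousLinearMap)
  ∘L (ContinuousLinearMap.lsmul ℝ ℝ : ℝ →L[ℝ] Lp E p P →L[ℝ] Lp E p P).flip.compLpL₂ p ν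

theorem slice_tensorL (φ : Lp E p P) (η : Lp ℝ p ν) :
    (slice (tensorL E P ν p φ η) : Lp (Lp E p P) p ν) =ᵐ[ν] fun y => η y • φ := by
  have h1 : slice (tensorL E P ν p φ η) =
      ((ContinuousLinearMap.lsmul ℝ ℝ : ℝ →L[ℝ] Lp E p P →L[ℝ] Lp E p P).flip φ).compLp η := by
    simp [tensorL]
  rw [h1]
  exact ContinuousLinearMap.coeFn_compLp _ _

theorem eq_of_slice_ae_eq {u v : Lp E p (P.prod ν)}
    (h : (slice u : Lp (Lp E p P) p ν) =ᵐ[ν] (slice v : Lp (Lp E p P) p ν)) : u = v :=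
  slice.injective (Lp.ext h)

theorem tensorL_eq_of_ae {u : Lp E p (P.prod ν)} {φ : Lp E p P} {η : Lp ℝ p ν}
    (h : u =ᵐ[P.prod ν] fun z => η z.2 • φ z.1) : tensorL E P ν p φ η = u :=
  eq_of_slice_ae_eq ((slice_tensorL φ η).trans (slice_ae_eq_of_ae h).symm)

theorem tensorL_coeFn (φ : Lp E p P) (η : Lp ℝ p ν) :
    tensorL E P ν p φ η =ᵐ[P.prod ν] fun z => η z.2 • φ z.1 := by
  rw [tensorL_eq_of_ae (tensor_coeFn φ η)]
  exact tensor_coeFn φ η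

/-- The lift of an operator on `L^p(Ω)` to `L^p(Ω × Y)`, acting on each slice. -/
noncomputable def liftOp (ν : Measure Y) [SFinite ν] (A : Lp E p P →L[ℝ] Lp E p P) :
    Lp E p (P.prod ν) →L[ℝ] Lp E p (P.prod ν) :=
  (slice (E := E) (P := P) (ν := ν) (p := p)).symm.toContinuousLinearEquiv.toContinuousLinearMap ∘L
    A.compLpL p ν ∘L
    (slice (E := E) (P := P) (ν := ν) (p := p)).toContinuousLinearEquiv.toContinuousLinearMap

theorem slice_liftOp (A : Lp E p P →L[ℝ] Lp E p P) (u : Lp E p (P.prod ν)) :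
    (slice (liftOp ν A u) : Lp (Lp E p P) p ν) =ᵐ[ν] fun y => A ((slice u : Lp _ p ν) y) := by
  have h1 : slice (liftOp ν A u) = A.compLpL p ν (slice u) := by
    simp [liftOp]
  rw [h1]
  exact A.coeFn_compLpL _

theorem liftOp_tensorL (A : Lp E p P →L[ℝ] Lp E p P) (φ : Lp E p P) (η : Lp ℝ p ν) :
    liftOp ν A (tensorL E P ν p φ η) = tensorL E P ν p (A φ) η := by
  refine eq_of_slice_ae_eq ?_
  filter_upwards [slice_liftOp A (tensorL E P ν p φ η), slice_tensorL φ η,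
    slice_tensorL (A φ) η] with y h1 h2 h3
  rw [h1, h2, h3, map_smul]

/-- The pair of products `(φ a, φ b)` for a pair `(a, b)` of a function and a vector field. -/
noncomputable def tensorPair [SecondCountableTopology (Lp ℝ p P)] {d : ℕ} (φ : Lp ℝ p P) :
    (Lp ℝ p ν × Lp (Space d) p ν) →L[ℝ]
      (Lp ℝ p (P.prod ν) × Lp (Space d) p (P.prod ν)) :=
  ((tensorL ℝ P ν p φ) ∘L ContinuousLinearMap.fst ℝ _ _).prod
    (∑ i, (incl (P.prod ν) p i) ∘L (tensorL ℝ P ν p φ) ∘L (coord ν p i) ∘L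
      ContinuousLinearMap.snd ℝ _ _)

variable [SecondCountableTopology (Lp ℝ p P)] {d : ℕ}

theorem tensorPair_fst (φ : Lp ℝ p P) (η : Lp ℝ p ν × Lp (Space d) p ν) :
    (tensorPair φ η).1 = tensorL ℝ P ν p φ η.1 := rfl

theorem coord_tensorPair (φ : Lp ℝ p P) (η : Lp ℝ p ν × Lp (Space d) p ν) (i : Fin d) :
    coord (P.prod ν) p i (tensorPair φ η).2 = tensorL ℝ P ν p φ (coord ν p i η.2) := by
  have h1 : (tensorPair φ η).2 = ∑ i, incl (P.prod ν) p i (tensorL ℝ P ν p φ (coord ν p i η.2)) := by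
    simp [tensorPair]
  rw [h1, coord_sum_incl]

/-- Translates the pointwise description of products in `randomSobolevZero` into the bounded
operator `tensorPair`, so that closure arguments in η become available. -/
theorem tensorPair_eq_iff (φ : Lp ℝ p P) (η : Lp ℝ p ν × Lp (Space d) p ν)
    (w : Lp ℝ p (P.prod ν) × Lp (Space d) p (P.prod ν)) :
    w = tensorPair φ η ↔ w.1 =ᵐ[P.prod ν] (fun z => φ z.1 * η.1 z.2) ∧
      w.2 =ᵐ[P.prod ν] (fun z => φ z.1 • η.2 z.2) := by
  have h1 : (tensorPair φ η).1 =ᵐ[P.prod ν] (fun z => φ z.1 * η.1 z.2) := by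
    rw [tensorPair_fst]
    filter_upwards [tensorL_coeFn φ η.1] with z hz
    rw [hz, smul_eq_mul, mul_comm]
  have h2 : (tensorPair φ η).2 =ᵐ[P.prod ν] (fun z => φ z.1 • η.2 z.2) := by
    have h3 : ∀ᵐ z ∂(P.prod ν), ∀ i, (tensorPair φ η).2 z i = φ z.1 * η.2 z.2 i := by
      rw [ae_all_iff]
      intro i
      have h4 := (Measure.quasiMeasurePreserving_snd (μ := P) (ν := ν)).ae_eq_comp
        (coord_coeFn i η.2)
      filter_upwards [coord_coeFn i (tensorPair φ η).2, tensorL_coeFn φ (coord ν p i η.2), h4]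
        with z h5 h6 h7
      simp only [Function.comp] at h7
      rw [← h5, coord_tensorPair, h6, h7, smul_eq_mul, mul_comm]
    filter_upwards [h3] with z hz
    ext i
    simpa using hz i
  constructor
  · rintro rfl
    exact ⟨h1, h2⟩
  · rintro ⟨h3, h4⟩
    exact Prod.ext (Lp.ext (h3.trans h1.symm)) (Lp.ext (h4.trans h2.symm))

end Tensor

/-! ### Test functions and density in the random Sobolev spaces. -/

section Sobolev

variable {d : ℕ} {Ω : Type*} [MeasurableSpace Ω] {P : Measure Ω}
  {p : ℝ≥0∞} [Fact (1 ≤ p)] {Q : Set (Space d)}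

/-- A smooth function with compact support. -/
structure IsTest (η : Space d → ℝ) : Prop where
  contDiff : ContDiff ℝ ∞ η
  hasCompactSupport : HasCompactSupport η

theorem IsTest.continuous {η : Space d → ℝ} (h : IsTest η) : Continuous η := h.contDiff.continuous

theorem IsTest.contDiff_one {η : Space d → ℝ} (h : IsTest η) : ContDiff ℝ 1 η :=
  h.contDiff.of_le (by simp)

theorem IsTest.partialDeriv {η : Space d → ℝ} (h : IsTest η) (i : Fin d) :
    IsTest (partialDeriv i η) :=
  ⟨(h.contDiff.fderiv_right (m := ∞) (by simp)).clm_apply contDiff_const,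
    hasCompactSupport_partialDeriv i h.hasCompactSupport⟩

theorem IsTest.mul {η ζ : Space d → ℝ} (h : IsTest η) (h' : IsTest ζ) :
    IsTest (fun x => η x * ζ x) :=
  ⟨h.contDiff.mul h'.contDiff, h'.hasCompactSupport.mul_left⟩

theorem partialDeriv_mul {η ζ : Space d → ℝ} (h : IsTest η) (h' : IsTest ζ) (i : Fin d)
    (x : Space d) : partialDeriv i (fun x => η x * ζ x) x =
      η x * partialDeriv i ζ x + partialDeriv i η x * ζ x := by
  have h1 := (h.contDiff_one.differentiable one_ne_zero x).hasFDerivAt.mul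
    (h'.contDiff_one.differentiable one_ne_zero x).hasFDerivAt
  have h2 : HasFDerivAt (fun x => η x * ζ x) _ x := h1
  rw [TwoScale.partialDeriv, h2.fderiv]
  simp [TwoScale.partialDeriv, mul_comm]

theorem IsTest.continuous_gradient {η : Space d → ℝ} (h : IsTest η) :
    Continuous (gradient η) :=
  (InnerProductSpace.toDual ℝ (Space d)).symm.continuous.comp
    (h.contDiff_one.continuous_fderiv one_ne_zero)

theorem IsTest.hasCompactSupport_gradient {η : Space d → ℝ} (h : IsTest η) :
    HasCompactSupport (gradient η) :=
  (h.hasCompactSupport.fderiv ℝ).comp_left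
    (g := (InnerProductSpace.toDual ℝ (Space d)).symm) (map_zero _)

theorem IsTest.memLp {η : Space d → ℝ} (h : IsTest η) (p : ℝ≥0∞) (Q : Set (Space d)) :
    MemLp η p (volume.restrict Q) :=
  h.continuous.memLp_of_hasCompactSupport h.hasCompactSupport

theorem IsTest.memLp_gradient {η : Space d → ℝ} (h : IsTest η) (p : ℝ≥0∞) (Q : Set (Space d)) :
    MemLp (gradient η) p (volume.restrict Q) :=
  h.continuous_gradient.memLp_of_hasCompactSupport h.hasCompactSupport_gradient

/-- The pair `(η, ∇η)` of a test function. -/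
noncomputable def testPair (p : ℝ≥0∞) (Q : Set (Space d)) {η : Space d → ℝ} (h : IsTest η) :
    Lp ℝ p (volume.restrict Q) × Lp (Space d) p (volume.restrict Q) :=
  ((h.memLp p Q).toLp η, (h.memLp_gradient p Q).toLp (gradient η))

theorem testPair_mem_sobolevZero {η : Space d → ℝ} (h : IsTest η) (hQ : tsupport η ⊆ Q) :
    testPair p Q h ∈ sobolevZero p Q :=
  Submodule.le_topologicalClosure _ (Submodule.subset_span
    ⟨η, h.contDiff, h.hasCompactSupport, hQ, (h.memLp p Q).coeFn_toLp,
      (h.memLp_gradient p Q).coeFn_toLp⟩)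

theorem coord_testPair {η : Space d → ℝ} (h : IsTest η) (i : Fin d) :
    coord (volume.restrict Q) p i (testPair p Q h).2 =ᵐ[volume.restrict Q] partialDeriv i η := by
  filter_upwards [coord_coeFn i (testPair p Q h).2, (h.memLp_gradient p Q).coeFn_toLp]
    with x h1 h2
  rw [h1]
  change ((h.memLp_gradient p Q).toLp (gradient η) : Space d → Space d) x i = _
  rw [h2, gradient_apply]

variable [SFinite P] [SFinite (volume.restrict Q)] [Fact (p ≠ ⊤)]
  [SecondCountableTopology (Lp ℝ p P)]

theorem tensorPair_mem_randomSobolevZero {X : Submodule ℝ (Lp ℝ p P)} {φ : Lp ℝ p P} (hφ : φ ∈ X)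
    {η : Lp ℝ p (volume.restrict Q) × Lp (Space d) p (volume.restrict Q)}
    (hη : η ∈ sobolevZero p Q) : tensorPair φ η ∈ randomSobolevZero p Q X :=
  Submodule.le_topologicalClosure _ (Submodule.subset_span
    ⟨φ, hφ, η, hη, ((tensorPair_eq_iff φ η _).1 rfl).1, ((tensorPair_eq_iff φ η _).1 rfl).2⟩)

/-- The induction principle for these spaces: it removes both closures, that of the tensor product
and that in W^{1,p}_0, so closed linear properties need checking only on φ times a smooth function
supported in Q. -/
theorem randomSobolevZero_le {X : Submodule ℝ (Lp ℝ p P)}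
    {N : Submodule ℝ (Lp ℝ p (prodMeasure P Q) × Lp (Space d) p (prodMeasure P Q))}
    (hN : IsClosed (N : Set (Lp ℝ p (prodMeasure P Q) × Lp (Space d) p (prodMeasure P Q))))
    (h : ∀ φ ∈ X, ∀ ζ : Space d → ℝ, ∀ hζ : IsTest ζ, tsupport ζ ⊆ Q →
      tensorPair φ (testPair p Q hζ) ∈ N) : randomSobolevZero p Q X ≤ N := by
  refine Submodule.topologicalClosure_minimal _ (Submodule.span_le.2 ?_) hN
  rintro w ⟨φ, hφ, η, hη, h1, h2⟩
  rw [(tensorPair_eq_iff φ η w).2 ⟨h1, h2⟩]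
  have h3 : sobolevZero p Q ≤ N.comap (tensorPair φ).toLinearMap := by
    refine Submodule.topologicalClosure_minimal _ (Submodule.span_le.2 ?_)
      (hN.preimage (tensorPair φ).continuous)
    rintro v ⟨ζ, hζ1, hζ2, hζ3, h4, h5⟩
    have hζ : IsTest ζ := ⟨hζ1, hζ2⟩
    have h6 : v = testPair p Q hζ := Prod.ext
      (Lp.ext (h4.trans (hζ.memLp p Q).coeFn_toLp.symm))
      (Lp.ext (h5.trans (hζ.memLp_gradient p Q).coeFn_toLp.symm))
    rw [h6]
    exact h φ hφ ζ hζ hζ3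
  exact h3 hη

theorem randomSobolevZero_mono {X Y : Submodule ℝ (Lp ℝ p P)} (h : X ≤ Y) :
    randomSobolevZero p Q X ≤ randomSobolevZero p Q Y :=
  randomSobolevZero_le (Submodule.isClosed_topologicalClosure _) fun _ hφ _ hζ hQ =>
    tensorPair_mem_randomSobolevZero (h hφ) (testPair_mem_sobolevZero hζ hQ)

end Sobolev

/-! ### Unfolding as an isometry acting on slices by shifts. -/

section UnfoldL

variable {d : ℕ} {Ω : Type*} [MeasurableSpace Ω] {P : Measure Ω} [IsProbabilityMeasure P]
  (τ : ShiftGroup d P) (Q : Set (Space d)) {p : ℝ≥0∞} [Fact (1 ≤ p)] [hp : Fact (p ≠ ⊤)]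
  {F : Type*} [NormedAddCommGroup F] [NormedSpace ℝ F]

variable (F p) in
/-- The unfolding operator as a linear isometry. -/
noncomputable def unfoldL (ε : ℝ) :
    Lp F p (prodMeasure P Q) →ₗᵢ[ℝ] Lp F p (prodMeasure P Q) where
  toFun := unfold τ Q hp.out ε
  map_add' u v := by
    refine Lp.ext ?_
    filter_upwards [unfold_coeFn τ Q hp.out ε (u + v), unfold_coeFn τ Q hp.out ε u,
      unfold_coeFn τ Q hp.out ε v, Lp.coeFn_add (unfold τ Q hp.out ε u) (unfold τ Q hp.out ε v),
      ae_unfoldMap τ Q ε (Lp.coeFn_add u v)] with z h1 h2 h3 h4 h5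
    rw [h1, h4, Pi.add_apply, h2, h3, h5, Pi.add_apply]
  map_smul' c u := by
    refine Lp.ext ?_
    filter_upwards [unfold_coeFn τ Q hp.out ε (c • u), unfold_coeFn τ Q hp.out ε u,
      Lp.coeFn_smul c (unfold τ Q hp.out ε u),
      ae_unfoldMap τ Q ε (Lp.coeFn_smul c u)] with z h1 h2 h4 h5
    rw [h1, RingHom.id_apply, h4, Pi.smul_apply, h2, h5, Pi.smul_apply]
  norm_map' u := by
    change ‖unfold τ Q hp.out ε u‖ = ‖u‖
    rw [Lp.norm_def, Lp.norm_def, eLpNorm_congr_ae (unfold_coeFn τ Q hp.out ε u),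
      eLpNorm_eq_lintegral_rpow_enorm_toReal (exponent_ne_zero p) hp.out,
      eLpNorm_eq_lintegral_rpow_enorm_toReal (exponent_ne_zero p) hp.out,
      lintegral_unfoldMap_of_aemeasurable τ Q ε (g := fun z => ‖u z‖ₑ ^ p.toReal)
        ((Lp.aestronglyMeasurable u).enorm.pow_const _)]

theorem unfoldL_apply (ε : ℝ) (u : Lp F p (prodMeasure P Q)) :
    unfoldL τ Q p F ε u = unfold τ Q hp.out ε u := rfl

theorem coord_unfoldL (ε : ℝ) (i : Fin d) (G : Lp (Space d) p (prodMeasure P Q)) :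
    coord (prodMeasure P Q) p i (unfoldL τ Q p (Space d) ε G) =
      unfoldL τ Q p ℝ ε (coord (prodMeasure P Q) p i G) := by
  refine Lp.ext ?_
  filter_upwards [coord_coeFn i (unfoldL τ Q p (Space d) ε G), unfold_coeFn τ Q hp.out ε G,
    unfold_coeFn τ Q hp.out ε (coord (prodMeasure P Q) p i G),
    ae_unfoldMap τ Q ε (coord_coeFn i G)] with z h1 h2 h3 h4
  rw [h1, unfoldL_apply, h2, unfoldL_apply, h3, h4]

variable [SFinite (volume.restrict Q)] [SecondCountableTopology (Lp ℝ p P)]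

/-- Unfolding acts on the slice at `x` as the shift by `-x/ε`. -/
theorem slice_unfoldL (ε : ℝ) (u : Lp ℝ p (prodMeasure P Q)) :
    (slice (unfoldL τ Q p ℝ ε u) : Lp (Lp ℝ p P) p (volume.restrict Q)) =ᵐ[volume.restrict Q]
      fun x => shiftOp τ p ((-ε⁻¹) • x) ((slice u : Lp (Lp ℝ p P) p (volume.restrict Q)) x) := by
  refine slice_ae_eq ?_
  filter_upwards [slice_coeFn u, ae_ae_of_ae_prod_swap (unfold_coeFn τ Q hp.out ε u)] with x h1 h2
  have h3 := (τ.measurePreserving ((-ε⁻¹) • x)).quasiMeasurePreserving.ae_eq_comp h1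
  filter_upwards [h2, h3, shiftOp_coeFn (τ := τ) ((-ε⁻¹) • x)
    ((slice u : Lp (Lp ℝ p P) p (volume.restrict Q)) x)] with w h4 h5 h6
  simp only [Function.comp] at h5
  rw [unfoldL_apply, h4, h6, h5, unfoldMap, neg_smul]

theorem slice_unfoldL_tensorL (ε : ℝ) (φ : Lp ℝ p P) (η : Lp ℝ p (volume.restrict Q)) :
    (slice (unfoldL τ Q p ℝ ε (tensorL ℝ P (volume.restrict Q) p φ η)) :
      Lp (Lp ℝ p P) p (volume.restrict Q)) =ᵐ[volume.restrict Q]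
      fun x => η x • shiftOp τ p ((-ε⁻¹) • x) φ := by
  filter_upwards [slice_unfoldL τ Q ε (tensorL ℝ P (volume.restrict Q) p φ η),
    slice_tensorL φ η] with x h1 h2
  rw [h1, h2, map_smul]

theorem unfoldL_tensorL_of_mem_LpInv (ε : ℝ) {φ : Lp ℝ p P} (hφ : φ ∈ LpInv τ p)
    (η : Lp ℝ p (volume.restrict Q)) :
    unfoldL τ Q p ℝ ε (tensorL ℝ P (volume.restrict Q) p φ η) =
      tensorL ℝ P (volume.restrict Q) p φ η := by
  have h : ∀ x, shiftOp τ p x φ = φ := hφ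
  refine eq_of_slice_ae_eq ?_
  filter_upwards [slice_unfoldL_tensorL τ Q ε φ η, slice_tensorL φ η] with x h1 h2
  rw [h1, h2, h]

/-- Lifts of operators that do not see shifts do not see unfolding. -/
theorem liftOp_unfoldL {A : Lp ℝ p P →L[ℝ] Lp ℝ p P} (hA : ∀ x φ, A (shiftOp τ p x φ) = A φ)
    (ε : ℝ) (u : Lp ℝ p (prodMeasure P Q)) :
    liftOp (volume.restrict Q) A (unfoldL τ Q p ℝ ε u) = liftOp (volume.restrict Q) A u := by
  refine eq_of_slice_ae_eq ?_
  filter_upwards [slice_liftOp A (unfoldL τ Q p ℝ ε u), slice_liftOp A u,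
    slice_unfoldL τ Q ε u] with x h1 h2 h3
  rw [h1, h2, h3, hA]

end UnfoldL

/-! ### Averages over Q against test functions, with values in L^p(Ω). -/

section TestAverage

variable {d : ℕ} {Ω : Type*} [MeasurableSpace Ω] {P : Measure Ω} [SFinite P]
  {Q : Set (Space d)} [IsFiniteMeasure (volume.restrict Q)]
  {p : ℝ≥0∞} [Fact (1 ≤ p)] [hp : Fact (p ≠ ⊤)]
  {E : Type*} [NormedAddCommGroup E] [NormedSpace ℝ E] [CompleteSpace E]
  [SecondCountableTopology (Lp E p P)] {η : Space d → ℝ}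

theorem exists_integral_norm_le {Y X : Type*} [MeasurableSpace Y] [NormedAddCommGroup X]
    (ν : Measure Y) [IsFiniteMeasure ν] (p : ℝ≥0∞) [Fact (1 ≤ p)] :
    ∃ K : ℝ, ∀ f : Lp X p ν, ∫ y, ‖f y‖ ∂ν ≤ K * ‖f‖ := by
  refine ⟨(ν Set.univ ^ (1 / (1 : ℝ≥0∞).toReal - 1 / p.toReal)).toReal, fun f => ?_⟩
  have h1 := eLpNorm_le_eLpNorm_mul_rpow_measure_univ (p := 1) (q := p) (μ := ν)
    (Fact.out : 1 ≤ p) (Lp.aestronglyMeasurable f)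
  rw [integral_norm_eq_lintegral_enorm (Lp.aestronglyMeasurable f), ← eLpNorm_one_eq_lintegral_enorm,
    mul_comm, Lp.norm_def, ← ENNReal.toReal_mul]
  refine ENNReal.toReal_mono ?_ h1
  refine ENNReal.mul_ne_top (Lp.eLpNorm_ne_top f) ?_
  refine ENNReal.rpow_ne_top_of_nonneg ?_ (measure_ne_top _ _)
  rcases eq_or_ne p ⊤ with rfl | hp
  · simp
  · have h2 : 1 ≤ p.toReal := by
      rw [← ENNReal.toReal_one]
      exact ENNReal.toReal_mono hp Fact.out
    simp only [ENNReal.toReal_one, div_one, sub_nonneg]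
    exact (div_le_one (by linarith)).2 h2

theorem integrable_test_smul {X : Type*} [NormedAddCommGroup X] [NormedSpace ℝ X] (hη : IsTest η)
    (f : Lp X p (volume.restrict Q)) : Integrable (fun x => η x • f x) (volume.restrict Q) := by
  obtain ⟨C, hC⟩ := hη.hasCompactSupport.exists_bound_of_continuous hη.continuous
  exact ((Lp.memLp f).integrable Fact.out).bdd_smul C hη.continuous.aestronglyMeasurable
    (Eventually.of_forall hC)

variable (Q p) in
/-- The integral `∫_Q η(x) f(x) dx` against a test function, for vector valued `f`. -/
noncomputable def testInt (X : Type*) [NormedAddCommGroup X] [NormedSpace ℝ X]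
    (hη : IsTest η) : Lp X p (volume.restrict Q) →L[ℝ] X :=
  LinearMap.mkContinuousOfExistsBound
    { toFun := fun f => ∫ x in Q, η x • f x
      map_add' := fun u v => by
        rw [← integral_add (integrable_test_smul hη _) (integrable_test_smul hη _)]
        refine integral_congr_ae ?_
        filter_upwards [Lp.coeFn_add u v] with x hx
        rw [hx, Pi.add_apply, smul_add]
      map_smul' := fun c u => by
        rw [RingHom.id_apply, ← integral_smul]
        refine integral_congr_ae ?_
        filter_upwards [Lp.coeFn_smul c u] with x hx
        rw [hx, Pi.smul_apply, smul_comm] } (by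
    obtain ⟨K, hK⟩ := exists_integral_norm_le (X := X) (volume.restrict Q) p
    obtain ⟨C, hC⟩ := hη.hasCompactSupport.exists_bound_of_continuous hη.continuous
    have hC0 : 0 ≤ C := (norm_nonneg _).trans (hC 0)
    refine ⟨C * K, fun u => ?_⟩
    have h1 := (Lp.memLp u).integrable (Fact.out : 1 ≤ p)
    refine (norm_integral_le_integral_norm _).trans ?_
    calc ∫ x in Q, ‖η x • u x‖
        ≤ ∫ x in Q, C * ‖u x‖ := by
          refine integral_mono (integrable_test_smul hη _).norm (h1.norm.const_mul C) fun x => ?_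
          simp only
          rw [norm_smul]
          exact mul_le_mul_of_nonneg_right (hC x) (norm_nonneg _)
      _ = C * ∫ x in Q, ‖u x‖ := integral_const_mul _ _
      _ ≤ C * (K * ‖u‖) := mul_le_mul_of_nonneg_left (hK _) hC0
      _ = C * K * ‖u‖ := by rw [mul_assoc])

variable (P Q p E) in
/-- The average `∫_Q η(x) u(·, x) dx` against a test function, an element of `L^p(Ω; E)`. -/
noncomputable def testAvg (hη : IsTest η) : Lp E p (prodMeasure P Q) →L[ℝ] Lp E p P :=
  testInt Q p (Lp E p P) hη ∘L
    (slice (P := P) (ν := volume.restrict Q) (E := E) (p := p)).toContinuousLinearEquiv.toContinuousLinearMap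

theorem testAvg_apply (hη : IsTest η) (u : Lp E p (prodMeasure P Q)) :
    testAvg P Q p E hη u = ∫ x in Q, η x • (slice u : Lp (Lp E p P) p (volume.restrict Q)) x :=
  rfl

theorem testAvg_eq_of_slice (hη : IsTest η) {u : Lp E p (prodMeasure P Q)}
    {f : Space d → Lp E p P}
    (h : (slice u : Lp (Lp E p P) p (volume.restrict Q)) =ᵐ[volume.restrict Q] f) :
    testAvg P Q p E hη u = ∫ x in Q, η x • f x := by
  rw [testAvg_apply]
  refine integral_congr_ae ?_
  filter_upwards [h] with x hx
  rw [hx]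

theorem testAvg_map_slice {F : Type*} [NormedAddCommGroup F] [NormedSpace ℝ F] [CompleteSpace F]
    [SecondCountableTopology (Lp F p P)] (hη : IsTest η) {u : Lp E p (prodMeasure P Q)}
    {v : Lp F p (prodMeasure P Q)} (A : Lp E p P →L[ℝ] Lp F p P)
    (h : (slice v : Lp (Lp F p P) p (volume.restrict Q)) =ᵐ[volume.restrict Q]
      fun x => A ((slice u : Lp (Lp E p P) p (volume.restrict Q)) x)) :
    testAvg P Q p F hη v = A (testAvg P Q p E hη u) := by
  rw [testAvg_eq_of_slice hη h, testAvg_apply, ← A.integral_comp_comm (integrable_test_smul hη _)]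
  refine integral_congr_ae (Eventually.of_forall fun x => ?_)
  simp

theorem testAvg_liftOp (hη : IsTest η) (A : Lp E p P →L[ℝ] Lp E p P)
    (u : Lp E p (prodMeasure P Q)) :
    testAvg P Q p E hη (liftOp (volume.restrict Q) A u) = A (testAvg P Q p E hη u) :=
  testAvg_map_slice hη A (slice_liftOp A u)

theorem coord_testAvg [SecondCountableTopology (Lp ℝ p P)]
    [SecondCountableTopology (Lp (Space d) p P)] (hη : IsTest η) (i : Fin d)
    (G : Lp (Space d) p (prodMeasure P Q)) :
    coord P p i (testAvg P Q p (Space d) hη G) =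
      testAvg P Q p ℝ hη (coord (prodMeasure P Q) p i G) :=
  (testAvg_map_slice hη (coord P p i) (slice_ae_eq_map (EuclideanSpace.proj i))).symm

/-- The fundamental lemma of the calculus of variations, applied to the slices as L^p(Ω)-valued
functions on Q. -/
theorem eq_of_testAvg_eq {u v : Lp E p (prodMeasure P Q)}
    (h : ∀ η : Space d → ℝ, ∀ hη : IsTest η, testAvg P Q p E hη u = testAvg P Q p E hη v) :
    u = v := by
  refine eq_of_slice_ae_eq ?_
  refine ae_eq_of_integral_contDiff_smul_eq
    ((Lp.memLp _).integrable Fact.out).locallyIntegrable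
    ((Lp.memLp _).integrable Fact.out).locallyIntegrable fun η h1 h2 => ?_
  exact h η ⟨h1, h2⟩

end TestAverage

/-! ### The stochastic derivative of a tested unfolded function. -/

section KeyIdentity

variable {d : ℕ} {Ω : Type*} [MeasurableSpace Ω] {P : Measure Ω} [IsProbabilityMeasure P]
  (τ : ShiftGroup d P) {Q : Set (Space d)} [IsFiniteMeasure (volume.restrict Q)]
  {p : ℝ≥0∞} [Fact (1 ≤ p)] [hp : Fact (p ≠ ⊤)] [SecondCountableTopology (Lp ℝ p P)]
  {η ζ : Space d → ℝ}

theorem setIntegral_eq_of_tsupport {X : Type*} [NormedAddCommGroup X] [NormedSpace ℝ X]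
    (hζ : tsupport ζ ⊆ Q) (f : Space d → X) : ∫ x in Q, ζ x • f x = ∫ x, ζ x • f x := by
  refine setIntegral_eq_integral_of_forall_compl_eq_zero fun x hx => ?_
  rw [image_eq_zero_of_notMem_tsupport fun h => hx (hζ h), zero_smul]

/-- The unfolded slice at x is ζ(x) U_{-x/ε} φ, so testing produces an average of φ at scale -1/ε
with kernel ηζ. The support of ζ lets the integral over Q be taken over ℝ^d. -/
theorem testAvg_unfoldL_tensorL (ε : ℝ) (hη : IsTest η) (hζ : tsupport ζ ⊆ Q) (φ : Lp ℝ p P)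
    {z : Lp ℝ p (volume.restrict Q)} (hz : z =ᵐ[volume.restrict Q] ζ) :
    testAvg P Q p ℝ hη (unfoldL τ Q p ℝ ε (tensorL ℝ P (volume.restrict Q) p φ z)) =
      conv τ p (-ε⁻¹) (fun x => η x * ζ x) φ := by
  have h1 : (slice (unfoldL τ Q p ℝ ε (tensorL ℝ P (volume.restrict Q) p φ z)) :
      Lp (Lp ℝ p P) p (volume.restrict Q)) =ᵐ[volume.restrict Q]
      fun x => ζ x • shiftOp τ p ((-ε⁻¹) • x) φ := by
    filter_upwards [slice_unfoldL_tensorL τ Q ε φ z, hz] with x h1 h2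
    rw [h1, h2]
  rw [testAvg_eq_of_slice hη h1, conv]
  rw [← setIntegral_eq_of_tsupport (Q := Q)
    ((tsupport_mul_subset_right (f := η) (g := ζ)).trans hζ)]
  simp only [mul_smul]

theorem tsupport_partialDeriv_subset (i : Fin d) : tsupport (partialDeriv i ζ) ⊆ tsupport ζ := by
  refine closure_minimal (fun x hx => ?_) (isClosed_tsupport ζ)
  refine support_fderiv_subset ℝ (f := ζ) (fun h0 => hx ?_)
  simp [partialDeriv, h0]

theorem testPair_coeFn (hζ : IsTest ζ) : (testPair p Q hζ).1 =ᵐ[volume.restrict Q] ζ :=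
  (hζ.memLp p Q).coeFn_toLp

/-- The part of `∇u` seen by unfolding and testing: `∫ η T_ε ∂_i u + ∫ ∂_i η T_ε u`. -/
noncomputable def testedDeriv (p : ℝ≥0∞) [Fact (1 ≤ p)] [Fact (p ≠ ⊤)]
    [SecondCountableTopology (Lp ℝ p P)] (hη : IsTest η) (i : Fin d) :
    (Lp ℝ p (prodMeasure P Q) × Lp (Space d) p (prodMeasure P Q)) →L[ℝ] Lp ℝ p P :=
  (testAvg P Q p ℝ hη ∘L coord (prodMeasure P Q) p i ∘L ContinuousLinearMap.snd ℝ _ _) +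
    (testAvg P Q p ℝ (hη.partialDeriv i) ∘L ContinuousLinearMap.fst ℝ _ _)

theorem testedDeriv_apply (hη : IsTest η) (i : Fin d)
    (w : Lp ℝ p (prodMeasure P Q) × Lp (Space d) p (prodMeasure P Q)) :
    testedDeriv p hη i w = testAvg P Q p ℝ hη (coord (prodMeasure P Q) p i w.2) +
      testAvg P Q p ℝ (hη.partialDeriv i) w.1 := rfl

variable (Q p) in
/-- The unfolding operator on pairs `(u, ∇u)`. -/
noncomputable def unfoldPair (ε : ℝ) :
    (Lp ℝ p (prodMeasure P Q) × Lp (Space d) p (prodMeasure P Q)) →L[ℝ]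
      (Lp ℝ p (prodMeasure P Q) × Lp (Space d) p (prodMeasure P Q)) :=
  (unfoldL τ Q p ℝ ε).toContinuousLinearMap.prodMap
    (unfoldL τ Q p (Space d) ε).toContinuousLinearMap

theorem unfoldPair_apply (ε : ℝ)
    (w : Lp ℝ p (prodMeasure P Q) × Lp (Space d) p (prodMeasure P Q)) :
    unfoldPair τ Q p ε w = (unfoldL τ Q p ℝ ε w.1, unfoldL τ Q p (Space d) ε w.2) := rfl

/-- The two terms have kernels η ∂_i ζ and ζ ∂_i η; the Leibniz rule merges them. -/
theorem testedDeriv_unfoldPair_tensorPair (ε : ℝ) (hη : IsTest η) (hζ : IsTest ζ)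
    (hζQ : tsupport ζ ⊆ Q) (φ : Lp ℝ p P) (i : Fin d) :
    testedDeriv p hη i (unfoldPair τ Q p ε (tensorPair φ (testPair p Q hζ))) =
      conv τ p (-ε⁻¹) (partialDeriv i (fun x => η x * ζ x)) φ := by
  rw [testedDeriv_apply, unfoldPair_apply]
  simp only
  rw [coord_unfoldL, coord_tensorPair, tensorPair_fst,
    testAvg_unfoldL_tensorL τ ε hη ((tsupport_partialDeriv_subset i).trans hζQ) φ
      (coord_testPair hζ i),
    testAvg_unfoldL_tensorL τ ε (hη.partialDeriv i) hζQ φ (testPair_coeFn hζ), conv, conv,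
    conv, ← integral_add
      (integrable_conv _ (hη.mul (hζ.partialDeriv i)).continuous
        (hη.mul (hζ.partialDeriv i)).hasCompactSupport φ)
      (integrable_conv _ ((hη.partialDeriv i).mul hζ).continuous
        ((hη.partialDeriv i).mul hζ).hasCompactSupport φ)]
  refine integral_congr_ae (Eventually.of_forall fun x => ?_)
  simp only
  rw [← add_smul, partialDeriv_mul hη hζ]

/-- D_i of an average at scale c costs -c⁻¹ and differentiates the kernel; with c = -1/ε the factor
is ε. This is the identity behind both parts of the two-scale limit. -/
theorem hasStochDeriv_testAvg_tensorPair {ε : ℝ} (hε : ε ≠ 0) (hη : IsTest η) (hζ : IsTest ζ)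
    (hζQ : tsupport ζ ⊆ Q) (φ : Lp ℝ p P) (i : Fin d) :
    HasStochDeriv τ p i
      (testAvg P Q p ℝ hη (unfoldPair τ Q p ε (tensorPair φ (testPair p Q hζ))).1)
      (ε • testedDeriv p hη i (unfoldPair τ Q p ε (tensorPair φ (testPair p Q hζ)))) := by
  rw [testedDeriv_unfoldPair_tensorPair τ ε hη hζ hζQ φ i, unfoldPair_apply]
  simp only
  rw [tensorPair_fst, testAvg_unfoldL_tensorL τ ε hη hζQ φ (testPair_coeFn hζ)]
  have h1 := hasStochDeriv_conv (τ := τ) (c := -ε⁻¹) (neg_ne_zero.2 (inv_ne_zero hε))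
    (hη.mul hζ).contDiff_one (hη.mul hζ).hasCompactSupport i φ
  have h2 : -((-ε⁻¹)⁻¹ • conv τ p (-ε⁻¹) (partialDeriv i fun x => η x * ζ x) φ) =
      ε • conv τ p (-ε⁻¹) (partialDeriv i fun x => η x * ζ x) φ := by
    rw [inv_neg, inv_inv, neg_smul, neg_neg]
  rw [h2] at h1
  exact h1

/-- On products, ε times this vector is a stochastic gradient. A subspace absorbs the factor ε⁻¹,
and `LpPot` is closed, so the general case follows by density. -/
theorem sum_incl_testedDeriv_mem_LpPot {ε : ℝ} (hε : ε ≠ 0) (hη : IsTest η)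
    {w : Lp ℝ p (prodMeasure P Q) × Lp (Space d) p (prodMeasure P Q)}
    (hw : w ∈ randomSobolevZero p Q (⊤ : Submodule ℝ (Lp ℝ p P))) :
    ∑ i, incl P p i (testedDeriv p hη i (unfoldPair τ Q p ε w)) ∈ LpPot τ p := by
  set A : (Lp ℝ p (prodMeasure P Q) × Lp (Space d) p (prodMeasure P Q)) →L[ℝ] Lp (Space d) p P :=
    ∑ i, incl P p i ∘L testedDeriv p hη i ∘L unfoldPair τ Q p ε with hA
  have hAw : ∀ w, A w = ∑ i, incl P p i (testedDeriv p hη i (unfoldPair τ Q p ε w)) := fun w => by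
    simp [hA]
  rw [← hAw]
  have h1 : randomSobolevZero p Q (⊤ : Submodule ℝ (Lp ℝ p P)) ≤
      (LpPot τ p).comap A.toLinearMap := by
    refine randomSobolevZero_le
      ((Submodule.isClosed_topologicalClosure _).preimage A.continuous) ?_
    intro φ _ ζ hζ hζQ
    change A _ ∈ LpPot τ p
    have h2 : ε • A (tensorPair φ (testPair p Q hζ)) ∈ stochGradRange τ p := by
      refine ⟨testAvg P Q p ℝ hη (unfoldPair τ Q p ε (tensorPair φ (testPair p Q hζ))).1,
        fun i => ?_⟩
      have h3 := hasStochDeriv_testAvg_tensorPair τ hε hη hζ hζQ φ i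
      have h4 : coord P p i (ε • A (tensorPair φ (testPair p Q hζ))) =
          ε • testedDeriv p hη i (unfoldPair τ Q p ε (tensorPair φ (testPair p Q hζ))) := by
        rw [map_smul, hAw, coord_sum_incl]
      rw [← h4] at h3
      exact h3
    have h5 := (LpPot τ p).smul_mem ε⁻¹ (Submodule.le_topologicalClosure _ h2)
    rwa [smul_smul, inv_mul_cancel₀ hε, one_smul] at h5
  exact h1 hw

theorem norm_shiftOp_testAvg_sub_le {ε : ℝ} (hε : ε ≠ 0) (hη : IsTest η)
    {w : Lp ℝ p (prodMeasure P Q) × Lp (Space d) p (prodMeasure P Q)}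
    (hw : w ∈ randomSobolevZero p Q (⊤ : Submodule ℝ (Lp ℝ p P))) (i : Fin d) (s : ℝ) :
    ‖shiftOp τ p (EuclideanSpace.single i s) (testAvg P Q p ℝ hη (unfoldPair τ Q p ε w).1) -
      testAvg P Q p ℝ hη (unfoldPair τ Q p ε w).1‖ ≤
      |s| * ‖ε • testedDeriv p hη i (unfoldPair τ Q p ε w)‖ := by
  set T := unfoldPair τ Q p ε
  -- The derivative identity holds on a dense subspace; the mean value inequality deduced from it is
  -- a closed condition and so extends, without any appeal to closedness of D_i.
  set N : Submodule ℝ (Lp ℝ p (prodMeasure P Q) × Lp (Space d) p (prodMeasure P Q)) :=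
    { carrier := {w | HasStochDeriv τ p i (testAvg P Q p ℝ hη (T w).1)
        (ε • testedDeriv p hη i (T w))}
      zero_mem' := by simp [HasStochDeriv]
      add_mem' := fun {v w} hv hw => by
        have h := Tendsto.add hv hw
        simp only [Set.mem_ofPred_eq, HasStochDeriv, map_add, Prod.fst_add, smul_add]
        refine h.congr fun r => ?_
        rw [← smul_add]
        congr 1
        abel
      smul_mem' := fun c w hw => by
        have h := Tendsto.const_smul hw c
        simp only [Set.mem_ofPred_eq, HasStochDeriv, map_smul, Prod.smul_fst]
        rw [smul_comm]
        refine h.congr fun r => ?_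
        rw [← smul_sub, smul_comm] }
  have h1 : randomSobolevZero p Q (⊤ : Submodule ℝ (Lp ℝ p P)) ≤ N.topologicalClosure :=
    randomSobolevZero_le (Submodule.isClosed_topologicalClosure _) fun φ _ ζ hζ hζQ =>
      Submodule.le_topologicalClosure _ (hasStochDeriv_testAvg_tensorPair τ hε hη hζ hζQ φ i)
  have h2 : IsClosed {w : Lp ℝ p (prodMeasure P Q) × Lp (Space d) p (prodMeasure P Q) |
      ‖shiftOp τ p (EuclideanSpace.single i s) (testAvg P Q p ℝ hη (T w).1) -
      testAvg P Q p ℝ hη (T w).1‖ ≤ |s| * ‖ε • testedDeriv p hη i (T w)‖} := by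
    have h3 : Continuous fun w => testAvg P Q p ℝ hη (T w).1 :=
      (testAvg P Q p ℝ hη).continuous.comp (continuous_fst.comp T.continuous)
    exact isClosed_le (((shiftOp τ p _).continuous.comp h3).sub h3).norm
      (continuous_const.mul (((testedDeriv p hη i).continuous.comp T.continuous).const_smul ε).norm)
  exact closure_minimal (fun w hw => HasStochDeriv.norm_shiftOp_sub_le hw s) h2 (h1 hw)

theorem unfoldPair_tensorPair_of_mem_LpInv (ε : ℝ) {φ : Lp ℝ p P} (hφ : φ ∈ LpInv τ p)
    (z : Lp ℝ p (volume.restrict Q) × Lp (Space d) p (volume.restrict Q)) :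
    unfoldPair τ Q p ε (tensorPair φ z) = tensorPair φ z := by
  rw [unfoldPair_apply]
  refine Prod.ext (unfoldL_tensorL_of_mem_LpInv τ Q ε hφ _) (ext_coord fun j => ?_)
  simp only
  rw [coord_unfoldL, coord_tensorPair]
  exact unfoldL_tensorL_of_mem_LpInv τ Q ε hφ _

/-- Shift invariant random functions do not see unfolding. -/
theorem unfoldPair_of_mem_inv (ε : ℝ)
    {w : Lp ℝ p (prodMeasure P Q) × Lp (Space d) p (prodMeasure P Q)}
    (hw : w ∈ randomSobolevZero p Q (LpInv τ p)) : unfoldPair τ Q p ε w = w := by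
  have h1 : randomSobolevZero p Q (LpInv τ p) ≤
      LinearMap.eqLocus (unfoldPair τ Q p ε).toLinearMap LinearMap.id :=
    randomSobolevZero_le (isClosed_eq (unfoldPair τ Q p ε).continuous continuous_id)
      fun φ hφ ζ hζ _ => unfoldPair_tensorPair_of_mem_LpInv τ ε hφ _
  exact h1 hw

/-- Integration by parts for shift invariant random functions. -/
theorem testedDeriv_eq_zero_of_mem_inv (hη : IsTest η) (i : Fin d)
    {w : Lp ℝ p (prodMeasure P Q) × Lp (Space d) p (prodMeasure P Q)}
    (hw : w ∈ randomSobolevZero p Q (LpInv τ p)) : testedDeriv p hη i w = 0 := by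
  have h1 : randomSobolevZero p Q (LpInv τ p) ≤
      LinearMap.ker (testedDeriv p hη i : (Lp ℝ p (prodMeasure P Q) ×
        Lp (Space d) p (prodMeasure P Q)) →L[ℝ] Lp ℝ p P).toLinearMap := by
    refine randomSobolevZero_le (isClosed_eq (testedDeriv p hη i).continuous continuous_const) ?_
    intro φ hφ ζ hζ hζQ
    -- At ε = 1 unfolding is the identity on invariant products, and the tested function is a
    -- multiple of the invariant φ. Its difference quotients vanish, hence so does the derivative.
    have h2 := hasStochDeriv_testAvg_tensorPair τ one_ne_zero hη hζ hζQ φ i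
    rw [unfoldPair_tensorPair_of_mem_LpInv τ 1 hφ, one_smul, tensorPair_fst,
      ← unfoldL_tensorL_of_mem_LpInv τ Q 1 hφ, testAvg_unfoldL_tensorL τ 1 hη hζQ φ
      (testPair_coeFn hζ), conv_of_mem_LpInv hφ] at h2
    have h3 : ∀ x, shiftOp τ p x φ = φ := hφ
    simp only [HasStochDeriv, map_smul, h3, sub_self, smul_zero] at h2
    exact (tendsto_nhds_unique h2 tendsto_const_nhds)
  exact h1 hw

end KeyIdentity

/-! ### Poincaré's inequality in one direction. -/

section Poincare

variable {d : ℕ} {Q : Set (Space d)}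

theorem hasDerivAt_comp_add_single {v : Space d → ℝ} (hv : IsTest v) (i : Fin d) (x : Space d)
    (s : ℝ) : HasDerivAt (fun r : ℝ => v (x + r • EuclideanSpace.single i (1 : ℝ)))
      (partialDeriv i v (x + s • EuclideanSpace.single i (1 : ℝ))) s := by
  have h1 : HasDerivAt (fun r : ℝ => x + r • (EuclideanSpace.single i (1 : ℝ) : Space d))
      (EuclideanSpace.single i (1 : ℝ)) s := by
    simpa using ((hasDerivAt_id s).smul_const (EuclideanSpace.single i (1 : ℝ) : Space d)).const_add x
  exact (hv.contDiff_one.differentiable one_ne_zero _).hasFDerivAt.comp_hasDerivAt s h1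

theorem lintegral_enorm_rpow_le {α : Type*} [MeasurableSpace α] {μ : Measure α} [IsFiniteMeasure μ]
    {r : ℝ} (hr : 1 ≤ r) {f : α → ℝ} (hf : AEStronglyMeasurable f μ) :
    (∫⁻ a, ‖f a‖ₑ ∂μ) ^ r ≤ (μ Set.univ ^ (1 - 1 / r)) ^ r * ∫⁻ a, ‖f a‖ₑ ^ r ∂μ := by
  have hr0 : 0 < r := zero_lt_one.trans_le hr
  have h1 := eLpNorm_le_eLpNorm_mul_rpow_measure_univ (p := 1) (q := ENNReal.ofReal r) (μ := μ)
    (ENNReal.one_le_ofReal.2 hr) hf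
  rw [eLpNorm_one_eq_lintegral_enorm, eLpNorm_eq_lintegral_rpow_enorm_toReal (by simpa using hr0)
    ENNReal.ofReal_ne_top, ENNReal.toReal_ofReal hr0.le, ENNReal.toReal_one, div_one] at h1
  refine (ENNReal.rpow_le_rpow h1 hr0.le).trans_eq ?_
  rw [ENNReal.mul_rpow_of_nonneg _ _ hr0.le, ← ENNReal.rpow_mul (∫⁻ a, ‖f a‖ₑ ^ r ∂μ),
    one_div_mul_cancel hr0.ne', ENNReal.rpow_one, mul_comm]

/-- Poincaré's inequality for test functions, with a single partial derivative. -/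
theorem exists_poincare_test (hQ : Bornology.IsBounded Q) {r : ℝ} (hr : 1 ≤ r) (i : Fin d) :
    ∃ K : ℝ≥0∞, K ≠ ⊤ ∧ ∀ v : Space d → ℝ, IsTest v → tsupport v ⊆ Q →
      ∫⁻ x in Q, ‖v x‖ₑ ^ r ≤ K * ∫⁻ x in Q, ‖partialDeriv i v x‖ₑ ^ r := by
  obtain ⟨R, hR⟩ := hQ.subset_closedBall 0
  have hr0 : 0 < r := zero_lt_one.trans_le hr
  set e : Space d := EuclideanSpace.single i (1 : ℝ) with he
  have hen : ‖e‖ = 1 := by simp [he]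
  -- Longer than the diameter of the ball containing Q: from any point of Q, moving by L along e
  -- leaves the ball, so v vanishes at the end of the segment.
  set L : ℝ := 2 * |R| + 1 with hL
  have hL0 : 0 < L := by positivity
  set ν : Measure ℝ := volume.restrict (Set.Ioc 0 L) with hν
  have hνf : IsFiniteMeasure ν := ⟨by simp [hν]⟩
  refine ⟨(ν Set.univ ^ (1 - 1 / r)) ^ r * ν Set.univ, ?_, fun v hv hvQ => ?_⟩
  · refine ENNReal.mul_ne_top (ENNReal.rpow_ne_top_of_nonneg hr0.le
      (ENNReal.rpow_ne_top_of_nonneg ?_ (measure_ne_top _ _))) (measure_ne_top _ _)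
    rw [sub_nonneg]
    exact (div_le_one hr0).2 hr
  have hg := (hv.partialDeriv i).continuous
  have h1 : ∀ x ∈ Q, ‖v x‖ₑ ^ r ≤
      (ν Set.univ ^ (1 - 1 / r)) ^ r * ∫⁻ s, ‖partialDeriv i v (x + s • e)‖ₑ ^ r ∂ν := by
    intro x hx
    have hxL : v (x + L • e) = 0 := by
      refine image_eq_zero_of_notMem_tsupport fun h => ?_
      have h2 := hR (hvQ h)
      have h3 := hR hx
      rw [mem_closedBall_zero_iff] at h2 h3
      have h4 : ‖L • e‖ ≤ ‖x + L • e‖ + ‖x‖ := by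
        calc ‖L • e‖ = ‖(x + L • e) - x‖ := by rw [add_sub_cancel_left]
          _ ≤ _ := norm_sub_le _ _
      rw [norm_smul, hen, mul_one, Real.norm_of_nonneg hL0.le] at h4
      have := le_abs_self R
      linarith
    have hc : Continuous fun s : ℝ => partialDeriv i v (x + s • e) := by fun_prop
    have h2 : ∫ s in (0 : ℝ)..L, partialDeriv i v (x + s • e) = - v x := by
      rw [intervalIntegral.integral_eq_sub_of_hasDerivAt
        (fun s _ => hasDerivAt_comp_add_single hv i x s) (hc.intervalIntegrable _ _), ← he, hxL]
      simp
    rw [intervalIntegral.integral_of_le hL0.le] at h2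
    have h3 : ‖v x‖ₑ ≤ ∫⁻ s, ‖partialDeriv i v (x + s • e)‖ₑ ∂ν := by
      rw [← enorm_neg, ← h2]
      exact enorm_integral_le_lintegral_enorm _
    exact (ENNReal.rpow_le_rpow h3 hr0.le).trans
      (lintegral_enorm_rpow_le hr hc.aestronglyMeasurable)
  calc ∫⁻ x in Q, ‖v x‖ₑ ^ r
      ≤ ∫⁻ x in Q, (ν Set.univ ^ (1 - 1 / r)) ^ r *
          ∫⁻ s, ‖partialDeriv i v (x + s • e)‖ₑ ^ r ∂ν := by
        refine lintegral_mono fun x => ?_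
        by_cases hx : x ∈ Q
        · exact h1 x hx
        · rw [image_eq_zero_of_notMem_tsupport fun h => hx (hvQ h), enorm_zero,
            ENNReal.zero_rpow_of_pos hr0]
          exact zero_le
    _ ≤ ∫⁻ x, (ν Set.univ ^ (1 - 1 / r)) ^ r *
          ∫⁻ s, ‖partialDeriv i v (x + s • e)‖ₑ ^ r ∂ν := setLIntegral_le_lintegral _ _
    _ = (ν Set.univ ^ (1 - 1 / r)) ^ r * (ν Set.univ *
          ∫⁻ x in Q, ‖partialDeriv i v x‖ₑ ^ r) := by
        have hm : Measurable fun z : Space d × ℝ => ‖partialDeriv i v (z.1 + z.2 • e)‖ₑ ^ r := by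
          have : Continuous fun z : Space d × ℝ => partialDeriv i v (z.1 + z.2 • e) := by fun_prop
          exact this.measurable.enorm.pow_const r
        -- Translation invariance removes s e once the integral is over ℝ^d; the support of v then
        -- brings it back to Q.
        have h4 : ∀ s : ℝ, ∫⁻ x, ‖partialDeriv i v (x + s • e)‖ₑ ^ r =
            ∫⁻ x in Q, ‖partialDeriv i v x‖ₑ ^ r := by
          intro s
          rw [lintegral_add_right_eq_self (fun x => ‖partialDeriv i v x‖ₑ ^ r) (s • e)]
          refine (setLIntegral_eq_of_support_subset fun x hx => ?_).symm
          by_contra h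
          refine hx ?_
          have h5 : partialDeriv i v x = 0 := image_eq_zero_of_notMem_tsupport fun h6 =>
            h (hvQ (tsupport_partialDeriv_subset i h6))
          simp [h5, hr0]
        rw [lintegral_const_mul _ hm.lintegral_prod_right', lintegral_lintegral_swap hm.aemeasurable]
        simp_rw [h4]
        rw [lintegral_const, mul_comm (ν Set.univ)]
    _ = _ := by rw [mul_assoc]

variable {Ω : Type*} [MeasurableSpace Ω] {P : Measure Ω} [SFinite P]
  [SFinite (volume.restrict Q)] {p : ℝ≥0∞} [Fact (1 ≤ p)] [hp : Fact (p ≠ ⊤)]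
  [SecondCountableTopology (Lp ℝ p P)]

theorem IsTest.add {v w : Space d → ℝ} (hv : IsTest v) (hw : IsTest w) :
    IsTest (fun x => v x + w x) :=
  ⟨hv.contDiff.add hw.contDiff, hv.hasCompactSupport.add hw.hasCompactSupport⟩

theorem IsTest.const_mul {v : Space d → ℝ} (hv : IsTest v) (c : ℝ) :
    IsTest (fun x => c * v x) :=
  ⟨contDiff_const.mul hv.contDiff, hv.hasCompactSupport.mul_left⟩

theorem partialDeriv_add {v w : Space d → ℝ} (hv : IsTest v) (hw : IsTest w) (i : Fin d)
    (x : Space d) :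
    partialDeriv i (fun x => v x + w x) x = partialDeriv i v x + partialDeriv i w x := by
  rw [partialDeriv, fderiv_fun_add (hv.contDiff_one.differentiable one_ne_zero x)
    (hw.contDiff_one.differentiable one_ne_zero x)]
  rfl

theorem partialDeriv_const_mul {v : Space d → ℝ} (hv : IsTest v) (c : ℝ) (i : Fin d)
    (x : Space d) : partialDeriv i (fun x => c * v x) x = c * partialDeriv i v x := by
  rw [partialDeriv, fderiv_const_mul (hv.contDiff_one.differentiable one_ne_zero x)]
  rfl

/-- Poincaré's inequality on `L^p(Ω) ⊗ W^{1,p}_0(Q)`. -/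
theorem exists_poincare (hQ : Bornology.IsBounded Q) (i : Fin d) :
    ∃ K : ℝ, 0 ≤ K ∧ ∀ w ∈ randomSobolevZero p Q (⊤ : Submodule ℝ (Lp ℝ p P)),
      ‖w.1‖ ≤ K * ‖coord (prodMeasure P Q) p i w.2‖ := by
  have hp1 : 1 ≤ p.toReal := by
    rw [← ENNReal.toReal_one]
    exact ENNReal.toReal_mono hp.out Fact.out
  have hp0 : 0 < p.toReal := zero_lt_one.trans_le hp1
  obtain ⟨K, hK, hPoin⟩ := exists_poincare_test hQ hp1 i
  refine ⟨(K ^ (1 / p.toReal)).toReal, ENNReal.toReal_nonneg, ?_⟩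
  -- Pairs represented by a genuine test function for every ω. On these the deterministic inequality
  -- holds for each ω and is integrated; sums stay in N because different ω may carry different test
  -- functions.
  set N : Submodule ℝ (Lp ℝ p (prodMeasure P Q) × Lp (Space d) p (prodMeasure P Q)) :=
    { carrier := {w | ∃ f : Ω → Space d → ℝ, (∀ a, IsTest (f a) ∧ tsupport (f a) ⊆ Q) ∧
        (w.1 =ᵐ[prodMeasure P Q] fun z => f z.1 z.2) ∧
        coord (prodMeasure P Q) p i w.2 =ᵐ[prodMeasure P Q] fun z => partialDeriv i (f z.1) z.2}
      zero_mem' := by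
        refine ⟨fun _ _ => 0, fun a => ⟨⟨contDiff_const, HasCompactSupport.zero⟩, ?_⟩,
          Lp.coeFn_zero ℝ p _, ?_⟩
        · have : (fun _ : Space d => (0 : ℝ)) = 0 := rfl
          simp [this, tsupport]
        · simp only [Prod.snd_zero, map_zero]
          refine (Lp.coeFn_zero ℝ p _).trans (Eventually.of_forall fun z => ?_)
          simp [partialDeriv]
      add_mem' := by
        rintro v w ⟨f, hf, hf1, hf2⟩ ⟨g, hg, hg1, hg2⟩
        refine ⟨fun a x => f a x + g a x, fun a => ⟨(hf a).1.add (hg a).1,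
          (tsupport_add _ _).trans (Set.union_subset (hf a).2 (hg a).2)⟩, ?_, ?_⟩
        · filter_upwards [hf1, hg1, Lp.coeFn_add v.1 w.1] with z h1 h2 h3
          rw [Prod.fst_add, h3, Pi.add_apply, h1, h2]
        · rw [Prod.snd_add, map_add]
          filter_upwards [hf2, hg2, Lp.coeFn_add (coord (prodMeasure P Q) p i v.2)
            (coord (prodMeasure P Q) p i w.2)] with z h1 h2 h3
          rw [h3, Pi.add_apply, h1, h2, partialDeriv_add (hf _).1 (hg _).1]
      smul_mem' := by
        rintro c v ⟨f, hf, hf1, hf2⟩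
        refine ⟨fun a x => c * f a x, fun a => ⟨(hf a).1.const_mul c,
          (tsupport_mul_subset_right (f := fun _ => c)).trans (hf a).2⟩, ?_, ?_⟩
        · filter_upwards [hf1, Lp.coeFn_smul c v.1] with z h1 h3
          rw [Prod.smul_fst, h3, Pi.smul_apply, h1, smul_eq_mul]
        · rw [Prod.smul_snd, map_smul]
          filter_upwards [hf2, Lp.coeFn_smul c (coord (prodMeasure P Q) p i v.2)] with z h1 h3
          rw [h3, Pi.smul_apply, h1, smul_eq_mul, partialDeriv_const_mul (hf _).1] } with hN
  have h1 : randomSobolevZero p Q (⊤ : Submodule ℝ (Lp ℝ p P)) ≤ N.topologicalClosure := by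
    refine randomSobolevZero_le (Submodule.isClosed_topologicalClosure _) fun φ _ ζ hζ hζQ =>
      Submodule.le_topologicalClosure _ ⟨fun a x => φ a * ζ x, fun a => ⟨hζ.const_mul _,
        (tsupport_mul_subset_right (f := fun _ => φ a)).trans hζQ⟩, ?_, ?_⟩
    · have h2 := (Measure.quasiMeasurePreserving_snd (μ := P) (ν := volume.restrict Q)).ae_eq_comp
        (show (testPair p Q hζ).1 =ᵐ[volume.restrict Q] ζ from (hζ.memLp p Q).coeFn_toLp)
      filter_upwards [((tensorPair_eq_iff φ (testPair p Q hζ) _).1 rfl).1, h2] with z h3 h4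
      simp only [Function.comp] at h4
      rw [h3, h4]
    · have h2 := (Measure.quasiMeasurePreserving_snd (μ := P) (ν := volume.restrict Q)).ae_eq_comp
        (coord_testPair (p := p) (Q := Q) hζ i)
      rw [coord_tensorPair]
      filter_upwards [tensorL_coeFn φ (coord (volume.restrict Q) p i (testPair p Q hζ).2), h2]
        with z h3 h4
      simp only [Function.comp] at h4
      rw [h3, h4, partialDeriv_const_mul hζ, smul_eq_mul, mul_comm]
  have hclosed : IsClosed {w : Lp ℝ p (prodMeasure P Q) × Lp (Space d) p (prodMeasure P Q) |
      ‖w.1‖ ≤ (K ^ (1 / p.toReal)).toReal * ‖coord (prodMeasure P Q) p i w.2‖} :=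
    isClosed_le continuous_fst.norm
      (continuous_const.mul ((coord (prodMeasure P Q) p i).continuous.comp continuous_snd).norm)
  refine fun w hw => closure_minimal ?_ hclosed (h1 hw)
  rintro w ⟨f, hf, hf1, hf2⟩
  change ‖w.1‖ ≤ _
  rw [Lp.norm_def, Lp.norm_def, ← ENNReal.toReal_mul]
  refine ENNReal.toReal_mono (ENNReal.mul_ne_top (ENNReal.rpow_ne_top_of_nonneg (by positivity) hK)
    (Lp.eLpNorm_ne_top _)) ?_
  rw [eLpNorm_eq_lintegral_rpow_enorm_toReal (exponent_ne_zero p) hp.out,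
    eLpNorm_eq_lintegral_rpow_enorm_toReal (exponent_ne_zero p) hp.out,
    ← ENNReal.mul_rpow_of_nonneg _ _ (by positivity)]
  refine ENNReal.rpow_le_rpow ?_ (by positivity)
  have hm1 := (Lp.aestronglyMeasurable w.1).enorm.pow_const p.toReal
  have hm2 := (Lp.aestronglyMeasurable (coord (prodMeasure P Q) p i w.2)).enorm.pow_const p.toReal
  rw [lintegral_prod _ hm1, lintegral_prod _ hm2, ← lintegral_const_mul'' _ hm2.lintegral_prod_right']
  refine lintegral_mono_ae ?_
  filter_upwards [Measure.ae_ae_of_ae_prod hf1, Measure.ae_ae_of_ae_prod hf2] with a h2 h3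
  have h4 : ∫⁻ x in Q, ‖w.1 (a, x)‖ₑ ^ p.toReal = ∫⁻ x in Q, ‖f a x‖ₑ ^ p.toReal :=
    lintegral_congr_ae (h2.mono fun x hx => by simp only [hx])
  have h5 : ∫⁻ x in Q, ‖coord (prodMeasure P Q) p i w.2 (a, x)‖ₑ ^ p.toReal =
      ∫⁻ x in Q, ‖partialDeriv i (f a) x‖ₑ ^ p.toReal :=
    lintegral_congr_ae (h3.mono fun x hx => by simp only [hx])
  rw [h4, h5]
  exact hPoin _ (hf a).1 (hf a).2

end Poincare

/-! ### Membership in L^p_pot ⊗ L^p(Q) through slices and tests. -/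

section VectorTensor

variable {d : ℕ} {Ω : Type*} [MeasurableSpace Ω] {P : Measure Ω} [SFinite P]
  {Q : Set (Space d)} {p : ℝ≥0∞} [Fact (1 ≤ p)] [Fact (p ≠ ⊤)]
  [SecondCountableTopology (Lp (Space d) p P)]

theorem tensorL_mem_vectorTensorLp [SFinite (volume.restrict Q)]
    {N : Submodule ℝ (Lp (Space d) p P)} {ψ : Lp (Space d) p P}
    (hψ : ψ ∈ N) (η : Lp ℝ p (volume.restrict Q)) :
    tensorL (Space d) P (volume.restrict Q) p ψ η ∈ vectorTensorLp p Q N :=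
  Submodule.le_topologicalClosure _ (Submodule.subset_span ⟨ψ, hψ, η, tensorL_coeFn ψ η⟩)

variable [IsFiniteMeasure (volume.restrict Q)]

theorem map_mem_of_indicatorConstLp {Y X W : Type*} [MeasurableSpace Y] {ν : Measure Y}
    [NormedAddCommGroup X] [NormedSpace ℝ X] [NormedAddCommGroup W] [NormedSpace ℝ W]
    {p : ℝ≥0∞} [Fact (1 ≤ p)] [hp : Fact (p ≠ ⊤)]
    (A : Lp X p ν →L[ℝ] W) {M : Submodule ℝ W} (hM : IsClosed (M : Set W))
    (h : ∀ (c : X) (s : Set Y) (hs : MeasurableSet s) (hμs : ν s ≠ ⊤),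
      A (indicatorConstLp p hs hμs c) ∈ M) (g : Lp X p ν) : A g ∈ M := by
  refine Lp.induction hp.out (motive := fun g => A g ∈ M) ?_ ?_ ?_ g
  · intro c s hs hμs
    exact h c s hs hμs.ne
  · intro f g hf hg _ h1 h2
    rw [map_add]
    exact add_mem h1 h2
  · exact hM.preimage A.continuous

/-- A function with values in N almost everywhere is an element of L^p with target N, where simple
functions with values in N are dense. -/
theorem map_mem_of_ae_mem {Y X W : Type*} [MeasurableSpace Y] {ν : Measure Y}
    [NormedAddCommGroup X] [NormedSpace ℝ X] [NormedAddCommGroup W] [NormedSpace ℝ W]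
    {p : ℝ≥0∞} [Fact (1 ≤ p)] [hp : Fact (p ≠ ⊤)]
    (A : Lp X p ν →L[ℝ] W) {M : Submodule ℝ W} (hM : IsClosed (M : Set W)) {N : Submodule ℝ X}
    (h : ∀ c ∈ N, ∀ (s : Set Y) (hs : MeasurableSet s) (hμs : ν s ≠ ⊤),
      A (indicatorConstLp p hs hμs c) ∈ M) {f : Lp X p ν} (hf : ∀ᵐ x ∂ν, f x ∈ N) : A f ∈ M := by
  classical
  have h1 : ∀ g : Lp N p ν, (A ∘L N.subtypeL.compLpL p ν) g ∈ M := by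
    refine map_mem_of_indicatorConstLp _ hM ?_
    intro c s hs hμs
    have h2 : N.subtypeL.compLpL p ν (indicatorConstLp p hs hμs c) =
        indicatorConstLp p hs hμs (c : X) := by
      refine Lp.ext ?_
      filter_upwards [N.subtypeL.coeFn_compLpL (p := p) (indicatorConstLp p hs hμs c),
        indicatorConstLp_coeFn (p := p) (hs := hs) (hμs := hμs) (c := c),
        indicatorConstLp_coeFn (p := p) (hs := hs) (hμs := hμs) (c := (c : X))]
        with x h4 h5 h6
      rw [h4, h5, h6]
      by_cases hx : x ∈ s <;> simp [hx]
    rw [ContinuousLinearMap.comp_apply, h2]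
    exact h c c.2 s hs hμs
  set g : Y → N := fun x => if hx : f x ∈ N then ⟨_, hx⟩ else 0
  have hg : (fun x => (g x : X)) =ᵐ[ν] f := by
    filter_upwards [hf] with x hx
    simp [g, hx]
  have hgm : MemLp g p ν := by
    have h2 := MemLp.ae_eq hg.symm (Lp.memLp _)
    refine h2.of_le ?_ (Eventually.of_forall fun x => le_rfl)
    exact (Topology.IsEmbedding.subtypeVal.aestronglyMeasurable_comp_iff).1 h2.1
  have h3 : N.subtypeL.compLpL p ν (hgm.toLp g) = f := by
    refine Lp.ext ?_
    filter_upwards [N.subtypeL.coeFn_compLpL (p := p) (hgm.toLp g), hgm.coeFn_toLp, hg]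
      with x h4 h5 h6
    rw [h4, h5]
    exact h6
  rw [← h3]
  exact h1 _

theorem mem_vectorTensorLp_of_slice_mem {N : Submodule ℝ (Lp (Space d) p P)}
    {χ : Lp (Space d) p (prodMeasure P Q)}
    (h : ∀ᵐ x ∂(volume.restrict Q),
      (slice χ : Lp (Lp (Space d) p P) p (volume.restrict Q)) x ∈ N) :
    χ ∈ vectorTensorLp p Q N := by
  have h1 := map_mem_of_ae_mem
    (slice (E := Space d) (P := P) (ν := volume.restrict Q)
      (p := p)).symm.toContinuousLinearEquiv.toContinuousLinearMap
    (M := vectorTensorLp p Q N) (Submodule.isClosed_topologicalClosure _) (N := N) ?_ h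
  · have h2 := slice.symm_apply_apply χ
    rw [← h2]
    exact h1
  · intro c hc s hs hμs
    have h2 : slice.symm (indicatorConstLp p hs hμs c) =
        tensorL (Space d) P (volume.restrict Q) p c (indicatorConstLp p hs hμs (1 : ℝ)) := by
      refine slice.injective (Lp.ext ?_)
      rw [LinearIsometryEquiv.apply_symm_apply]
      filter_upwards [slice_tensorL c (indicatorConstLp p hs hμs (1 : ℝ)),
        indicatorConstLp_coeFn (p := p) (hs := hs) (hμs := hμs) (c := c),
        indicatorConstLp_coeFn (p := p) (hs := hs) (hμs := hμs) (c := (1 : ℝ))]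
        with x h3 h5 h6
      rw [h3, h5, h6]
      by_cases hx : x ∈ s <;> simp [hx]
    change slice.symm (indicatorConstLp p hs hμs c) ∈ _
    rw [h2]
    exact tensorL_mem_vectorTensorLp hc _

/-- Modulo the closed subspace N every tested average of χ vanishes, so the fundamental lemma in the
quotient space puts almost every slice in N. -/
theorem mem_vectorTensorLp_of_testAvg_mem {N : Submodule ℝ (Lp (Space d) p P)}
    (hN : IsClosed (N : Set (Lp (Space d) p P))) {χ : Lp (Space d) p (prodMeasure P Q)}
    (h : ∀ η : Space d → ℝ, ∀ hη : IsTest η, testAvg P Q p (Space d) hη χ ∈ N) :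
    χ ∈ vectorTensorLp p Q N := by
  refine mem_vectorTensorLp_of_slice_mem ?_
  have : IsClosed (N : Set (Lp (Space d) p P)) := hN
  have h1 := (Lp.memLp (slice χ : Lp (Lp (Space d) p P) p (volume.restrict Q))).integrable
    (Fact.out : 1 ≤ p)
  have h2 : ∀ᵐ x ∂(volume.restrict Q),
      N.mkQL ((slice χ : Lp (Lp (Space d) p P) p (volume.restrict Q)) x) = 0 := by
    refine ae_eq_zero_of_integral_contDiff_smul_eq_zero
      (N.mkQL.integrable_comp h1).locallyIntegrable fun η h3 h4 => ?_
    have hη : IsTest η := ⟨h3, h4⟩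
    have h5 : N.mkQL (testAvg P Q p (Space d) hη χ) = 0 :=
      (Submodule.Quotient.mk_eq_zero N).2 (h η hη)
    rw [testAvg_apply, ← ContinuousLinearMap.integral_comp_comm _ (integrable_test_smul hη _)] at h5
    simpa using h5
  filter_upwards [h2] with x hx
  exact (Submodule.Quotient.mk_eq_zero N).1 hx

end VectorTensor

/-! ### Weak compactness for pairs of a function and a vector field. -/

section WeakSubsequence

variable {Z : Type*} [MeasurableSpace Z] {μ : Measure Z} [IsFiniteMeasure μ]
  {p q : ℝ≥0∞} [Fact (1 ≤ p)] [Fact (1 ≤ q)] [ENNReal.HolderConjugate p q] {d : ℕ}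
  [TopologicalSpace.SeparableSpace (Lp ℝ q μ)]

theorem exists_weak_subseq_finset (hp : p ≠ ⊤) (hq : q ≠ ⊤) {ι : Type*} (s : Finset ι)
    (u : ℕ → ι → Lp ℝ p μ) {C : ℝ} (hu : ∀ n i, ‖u n i‖ ≤ C) :
    ∃ (v : ι → Lp ℝ p μ) (k : ℕ → ℕ), StrictMono k ∧
      ∀ i ∈ s, WeakTendsto (fun n => u (k n) i) atTop (v i) := by
  classical
  induction s using Finset.induction_on with
  | empty => exact ⟨fun _ => 0, id, strictMono_id, by simp⟩
  | insert a s ha ih =>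
    obtain ⟨v, k, hk, hv⟩ := ih
    obtain ⟨va, m, hm, hva⟩ := exists_weak_subseq hp hq (fun n => u (k n) a) (fun n => hu _ _)
    refine ⟨Function.update v a va, k ∘ m, hk.comp hm, fun i hi => ?_⟩
    rcases Finset.mem_insert.1 hi with rfl | hi'
    · rw [Function.update_self]
      exact hva
    · rw [Function.update_of_ne (by rintro rfl; exact ha hi')]
      exact (hv i hi').comp hm.tendsto_atTop

theorem exists_weak_subseq_prod (hp : p ≠ ⊤) (hq : q ≠ ⊤)
    (w : ℕ → Lp ℝ p μ × Lp (Space d) p μ) {C : ℝ} (hw : ∀ n, ‖w n‖ ≤ C) :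
    ∃ (v : Lp ℝ p μ × Lp (Space d) p μ) (k : ℕ → ℕ), StrictMono k ∧
      WeakTendsto (fun n => w (k n)) atTop v := by
  -- `none` stands for the function, `some i` for the i-th component of the field.
  obtain ⟨v, k, hk, hv⟩ := exists_weak_subseq_finset hp hq (Finset.univ : Finset (Option (Fin d)))
    (fun n o => o.elim (w n).1 fun i => coord μ p i (w n).2) (C := C) (by
      rintro n (_ | i)
      · exact (norm_fst_le _).trans (hw n)
      · exact (norm_coord_le i _).trans ((norm_snd_le _).trans (hw n)))
  refine ⟨(v none, ∑ i, incl μ p i (v (some i))), k, hk, ?_⟩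
  refine WeakTendsto.prodMk (hv none (Finset.mem_univ _)) fun f => ?_
  simp_rw [map_sum]
  have h1 : ∀ n, f (w (k n)).2 = ∑ i, f (incl μ p i (coord μ p i (w (k n)).2)) := fun n => by
    rw [← map_sum, sum_incl_coord]
  simp_rw [h1]
  exact tendsto_finsetSum _ fun i _ => ((hv (some i) (Finset.mem_univ _)).map (incl μ p i)) f

end WeakSubsequence

/-! ### Slicewise operators on pairs. -/

section LiftPair

variable {d : ℕ} {Ω : Type*} [MeasurableSpace Ω] {P : Measure Ω}
  {p : ℝ≥0∞} [Fact (1 ≤ p)] [hp : Fact (p ≠ ⊤)] [SecondCountableTopology (Lp ℝ p P)]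

/-- The lift of an operator on `L^p(Ω)` to pairs of a function and a vector field. -/
noncomputable def liftPair {Y : Type*} [MeasurableSpace Y] [SFinite P] (ν : Measure Y) [SFinite ν]
    (A : Lp ℝ p P →L[ℝ] Lp ℝ p P) :
    (Lp ℝ p (P.prod ν) × Lp (Space d) p (P.prod ν)) →L[ℝ]
      (Lp ℝ p (P.prod ν) × Lp (Space d) p (P.prod ν)) :=
  (liftOp ν A).prodMap (∑ i, incl (P.prod ν) p i ∘L liftOp ν A ∘L coord (P.prod ν) p i)

theorem liftPair_fst {Y : Type*} [MeasurableSpace Y] [SFinite P] {ν : Measure Y} [SFinite ν]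
    (A : Lp ℝ p P →L[ℝ] Lp ℝ p P) (w : Lp ℝ p (P.prod ν) × Lp (Space d) p (P.prod ν)) :
    (liftPair ν A w).1 = liftOp ν A w.1 := rfl

theorem coord_liftPair {Y : Type*} [MeasurableSpace Y] [SFinite P] {ν : Measure Y} [SFinite ν]
    (A : Lp ℝ p P →L[ℝ] Lp ℝ p P) (w : Lp ℝ p (P.prod ν) × Lp (Space d) p (P.prod ν))
    (i : Fin d) :
    coord (P.prod ν) p i (liftPair ν A w).2 = liftOp ν A (coord (P.prod ν) p i w.2) := by
  have h1 : (liftPair ν A w).2 =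
      ∑ i, incl (P.prod ν) p i (liftOp ν A (coord (P.prod ν) p i w.2)) := by
    simp [liftPair]
  rw [h1, coord_sum_incl]

theorem liftPair_tensorPair {Y : Type*} [MeasurableSpace Y] [SFinite P] {ν : Measure Y} [SFinite ν]
    (A : Lp ℝ p P →L[ℝ] Lp ℝ p P) (φ : Lp ℝ p P) (η : Lp ℝ p ν × Lp (Space d) p ν) :
    liftPair ν A (tensorPair φ η) = tensorPair (A φ) η := by
  refine Prod.ext ?_ (ext_coord fun i => ?_)
  · rw [liftPair_fst, tensorPair_fst, tensorPair_fst, liftOp_tensorL]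
  · rw [coord_liftPair, coord_tensorPair, coord_tensorPair, liftOp_tensorL]

variable [IsProbabilityMeasure P] (τ : ShiftGroup d P) {Q : Set (Space d)}
  [IsFiniteMeasure (volume.restrict Q)]

theorem liftPair_mem_randomSobolevZero {A : Lp ℝ p P →L[ℝ] Lp ℝ p P} {X X' : Submodule ℝ (Lp ℝ p P)}
    (hA : ∀ φ ∈ X, A φ ∈ X')
    {w : Lp ℝ p (prodMeasure P Q) × Lp (Space d) p (prodMeasure P Q)}
    (hw : w ∈ randomSobolevZero p Q X) :
    (liftPair (volume.restrict Q) A w : Lp ℝ p (prodMeasure P Q) × Lp (Space d) p (prodMeasure P Q)) ∈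
      randomSobolevZero p Q X' := by
  have h1 : randomSobolevZero p Q X ≤
      (randomSobolevZero p Q X').comap (liftPair (d := d) (volume.restrict Q) A).toLinearMap := by
    refine randomSobolevZero_le ((Submodule.isClosed_topologicalClosure _).preimage
      (liftPair (volume.restrict Q) A).continuous) fun φ hφ ζ hζ hζQ => ?_
    change liftPair (volume.restrict Q) A (tensorPair φ (testPair p Q hζ)) ∈ randomSobolevZero p Q X'
    rw [liftPair_tensorPair]
    exact tensorPair_mem_randomSobolevZero (hA φ hφ) (testPair_mem_sobolevZero hζ hζQ)
  exact h1 hw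

/-- Unfolding shifts each slice and A ignores shifts. So the invariant projection of an unfolded
function keeps the Sobolev structure that unfolding alone destroys. -/
theorem liftPair_unfoldPair {A : Lp ℝ p P →L[ℝ] Lp ℝ p P}
    (hA : ∀ x φ, A (shiftOp τ p x φ) = A φ) (ε : ℝ)
    (w : Lp ℝ p (prodMeasure P Q) × Lp (Space d) p (prodMeasure P Q)) :
    liftPair (volume.restrict Q) A (unfoldPair τ Q p ε w) = liftPair (volume.restrict Q) A w := by
  refine Prod.ext ?_ (ext_coord fun i => ?_)
  · rw [liftPair_fst, liftPair_fst, unfoldPair_apply, liftOp_unfoldL τ Q hA]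
  · rw [coord_liftPair, coord_liftPair, unfoldPair_apply, coord_unfoldL, liftOp_unfoldL τ Q hA]

end LiftPair

/-! ### Identification of two-scale limits. -/

section Compactness

variable {d : ℕ} {Ω : Type*} [MeasurableSpace Ω] {P : Measure Ω} [IsProbabilityMeasure P]
  (τ : ShiftGroup d P) {Q : Set (Space d)} [IsFiniteMeasure (volume.restrict Q)]
  {p q : ℝ≥0∞} [Fact (1 ≤ p)] [hp : Fact (p ≠ ⊤)] [SecondCountableTopology (Lp ℝ p P)]

/-- A shift along a coordinate axis changes the tested unfolded function by O(ε_n) in norm, so the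
weak limit of that difference is zero. -/
theorem testAvg_mem_LpInv_of_weakTendsto {ε : ℕ → ℝ} (hε : ∀ n, ε n ≠ 0)
    (hε0 : Tendsto ε atTop (𝓝 0))
    {w : ℕ → Lp ℝ p (prodMeasure P Q) × Lp (Space d) p (prodMeasure P Q)}
    (hw : ∀ n, w n ∈ randomSobolevZero p Q (⊤ : Submodule ℝ (Lp ℝ p P))) {C : ℝ}
    (hC : ∀ n, ‖unfoldPair τ Q p (ε n) (w n)‖ ≤ C)
    {v : Lp ℝ p (prodMeasure P Q) × Lp (Space d) p (prodMeasure P Q)}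
    (h : WeakTendsto (fun n => unfoldPair τ Q p (ε n) (w n)) atTop v)
    {η : Space d → ℝ} (hη : IsTest η) : testAvg P Q p ℝ hη v.1 ∈ LpInv τ p := by
  refine mem_LpInv_of_single fun i s => ?_
  set U := (shiftOp τ p (EuclideanSpace.single i s)).toContinuousLinearMap
  set D : (Lp ℝ p (prodMeasure P Q) × Lp (Space d) p (prodMeasure P Q)) →L[ℝ] Lp ℝ p P :=
    (U - ContinuousLinearMap.id ℝ (Lp ℝ p P)) ∘L testAvg P Q p ℝ hη ∘L
      ContinuousLinearMap.fst ℝ (Lp ℝ p (prodMeasure P Q)) (Lp (Space d) p (prodMeasure P Q)) with hD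
  have hDw : ∀ w, D w = shiftOp τ p (EuclideanSpace.single i s) (testAvg P Q p ℝ hη w.1) -
      testAvg P Q p ℝ hη w.1 := fun w => rfl
  have h1 := h.map D
  have h2 : Tendsto (fun n => D (unfoldPair τ Q p (ε n) (w n))) atTop (𝓝 0) := by
    have h3 : Tendsto (fun n => |s| * (‖ε n‖ * (‖testedDeriv (P := P) (Q := Q) p hη i‖ * C)))
        atTop (𝓝 0) := by
      have := (hε0.norm.mul_const (‖testedDeriv (P := P) (Q := Q) p hη i‖ * C)).const_mul |s|
      simpa using this
    refine squeeze_zero_norm (fun n => ?_) h3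
    rw [hDw]
    refine (norm_shiftOp_testAvg_sub_le τ (hε n) hη (hw n) i s).trans ?_
    rw [norm_smul]
    gcongr
    exact (ContinuousLinearMap.le_opNorm _ _).trans (by gcongr; exact hC n)
  have h4 := h1.unique h2.weakTendsto
  rw [hDw] at h4
  exact sub_eq_zero.1 h4

/-- Two-scale compactness: bounded sequences of random Sobolev functions. -/
theorem exists_twoScale_limit [SecondCountableTopology (Lp (Space d) p P)]
    [Fact (1 ≤ q)] [ENNReal.HolderConjugate p q] (hq : q ≠ ⊤)
    [TopologicalSpace.SeparableSpace (Lp ℝ q P)]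
    [TopologicalSpace.SeparableSpace (Lp ℝ q (prodMeasure P Q))]
    {ε : ℕ → ℝ} (hε : ∀ n, ε n ≠ 0)
    (hε0 : Tendsto ε atTop (𝓝 0))
    {w : ℕ → Lp ℝ p (prodMeasure P Q) × Lp (Space d) p (prodMeasure P Q)}
    (hw : ∀ n, w n ∈ randomSobolevZero p Q (⊤ : Submodule ℝ (Lp ℝ p P))) {C : ℝ}
    (hC : ∀ n, ‖unfoldPair τ Q p (ε n) (w n)‖ ≤ C) :
    ∃ u₀ ∈ randomSobolevZero p Q (LpInv τ p), ∃ χ ∈ vectorTensorLp p Q (LpPot τ p),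
      ∃ k : ℕ → ℕ, StrictMono k ∧
        WeakTendsto (fun n => unfoldPair τ Q p (ε (k n)) (w (k n))) atTop (u₀.1, u₀.2 + χ) := by
  obtain ⟨v, k, hk, hv⟩ := exists_weak_subseq_prod hp.out hq
    (fun n => unfoldPair τ Q p (ε n) (w n)) hC
  obtain ⟨A, hA1, hA2, hA3⟩ := exists_invariantProjection τ p hq
  have h1 : liftOp (volume.restrict Q) A v.1 = v.1 := by
    refine eq_of_testAvg_eq fun η hη => ?_
    rw [testAvg_liftOp]
    exact hA2 _ (testAvg_mem_LpInv_of_weakTendsto τ (fun n => hε (k n))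
      (hε0.comp hk.tendsto_atTop) (fun n => hw (k n)) (fun n => hC (k n)) hv hη)
  set u₀ := liftPair (volume.restrict Q) A v with hu₀
  have hu₀1 : u₀.1 = v.1 := h1
  -- Each projected unfolded pair equals the projection of w_n, which lies in this closed subspace;
  -- subspaces are convex, so the weak limit stays inside.
  have h2 : u₀ ∈ randomSobolevZero p Q (LpInv τ p) := by
    refine (hv.map (liftPair (volume.restrict Q) A)).mem_of_frequently
      (s := (randomSobolevZero p Q (LpInv τ p) : Set _)) (Submodule.convex _)
      (Submodule.isClosed_topologicalClosure _) (Eventually.frequently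
        (Eventually.of_forall fun n => ?_))
    rw [liftPair_unfoldPair τ hA3]
    exact liftPair_mem_randomSobolevZero (fun φ _ => hA1 φ) (hw (k n))
  refine ⟨u₀, h2, v.2 - u₀.2, ?_, k, hk, ?_⟩
  · refine mem_vectorTensorLp_of_testAvg_mem (Submodule.isClosed_topologicalClosure _)
      fun η hη => ?_
    set B : (Lp ℝ p (prodMeasure P Q) × Lp (Space d) p (prodMeasure P Q)) →L[ℝ] Lp (Space d) p P :=
      ∑ i, incl P p i ∘L testedDeriv p hη i with hB
    have hBw : ∀ w, B w = ∑ i, incl P p i (testedDeriv p hη i w) := fun w => by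
      simp [hB]
    -- Integration by parts for u₀ replaces the tested gradient of u₀ by minus the test of v.1
    -- against ∇η, and the expression becomes the weakly continuous B v.
    have h3 : testAvg P Q p (Space d) hη (v.2 - u₀.2) = B v := by
      refine ext_coord fun i => ?_
      have h4 := testedDeriv_eq_zero_of_mem_inv τ hη i h2
      rw [testedDeriv_apply, hu₀1] at h4
      rw [hBw, coord_sum_incl, coord_testAvg, map_sub, map_sub, testedDeriv_apply,
        eq_neg_of_add_eq_zero_left h4, sub_neg_eq_add]
    rw [h3]
    refine (hv.map B).mem_of_frequently (s := (LpPot τ p : Set _)) (Submodule.convex _)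
      (Submodule.isClosed_topologicalClosure _) (Eventually.frequently
        (Eventually.of_forall fun n => ?_))
    rw [hBw]
    exact sum_incl_testedDeriv_mem_LpPot τ (hε (k n)) hη (hw (k n))
  · rw [hu₀1, add_sub_cancel]
    exact hv

end Compactness

/-! ### Density of test functions in L^p(Q). -/

section Density

variable {d : ℕ} {Q : Set (Space d)} [IsFiniteMeasure (volume.restrict Q)]
  {p q : ℝ≥0∞} [Fact (1 ≤ p)] [Fact (1 ≤ q)] [ENNReal.HolderConjugate q p]

/-- Test functions with support in an open set `Q` are dense in `L^p(Q)`. -/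
theorem mem_of_isTest_mem (hp : p ≠ ⊤) (hq : q ≠ ⊤) (hQ : IsOpen Q)
    {D : Submodule ℝ (Lp ℝ p (volume.restrict Q))}
    (hD : IsClosed (D : Set (Lp ℝ p (volume.restrict Q))))
    (h : ∀ η : Space d → ℝ, ∀ hη : IsTest η, tsupport η ⊆ Q → (hη.memLp p Q).toLp η ∈ D)
    (u : Lp ℝ p (volume.restrict Q)) : u ∈ D := by
  by_contra hu
  obtain ⟨f, c, h1, h2⟩ := geometric_hahn_banach_closed_point D.convex hD hu
  have hc : 0 < c := by simpa using h1 0 D.zero_mem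
  have h3 : ∀ a ∈ D, f a = 0 := by
    intro a ha
    by_contra hne
    have h4 := h1 ((c / f a) • a) (D.smul_mem _ ha)
    rw [map_smul, smul_eq_mul, div_mul_cancel₀ _ hne] at h4
    exact lt_irrefl _ h4
  -- A separating functional annihilates all test functions supported in Q; its Riesz density g
  -- therefore vanishes on the open set Q.
  obtain ⟨g, rfl⟩ := exists_lpPairing_eq hp hq f
  have hg := (Lp.memLp g).integrable (Fact.out : 1 ≤ q)
  have h4 : ∀ᵐ x, x ∈ Q → g x = 0 := by
    refine hQ.ae_eq_zero_of_integral_contDiff_smul_eq_zero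
      (IntegrableOn.locallyIntegrableOn hg) fun η h5 h6 h7 => ?_
    have hη : IsTest η := ⟨h5, h6⟩
    have h8 := h3 _ (h η hη h7)
    rw [ContinuousLinearMap.lpPairing_eq_integral] at h8
    rw [← setIntegral_eq_of_tsupport h7, ← h8]
    refine integral_congr_ae ?_
    filter_upwards [(hη.memLp p Q).coeFn_toLp] with x hx
    rw [hx]
    simp [mul_comm]
  have h5 : g = 0 := by
    refine Lp.ext ?_
    filter_upwards [(ae_restrict_iff' hQ.measurableSet).2 h4, Lp.coeFn_zero ℝ q _] with x h6 h7
    rw [h6, h7, Pi.zero_apply]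
  rw [h5] at h2
  simp at h2
  linarith

end Density

/-! ### Oscillating functions as superpositions of products. -/

section Correctors

variable {d : ℕ} {Ω : Type*} [MeasurableSpace Ω] {P : Measure Ω} [IsProbabilityMeasure P]
  (τ : ShiftGroup d P) {Q : Set (Space d)} [IsFiniteMeasure (volume.restrict Q)]
  {p : ℝ≥0∞} [Fact (1 ≤ p)] [hp : Fact (p ≠ ⊤)] [SecondCountableTopology (Lp ℝ p P)]
  {a h : Space d → ℝ}

theorem IsTest.mul_comp_sub (ha : IsTest a) (hh : IsTest h) (k : ℝ) (y : Space d) :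
    IsTest (fun x => a x * h (y - k • x)) :=
  ⟨ha.contDiff.mul (hh.contDiff.comp (contDiff_const.sub (contDiff_const_smul k))),
    ha.hasCompactSupport.mul_right⟩

variable (Q p) in
-- Uniform continuity of h gives a uniform estimate in x, and Q has finite measure. Continuity in y
-- makes the superposition integrable as a function with values in L^p.
theorem continuous_toLp_mul_comp_sub (ha : IsTest a) (hh : IsTest h) (k : ℝ) :
    Continuous fun y => ((ha.mul_comp_sub hh k y).memLp p Q).toLp _ := by
  obtain ⟨C, hC⟩ := ha.hasCompactSupport.exists_bound_of_continuous ha.continuous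
  have hC0 : 0 ≤ C := (norm_nonneg _).trans (hC 0)
  have hu := hh.hasCompactSupport.uniformContinuous_of_continuous hh.continuous
  set B : ℝ := (measureUnivNNReal (volume.restrict Q) : ℝ) ^ p.toReal⁻¹ with hB
  have hB0 : 0 ≤ B := by positivity
  rw [Metric.continuous_iff]
  intro y δ hδ
  have hδ' : 0 < δ / (B * C + 1) := by positivity
  obtain ⟨ρ, hρ, hρh⟩ := Metric.uniformContinuous_iff.1 hu _ hδ'
  refine ⟨ρ, hρ, fun y' hy' => ?_⟩
  rw [dist_eq_norm, ← MemLp.toLp_sub]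
  refine (Lp.norm_le_of_ae_bound (C := C * (δ / (B * C + 1))) (by positivity) ?_).trans_lt ?_
  · filter_upwards [(((ha.mul_comp_sub hh k y').memLp p Q).sub
      ((ha.mul_comp_sub hh k y).memLp p Q)).coeFn_toLp] with x hx
    rw [hx, Pi.sub_apply, ← mul_sub, norm_mul]
    gcongr
    · exact hC x
    · rw [← dist_eq_norm]
      refine (hρh ?_).le
      rwa [dist_sub_right]
  · change B * (C * (δ / (B * C + 1))) < δ
    rw [← mul_assoc, ← mul_div_assoc, div_lt_iff₀ (by positivity)]
    nlinarith

variable (p Q) in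
/-- The products `φ(τ_{cy} w) a(x) h(y - k x)`, whose integral over `y` is
`φ_c(τ_{ckx} w) a(x)` for the average `φ_c` of `φ` against `h`. -/
noncomputable def shiftedTensor (ha : IsTest a) (hh : IsTest h) (c k : ℝ) (φ : Lp ℝ p P)
    (y : Space d) : Lp ℝ p (prodMeasure P Q) :=
  tensorL ℝ P (volume.restrict Q) p (shiftOp τ p (c • y) φ)
    (((ha.mul_comp_sub hh k y).memLp p Q).toLp _)

theorem continuous_shiftedTensor (ha : IsTest a) (hh : IsTest h) (c k : ℝ) (φ : Lp ℝ p P) :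
    Continuous (shiftedTensor τ Q p ha hh c k φ) :=
  ((tensorL ℝ P (volume.restrict Q) p).continuous.comp (continuous_shiftOp_smul c φ)).clm_apply
    (continuous_toLp_mul_comp_sub Q p ha hh k)

theorem integrable_shiftedTensor (ha : IsTest a) (hh : IsTest h) (c k : ℝ) (φ : Lp ℝ p P) :
    Integrable (shiftedTensor τ Q p ha hh c k φ) := by
  refine (continuous_shiftedTensor τ ha hh c k φ).integrable_of_hasCompactSupport ?_
  -- The product a(x) h(y - kx) can be nonzero only for y in supp h + k supp a.
  refine HasCompactSupport.intro (K := (fun z : Space d × Space d => z.1 + k • z.2) ''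
    (tsupport h ×ˢ tsupport a)) ((hh.hasCompactSupport.isCompact.prod
      ha.hasCompactSupport.isCompact).image (by fun_prop)) fun y hy => ?_
  have h1 : (fun x => a x * h (y - k • x)) = fun _ => 0 := by
    funext x
    by_cases hx : x ∈ tsupport a
    · have : y - k • x ∉ tsupport h := fun hyx => hy ⟨(y - k • x, x), ⟨hyx, hx⟩, by simp⟩
      rw [image_eq_zero_of_notMem_tsupport this, mul_zero]
    · rw [image_eq_zero_of_notMem_tsupport hx, zero_mul]
  have h2 : ((ha.mul_comp_sub hh k y).memLp p Q).toLp _ = 0 := by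
    refine Lp.ext ?_
    filter_upwards [((ha.mul_comp_sub hh k y).memLp p Q).coeFn_toLp, Lp.coeFn_zero ℝ p _]
      with x h3 h4
    rw [h3, h4]
    exact congrFun h1 x
  rw [shiftedTensor, h2, map_zero]

/-- Fubini, then y ↦ y + kx in the inner integral. Since k = (cε)⁻¹, the translation produces the
shift U_{x/ε}, which cancels the unfolding shift U_{-x/ε}. -/
theorem integral_conv_mul_comp_sub (ha : IsTest a) (hh : IsTest h) {θ : Space d → ℝ}
    (hθ : IsTest θ) {c ε : ℝ} (hc : c ≠ 0) (φ : Lp ℝ p P) :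
    ∫ y, conv τ p (-ε⁻¹) (fun x => θ x * (a x * h (y - (c * ε)⁻¹ • x))) (shiftOp τ p (c • y) φ) =
      (∫ x, θ x * a x) • conv τ p c h φ := by
  set k : ℝ := (c * ε)⁻¹ with hk
  have hck : c * k = ε⁻¹ := by
    rw [hk, mul_inv, ← mul_assoc, mul_inv_cancel₀ hc, one_mul]
  simp only [conv]
  rw [integral_integral_swap]
  · rw [← integral_smul_const]
    refine integral_congr_ae (Eventually.of_forall fun x => ?_)
    simp only
    have h1 : ∀ y, (θ x * (a x * h (y - k • x))) • shiftOp τ p (-ε⁻¹ • x) (shiftOp τ p (c • y) φ) =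
        (θ x * a x) • (fun y => h y • shiftOp τ p (c • y) φ) (y - k • x) := by
      intro y
      simp only
      rw [shiftOp_shiftOp, ← mul_assoc, mul_smul]
      congr 3
      rw [smul_sub, smul_smul, hck, neg_smul]
      abel
    simp_rw [h1]
    rw [integral_smul, integral_sub_right_eq_self (fun y => h y • shiftOp τ p (c • y) φ)]
  · refine Continuous.integrable_of_hasCompactSupport ?_ ?_
    · have h1 := hθ.continuous
      have h2 := ha.continuous
      have h3 := hh.continuous
      have h4 : Continuous fun z : Space d × Space d => θ z.2 * (a z.2 * h (z.1 - k • z.2)) := by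
        fun_prop
      refine h4.smul (g := fun z : Space d × Space d =>
        shiftOp τ p (-ε⁻¹ • z.2) (shiftOp τ p (c • z.1) φ)) ?_
      exact continuous_shiftOp_uncurry (f := fun z : Space d × Space d => -ε⁻¹ • z.2)
        (g := fun z => shiftOp τ p (c • z.1) φ) (by fun_prop) ((continuous_shiftOp_smul c φ).comp continuous_fst)
    · refine HasCompactSupport.intro (K := (fun z : Space d × Space d => (z.1 + k • z.2, z.2)) ''
        (tsupport h ×ˢ tsupport a)) ((hh.hasCompactSupport.isCompact.prod
          ha.hasCompactSupport.isCompact).image (by fun_prop)) ?_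
      rintro ⟨y, x⟩ hy
      simp only [Function.uncurry]
      by_cases hx : x ∈ tsupport a
      · have : y - k • x ∉ tsupport h := fun hyx => hy ⟨(y - k • x, x), ⟨hyx, hx⟩, by simp⟩
        rw [image_eq_zero_of_notMem_tsupport this, mul_zero, mul_zero, zero_smul]
      · rw [image_eq_zero_of_notMem_tsupport hx, zero_mul, mul_zero, zero_smul]

theorem testAvg_unfoldL_integral {Y : Type*} [MeasurableSpace Y] {ν : Measure Y}
    {θ : Space d → ℝ} (hθ : IsTest θ) (ε : ℝ) {f : Y → Lp ℝ p (prodMeasure P Q)}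
    (hf : Integrable f ν) :
    testAvg P Q p ℝ hθ (unfoldL τ Q p ℝ ε (∫ y, f y ∂ν)) =
      ∫ y, testAvg P Q p ℝ hθ (unfoldL τ Q p ℝ ε (f y)) ∂ν := by
  have h1 := (unfoldL τ Q p ℝ ε).toContinuousLinearMap.integral_comp_comm hf
  have h2 := (testAvg P Q p ℝ hθ).integral_comp_comm
    ((unfoldL τ Q p ℝ ε).toContinuousLinearMap.integrable_comp hf)
  rw [h1] at h2
  exact h2.symm

/-- The superposition is φ_c(τ_{x/ε} ω) a(x), with φ_c the average of φ against h. Writing it as an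
integral of products shows that it belongs to the tensor spaces, and equality is checked by testing.
-/
theorem unfoldL_integral_shiftedTensor (ha : IsTest a) (haQ : tsupport a ⊆ Q) (hh : IsTest h)
    {c ε : ℝ} (hc : c ≠ 0) (φ : Lp ℝ p P) :
    unfoldL τ Q p ℝ ε (∫ y, shiftedTensor τ Q p ha hh c (c * ε)⁻¹ φ y) =
      tensorL ℝ P (volume.restrict Q) p (conv τ p c h φ) ((ha.memLp p Q).toLp a) := by
  refine eq_of_testAvg_eq fun θ hθ => ?_
  have h2 : ∀ y, testAvg P Q p ℝ hθ
      (unfoldL τ Q p ℝ ε (shiftedTensor τ Q p ha hh c (c * ε)⁻¹ φ y)) =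
      conv τ p (-ε⁻¹) (fun x => θ x * (a x * h (y - (c * ε)⁻¹ • x))) (shiftOp τ p (c • y) φ) :=
    fun y => testAvg_unfoldL_tensorL τ ε hθ (tsupport_mul_subset_left.trans haQ) _
      (MemLp.coeFn_toLp _)
  rw [testAvg_unfoldL_integral τ hθ ε (integrable_shiftedTensor τ ha hh c (c * ε)⁻¹ φ)]
  simp_rw [h2]
  rw [integral_conv_mul_comp_sub τ ha hh hθ hc φ]
  have h3 : (slice (tensorL ℝ P (volume.restrict Q) p (conv τ p c h φ) ((ha.memLp p Q).toLp a)) :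
      Lp (Lp ℝ p P) p (volume.restrict Q)) =ᵐ[volume.restrict Q]
      fun x => a x • conv τ p c h φ := by
    filter_upwards [slice_tensorL (conv τ p c h φ) ((ha.memLp p Q).toLp a),
      (ha.memLp p Q).coeFn_toLp] with x h4 h5
    rw [h4, h5]
  rw [testAvg_eq_of_slice hθ h3, ← integral_smul_const]
  simp_rw [← mul_smul]
  refine (setIntegral_eq_integral_of_forall_compl_eq_zero fun x hx => ?_).symm
  rw [image_eq_zero_of_notMem_tsupport fun h6 => hx (haQ h6), mul_zero, zero_smul]

end Correctors

/-! ### Correctors with their gradients, and the space of correctable fields. -/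

section CorrectorPairs

variable {d : ℕ} {Ω : Type*} [MeasurableSpace Ω] {P : Measure Ω} [IsProbabilityMeasure P]
  (τ : ShiftGroup d P) {Q : Set (Space d)} [IsFiniteMeasure (volume.restrict Q)]
  {p : ℝ≥0∞} [Fact (1 ≤ p)] [hp : Fact (p ≠ ⊤)] [SecondCountableTopology (Lp ℝ p P)]
  {η g : Space d → ℝ}

theorem partialDeriv_mul_comp_sub (hη : IsTest η) (hg : IsTest g) (k : ℝ) (y : Space d) (i : Fin d)
    (x : Space d) : partialDeriv i (fun x => η x * g (y - k • x)) x =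
      partialDeriv i η x * g (y - k • x) + -k * (η x * partialDeriv i g (y - k • x)) := by
  have h1 : HasFDerivAt (fun x : Space d => y - k • x)
      (-(k • ContinuousLinearMap.id ℝ (Space d))) x :=
    ((hasFDerivAt_id x).const_smul k).const_sub y
  have h2 := (hη.contDiff_one.differentiable one_ne_zero x).hasFDerivAt.mul
    ((hg.contDiff_one.differentiable one_ne_zero (y - k • x)).hasFDerivAt.comp x h1)
  have h3 : HasFDerivAt (fun x => η x * g (y - k • x)) _ x := h2
  rw [partialDeriv, h3.fderiv]
  simp [partialDeriv]
  ring

theorem coord_tensorPair_shiftOp (hη : IsTest η) (hg : IsTest g) (c k : ℝ) (φ : Lp ℝ p P)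
    (y : Space d) (i : Fin d) :
    coord (prodMeasure P Q) p i (tensorPair (shiftOp τ p (c • y) φ)
      (testPair p Q (hη.mul_comp_sub hg k y))).2 =
      shiftedTensor τ Q p (hη.partialDeriv i) hg c k φ y -
        k • shiftedTensor τ Q p hη (hg.partialDeriv i) c k φ y := by
  rw [coord_tensorPair, shiftedTensor, shiftedTensor, ← map_smul, ← map_sub]
  congr 1
  refine Lp.ext ?_
  set u := (((hη.partialDeriv i).mul_comp_sub hg k y).memLp p Q).toLp _ with hu
  set v := ((hη.mul_comp_sub (hg.partialDeriv i) k y).memLp p Q).toLp _ with hv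
  filter_upwards [coord_testPair (p := p) (Q := Q) (hη.mul_comp_sub hg k y) i,
    Lp.coeFn_sub u (k • v), Lp.coeFn_smul k v,
    (((hη.partialDeriv i).mul_comp_sub hg k y).memLp p Q).coeFn_toLp,
    ((hη.mul_comp_sub (hg.partialDeriv i) k y).memLp p Q).coeFn_toLp] with x h1 h2 h3 h4 h5
  rw [h1, h2, Pi.sub_apply, h3, Pi.smul_apply, h4, h5, partialDeriv_mul_comp_sub hη hg, smul_eq_mul]
  ring

theorem map_sub_smul {X Y : Type*} [AddCommGroup X] [Module ℝ X] [AddCommGroup Y] [Module ℝ Y]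
    (A : X →ₗ[ℝ] Y) (k : ℝ) (x x' : X) : A (x - k • x') = A x - k • A x' := by
  rw [map_sub, map_smul]

theorem smul_sub_smul_of_mul_eq {X : Type*} [AddCommGroup X] [Module ℝ X] {a b c : ℝ}
    (h : a * b = c) (x y : X) : a • (x - b • y) = a • x + -(c • y) := by
  rw [smul_sub, smul_smul, h, sub_eq_add_neg]

theorem map_smul_add {X Y : Type*} [AddCommGroup X] [Module ℝ X] [AddCommGroup Y] [Module ℝ Y]
    (A : X →ₗ[ℝ] Y) (k : ℝ) (x x' : X) : A (k • x + x') = k • A x + A x' := by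
  rw [map_add, map_smul]

theorem clm_neg_smul_apply {X Y W : Type*} [NormedAddCommGroup X] [NormedSpace ℝ X]
    [NormedAddCommGroup Y] [NormedSpace ℝ Y] [NormedAddCommGroup W] [NormedSpace ℝ W]
    (B : X →L[ℝ] Y →L[ℝ] W) (k : ℝ) (x : X) (y : Y) : B (-(k • x)) y = -(k • B x y) := by
  simp

variable (Q p) in
/-- The pairs `φ(τ_{cy} w) (ζ_y, ∇ζ_y)(x)` with `ζ_y(x) = η(x) g(y - k x)`. -/
noncomputable def shiftedPair (hη : IsTest η) (hg : IsTest g) (c k : ℝ) (φ : Lp ℝ p P)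
    (y : Space d) : Lp ℝ p (prodMeasure P Q) × Lp (Space d) p (prodMeasure P Q) :=
  tensorPair (shiftOp τ p (c • y) φ) (testPair p Q (hη.mul_comp_sub hg k y))

theorem shiftedPair_fst (hη : IsTest η) (hg : IsTest g) (c k : ℝ) (φ : Lp ℝ p P) (y : Space d) :
    (shiftedPair τ Q p hη hg c k φ y).1 = shiftedTensor τ Q p hη hg c k φ y := rfl

theorem integrable_shiftedPair (hη : IsTest η) (hg : IsTest g) (c k : ℝ) (φ : Lp ℝ p P) :
    Integrable (shiftedPair τ Q p hη hg c k φ) := by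
  have h1 : Integrable fun y => ∑ i, incl (prodMeasure P Q) p i
      (shiftedTensor τ Q p (hη.partialDeriv i) hg c k φ y -
        k • shiftedTensor τ Q p hη (hg.partialDeriv i) c k φ y) :=
    integrable_finsetSum _ fun i _ => (incl (prodMeasure P Q) p i).integrable_comp
      ((integrable_shiftedTensor τ (hη.partialDeriv i) hg c k φ).sub
        ((integrable_shiftedTensor τ hη (hg.partialDeriv i) c k φ).smul k))
  refine ((integrable_shiftedTensor τ hη hg c k φ).prodMk h1).congr
    (Eventually.of_forall fun y => ?_)
  refine Prod.ext (shiftedPair_fst τ hη hg c k φ y).symm (ext_coord fun i => ?_)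
  rw [coord_sum_incl, shiftedPair, coord_tensorPair_shiftOp]

theorem integral_shiftedPair_fst (hη : IsTest η) (hg : IsTest g) (c k : ℝ) (φ : Lp ℝ p P) :
    (∫ y, shiftedPair τ Q p hη hg c k φ y).1 = ∫ y, shiftedTensor τ Q p hη hg c k φ y :=
  fst_integral (integrable_shiftedPair τ hη hg c k φ)

theorem coord_integral_shiftedPair (hη : IsTest η) (hg : IsTest g) (c k : ℝ) (φ : Lp ℝ p P)
    (i : Fin d) :
    coord (prodMeasure P Q) p i (∫ y, shiftedPair τ Q p hη hg c k φ y).2 =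
      (∫ y, shiftedTensor τ Q p (hη.partialDeriv i) hg c k φ y) -
        k • ∫ y, shiftedTensor τ Q p hη (hg.partialDeriv i) c k φ y := by
  have h0 := integrable_shiftedPair τ (Q := Q) hη hg c k φ
  have h1 := integral_sub (integrable_shiftedTensor τ (Q := Q) (hη.partialDeriv i) hg c k φ)
    ((integrable_shiftedTensor τ (Q := Q) hη (hg.partialDeriv i) c k φ).smul k)
  simp only [Pi.smul_apply] at h1
  rw [snd_integral h0, ← (coord (prodMeasure P Q) p i).integral_comp_comm h0.snd, ← integral_smul,
    ← h1]
  refine integral_congr_ae (Eventually.of_forall fun y => ?_)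
  simp only [shiftedPair]
  exact coord_tensorPair_shiftOp τ hη hg c k φ y i

/-- Every integrand is a product with a test function supported in Q, and the space is closed. No
regularity of x ↦ φ(τ_x ω) is needed. -/
theorem integral_shiftedPair_mem (hη : IsTest η) (hηQ : tsupport η ⊆ Q) (hg : IsTest g) (c k : ℝ)
    (φ : Lp ℝ p P) :
    ∫ y, shiftedPair τ Q p hη hg c k φ y ∈ randomSobolevZero p Q (⊤ : Submodule ℝ (Lp ℝ p P)) :=
  integral_mem_submodule (Submodule.isClosed_topologicalClosure _) (Eventually.of_forall fun y =>
    tensorPair_mem_randomSobolevZero Submodule.mem_top (testPair_mem_sobolevZero _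
      (tsupport_mul_subset_left.trans hηQ)))

theorem unfoldPair_integral_shiftedPair_fst (hη : IsTest η) (hηQ : tsupport η ⊆ Q) (hg : IsTest g)
    {c : ℝ} (hc : c ≠ 0) (ε : ℝ) (φ : Lp ℝ p P) :
    (unfoldPair τ Q p ε (∫ y, shiftedPair τ Q p hη hg c (c * ε)⁻¹ φ y)).1 =
      tensorL ℝ P (volume.restrict Q) p (conv τ p c g φ) ((hη.memLp p Q).toLp η) := by
  rw [unfoldPair_apply, integral_shiftedPair_fst]
  exact unfoldL_integral_shiftedTensor τ hη hηQ hg hc φ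

theorem coord_unfoldPair_integral_shiftedPair (hη : IsTest η) (hηQ : tsupport η ⊆ Q)
    (hg : IsTest g) {c : ℝ} (hc : c ≠ 0) (ε : ℝ) (φ : Lp ℝ p P) (i : Fin d) :
    coord (prodMeasure P Q) p i
        (unfoldPair τ Q p ε (∫ y, shiftedPair τ Q p hη hg c (c * ε)⁻¹ φ y)).2 =
      tensorL ℝ P (volume.restrict Q) p (conv τ p c g φ)
          (((hη.partialDeriv i).memLp p Q).toLp _) -
        (c * ε)⁻¹ • tensorL ℝ P (volume.restrict Q) p (conv τ p c (partialDeriv i g) φ)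
          ((hη.memLp p Q).toLp η) := by
  have h1 := unfoldL_integral_shiftedTensor τ (ε := ε) (hη.partialDeriv i)
    ((tsupport_partialDeriv_subset i).trans hηQ) hg hc φ
  have h2 := unfoldL_integral_shiftedTensor τ (ε := ε) hη hηQ (hg.partialDeriv i) hc φ
  rw [← h1, ← h2, unfoldPair_apply, coord_unfoldL, coord_integral_shiftedPair]
  exact map_sub_smul (unfoldL τ Q p ℝ ε).toLinearMap _ _ _

/-- The witness is the corrector ε η(x) φ_c(τ_{x/ε} ω). In its gradient the derivative of η keeps
the factor ε, while the derivative of the oscillating factor gains (cε)⁻¹, leaving η times Dφ_c,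
whose components are -c⁻¹ times averages against ∂_i g. -/
theorem exists_unfoldPair_eq (hη : IsTest η) (hηQ : tsupport η ⊆ Q) (hg : IsTest g) {c ε : ℝ}
    (hc : c ≠ 0) (hε : ε ≠ 0) (φ : Lp ℝ p P) :
    ∃ v ∈ randomSobolevZero p Q (⊤ : Submodule ℝ (Lp ℝ p P)),
      unfoldPair τ Q p ε v = ε • tensorPair (conv τ p c g φ) (testPair p Q hη) +
        (0, ∑ i, incl (prodMeasure P Q) p i (tensorL ℝ P (volume.restrict Q) p
          (-(c⁻¹ • conv τ p c (partialDeriv i g) φ)) ((hη.memLp p Q).toLp η))) := by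
  have hεk : ε * (c * ε)⁻¹ = c⁻¹ := by
    rw [mul_inv, mul_comm c⁻¹, ← mul_assoc, mul_inv_cancel₀ hε, one_mul]
  refine ⟨ε • ∫ y, shiftedPair τ Q p hη hg c (c * ε)⁻¹ φ y,
    Submodule.smul_mem _ _ (integral_shiftedPair_mem τ hη hηQ hg _ _ φ), ?_⟩
  rw [(unfoldPair τ Q p ε).map_smul]
  refine Prod.ext ?_ (ext_coord fun i => ?_)
  · rw [Prod.smul_fst, Prod.fst_add, Prod.smul_fst, add_zero,
      unfoldPair_integral_shiftedPair_fst τ hη hηQ hg hc, tensorPair_fst]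
    rfl
  · have h4 : coord (volume.restrict Q) p i (testPair p Q hη).2 =
        ((hη.partialDeriv i).memLp p Q).toLp _ :=
      Lp.ext ((coord_testPair hη i).trans ((hη.partialDeriv i).memLp p Q).coeFn_toLp.symm)
    have h5 : tensorL ℝ P (volume.restrict Q) p (-(c⁻¹ • conv τ p c (partialDeriv i g) φ))
        ((hη.memLp p Q).toLp η) = -(c⁻¹ • tensorL ℝ P (volume.restrict Q) p
          (conv τ p c (partialDeriv i g) φ) ((hη.memLp p Q).toLp η)) :=
      clm_neg_smul_apply _ _ _ _
    have h6 := coord_unfoldPair_integral_shiftedPair τ hη hηQ hg hc ε φ i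
    have h7 := coord_tensorPair (conv τ p c g φ) (testPair p Q hη) i
    rw [h4] at h7
    refine ((coord (prodMeasure P Q) p i).map_smul ε _).trans ?_
    refine Eq.trans ?_ (map_smul_add (coord (prodMeasure P Q) p i).toLinearMap ε _ _).symm
    refine (congrArg (ε • ·) h6).trans ?_
    refine Eq.trans ?_ (congrArg₂ (ε • · + ·) h7.symm ((coord_sum_incl i _).trans h5).symm)
    exact smul_sub_smul_of_mul_eq hεk _ _

variable (Q p) in
/-- The vector fields `χ` that are strong two-scale limits of gradients of random functions whose
values tend to zero. -/
noncomputable def correctable :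
    Submodule ℝ (Lp (Space d) p (prodMeasure P Q)) where
  carrier := {χ | ∀ δ > 0, ∀ᶠ ε in 𝓝[>] (0 : ℝ),
    ∃ v ∈ randomSobolevZero p Q (⊤ : Submodule ℝ (Lp ℝ p P)),
      ‖unfoldPair τ Q p ε v - (0, χ)‖ < δ}
  zero_mem' := fun δ hδ => Eventually.of_forall fun ε => ⟨0, Submodule.zero_mem _, by
    have : ((0, 0) : Lp ℝ p (prodMeasure P Q) × Lp (Space d) p (prodMeasure P Q)) = 0 := rfl
    rw [map_zero, this, sub_zero, norm_zero]
    exact hδ⟩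
  add_mem' := by
    intro χ χ' h h' δ hδ
    filter_upwards [h (δ / 2) (half_pos hδ), h' (δ / 2) (half_pos hδ)] with ε h1 h2
    obtain ⟨v, hv, h3⟩ := h1
    obtain ⟨w, hw, h4⟩ := h2
    refine ⟨v + w, add_mem hv hw, ?_⟩
    have h5 : unfoldPair τ Q p ε (v + w) - (0, χ + χ') =
        (unfoldPair τ Q p ε v - (0, χ)) + (unfoldPair τ Q p ε w - (0, χ')) := by
      have : ((0, χ + χ') : Lp ℝ p (prodMeasure P Q) × Lp (Space d) p (prodMeasure P Q)) =
        (0, χ) + (0, χ') := by simp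
      rw [map_add, this]
      abel
    rw [h5]
    exact (norm_add_le _ _).trans_lt (by linarith)
  smul_mem' := by
    intro c χ h δ hδ
    filter_upwards [h (δ / (|c| + 1)) (by positivity)] with ε h1
    obtain ⟨v, hv, h3⟩ := h1
    refine ⟨c • v, Submodule.smul_mem _ _ hv, ?_⟩
    have h5 : unfoldPair τ Q p ε (c • v) - (0, c • χ) = c • (unfoldPair τ Q p ε v - (0, χ)) := by
      have : ((0, c • χ) : Lp ℝ p (prodMeasure P Q) × Lp (Space d) p (prodMeasure P Q)) =
        c • (0, χ) := by simp
      rw [map_smul, this, smul_sub]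
    rw [h5, norm_smul, Real.norm_eq_abs]
    rw [lt_div_iff₀ (by positivity)] at h3
    nlinarith [norm_nonneg (unfoldPair τ Q p ε v - (0, χ))]

/-- Errors are measured after unfolding, where the target (0, χ) does not depend on ε, so a nearby
correctable field serves for all small ε at once. -/
theorem isClosed_correctable :
    IsClosed (correctable τ Q p : Set (Lp (Space d) p (prodMeasure P Q))) := by
  refine isClosed_of_closure_subset fun χ hχ δ hδ => ?_
  obtain ⟨χ', hχ', hd⟩ := Metric.mem_closure_iff.1 hχ (δ / 2) (half_pos hδ)
  filter_upwards [hχ' (δ / 2) (half_pos hδ)] with ε h1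
  obtain ⟨v, hv, h3⟩ := h1
  refine ⟨v, hv, ?_⟩
  have h5 : unfoldPair τ Q p ε v - (0, χ) = (unfoldPair τ Q p ε v - (0, χ')) - (0, χ - χ') := by
    have : ((0, χ) : Lp ℝ p (prodMeasure P Q) × Lp (Space d) p (prodMeasure P Q)) =
      (0, χ') + (0, χ - χ') := by simp
    rw [this]
    abel
  rw [h5]
  refine (norm_sub_le _ _).trans_lt ?_
  have h6 : ‖((0, χ - χ') : Lp ℝ p (prodMeasure P Q) × Lp (Space d) p (prodMeasure P Q))‖ =
      dist χ χ' := by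
    rw [Prod.norm_mk, norm_zero, dist_eq_norm, max_eq_right (norm_nonneg _)]
  rw [h6]
  linarith

theorem sum_incl_tensorL_mem_correctable (hη : IsTest η) (hηQ : tsupport η ⊆ Q) (hg : IsTest g)
    {c : ℝ} (hc : c ≠ 0) (φ : Lp ℝ p P) :
    ∑ i, incl (prodMeasure P Q) p i (tensorL ℝ P (volume.restrict Q) p
      (-(c⁻¹ • conv τ p c (partialDeriv i g) φ)) ((hη.memLp p Q).toLp η)) ∈
      correctable τ Q p := by
  intro δ hδ
  have h1 : Tendsto (fun ε : ℝ => ‖ε • tensorPair (conv τ p c g φ) (testPair p Q hη)‖) (𝓝[>] 0)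
      (𝓝 0) := by
    have h2 : Continuous fun ε : ℝ => ‖ε • tensorPair (conv τ p c g φ) (testPair p Q hη)‖ := by
      fun_prop
    have h3 := h2.tendsto 0
    rw [zero_smul, norm_zero] at h3
    exact h3.mono_left nhdsWithin_le_nhds
  filter_upwards [h1.eventually (gt_mem_nhds hδ), self_mem_nhdsWithin] with ε h2 hε
  obtain ⟨v, hv, h3⟩ := exists_unfoldPair_eq τ hη hηQ hg hc (ne_of_gt hε) φ
  refine ⟨v, hv, ?_⟩
  rw [h3, add_sub_cancel_right]
  exact h2

end CorrectorPairs

/-! ### Every field in L^p_pot ⊗ L^p(Q) is correctable. -/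

section CorrectorDensity

variable {d : ℕ} {Ω : Type*} [MeasurableSpace Ω] {P : Measure Ω} [IsProbabilityMeasure P]
  (τ : ShiftGroup d P) {Q : Set (Space d)} [IsFiniteMeasure (volume.restrict Q)]
  {p q : ℝ≥0∞} [Fact (1 ≤ p)] [hp : Fact (p ≠ ⊤)] [SecondCountableTopology (Lp ℝ p P)]
  [SecondCountableTopology (Lp (Space d) p P)]

theorem coord_tensorL (ψ : Lp (Space d) p P) (z : Lp ℝ p (volume.restrict Q)) (i : Fin d) :
    coord (prodMeasure P Q) p i (tensorL (Space d) P (volume.restrict Q) p ψ z) =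
      tensorL ℝ P (volume.restrict Q) p (coord P p i ψ) z := by
  refine (tensorL_eq_of_ae ?_).symm
  have h1 := (Measure.quasiMeasurePreserving_fst (μ := P) (ν := volume.restrict Q)).ae_eq_comp
    (coord_coeFn i ψ)
  filter_upwards [coord_coeFn i (tensorL (Space d) P (volume.restrict Q) p ψ z),
    tensorL_coeFn ψ z, h1] with x h2 h3 h4
  simp only [Function.comp] at h4
  rw [h2, h3, h4]
  rfl

theorem tensorL_gradient_mem_correctable {η : Space d → ℝ} (hη : IsTest η)
    (hηQ : tsupport η ⊆ Q) {ψ : Lp (Space d) p P} (hψ : ψ ∈ stochGradRange τ p) :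
    tensorL (Space d) P (volume.restrict Q) p ψ ((hη.memLp p Q).toLp η) ∈
      correctable τ Q p := by
  obtain ⟨φ, hφ⟩ := hψ
  obtain ⟨g, hg, hgs, -, hg1⟩ := exists_mollifier d
  have hgt : IsTest g := ⟨hg, hgs⟩
  set A := tensorL ℝ P (volume.restrict Q) p with hA
  have h1 : Tendsto (fun c : ℝ => ∑ i, incl (prodMeasure P Q) p i
      (A (conv τ p c g (coord P p i ψ)) ((hη.memLp p Q).toLp η))) (𝓝[≠] 0)
      (𝓝 (∑ i, incl (prodMeasure P Q) p i (A (coord P p i ψ) ((hη.memLp p Q).toLp η)))) := by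
    refine tendsto_finsetSum _ fun i _ => ?_
    refine ((incl (prodMeasure P Q) p i).continuous.tendsto _).comp ?_
    refine ((A.flip ((hη.memLp p Q).toLp η)).continuous.tendsto _).comp ?_
    exact (tendsto_conv_zero hg.continuous hgs hg1 (coord P p i ψ)).mono_left nhdsWithin_le_nhds
  have h2 : tensorL (Space d) P (volume.restrict Q) p ψ ((hη.memLp p Q).toLp η) =
      ∑ i, incl (prodMeasure P Q) p i (A (coord P p i ψ) ((hη.memLp p Q).toLp η)) :=
    ext_coord fun i => by rw [coord_tensorL, coord_sum_incl]
  rw [h2]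
  refine (isClosed_correctable τ).mem_of_tendsto h1 ?_
  filter_upwards [self_mem_nhdsWithin] with c hc
  -- Two computations of D_i of the mollified φ: mollification commutes with D_i, and D_i may fall
  -- on the kernel. As c → 0 the left side tends to the i-th component of ψ.
  have h3 : ∀ i, conv τ p c g (coord P p i ψ) = -(c⁻¹ • conv τ p c (partialDeriv i g) φ) := fun i =>
    tendsto_nhds_unique ((hφ i).conv hg.continuous hgs)
      (hasStochDeriv_conv hc hgt.contDiff_one hgs i φ)
  simp_rw [h3]
  exact sum_incl_tensorL_mem_correctable τ hη hηQ hgt hc φ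

/-- Three successive closures: from test functions to L^p(Q), from stochastic gradients to L^p_pot,
and from products to the tensor space, each absorbed by the closedness of `correctable`. -/
theorem vectorTensorLp_le_correctable [Fact (1 ≤ q)] [ENNReal.HolderConjugate q p] (hq : q ≠ ⊤)
    (hQ : IsOpen Q) : vectorTensorLp p Q (LpPot τ p) ≤ correctable τ Q p := by
  refine Submodule.topologicalClosure_minimal _ (Submodule.span_le.2 ?_) (isClosed_correctable τ)
  rintro w ⟨ψ, hψ, z, hw⟩
  rw [← tensorL_eq_of_ae hw]
  set A := tensorL (Space d) P (volume.restrict Q) p with hA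
  have h1 : LpPot τ p ≤ (correctable τ Q p).comap (A.flip z).toLinearMap := by
    refine Submodule.topologicalClosure_minimal _ (fun ψ hψ => ?_)
      ((isClosed_correctable τ).preimage (A.flip z).continuous)
    have h2 : z ∈ (correctable τ Q p).comap (A ψ).toLinearMap :=
      mem_of_isTest_mem (q := q) hp.out hq hQ ((isClosed_correctable τ).preimage (A ψ).continuous)
        (fun η hη hηQ => tensorL_gradient_mem_correctable τ hη hηQ hψ) z
    exact h2
  exact h1 hψ

end CorrectorDensity

/-! ### Compactness, the liminf inequality and recovery sequences. -/

section Homogenization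

variable {d : ℕ} {Ω : Type*} [MeasurableSpace Ω] {P : Measure Ω} [IsProbabilityMeasure P]
  (τ : ShiftGroup d P) {Q : Set (Space d)} [IsFiniteMeasure (volume.restrict Q)]
  {p q : ℝ≥0∞} [Fact (1 ≤ p)] [hp : Fact (p ≠ ⊤)] {V : Ω → Space d → Space d → ℝ}

/-- Coercivity of V applied to the unfolded gradient; as unfolding is isometric, the bound holds for
the gradient itself, uniformly in ε. -/
theorem exists_norm_unfold_le (hV : IsConvexIntegrand P Q p V) (M : ℝ) :
    ∃ R : ℝ, 0 ≤ R ∧ ∀ ε : ℝ, ∀ u : Lp ℝ p (prodMeasure P Q) × Lp (Space d) p (prodMeasure P Q),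
      oscEnergy τ Q V ε u ≤ M → ‖u.2‖ ≤ R := by
  obtain ⟨C, hC, hg⟩ := hV.growth
  have hp0 := exponent_toReal_pos p
  refine ⟨|C * (M + C * (prodMeasure P Q).real Set.univ)| ^ (p.toReal)⁻¹, by positivity,
    fun ε u hu => ?_⟩
  rw [oscEnergy_eq τ hp.out hV] at hu
  have h1 := (le_integralFunctional hV.aemeasurable hV.convex hC hg _).trans hu
  have h2 : ‖unfold τ Q hp.out ε u.2‖ = ‖u.2‖ := (unfoldL τ Q p (Space d) ε).norm_map u.2
  rw [h2] at h1
  have h3 : ‖u.2‖ ^ p.toReal ≤ |C * (M + C * (prodMeasure P Q).real Set.univ)| := by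
    refine le_trans ?_ (le_abs_self _)
    have h4 : 1 / C * ‖u.2‖ ^ p.toReal ≤ M + C * (prodMeasure P Q).real Set.univ := by linarith
    rwa [one_div, inv_mul_le_iff₀ hC] at h4
  calc ‖u.2‖ = (‖u.2‖ ^ p.toReal) ^ (p.toReal)⁻¹ := (Real.rpow_rpow_inv (norm_nonneg _) hp0.ne').symm
    _ ≤ _ := Real.rpow_le_rpow (by positivity) h3 (by positivity)

theorem continuous_energy (hV : IsConvexIntegrand P Q p V) :
    Continuous (integralFunctional (prodMeasure P Q) p fun z : Ω × Space d => V z.1 z.2) := by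
  obtain ⟨C, hC, hg⟩ := hV.growth
  exact continuous_integralFunctional hV.aemeasurable hV.convex hC hg

theorem convexOn_energy (hV : IsConvexIntegrand P Q p V) :
    ConvexOn ℝ Set.univ
      (integralFunctional (prodMeasure P Q) p fun z : Ω × Space d => V z.1 z.2) := by
  obtain ⟨C, hC, hg⟩ := hV.growth
  exact convexOn_integralFunctional hV.aemeasurable hV.convex hC hg

theorem tendsto_oscEnergy (hV : IsConvexIntegrand P Q p V)
    {u : ℝ → Lp ℝ p (prodMeasure P Q) × Lp (Space d) p (prodMeasure P Q)}
    {u₀ : Lp ℝ p (prodMeasure P Q) × Lp (Space d) p (prodMeasure P Q)}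
    {χ : Lp (Space d) p (prodMeasure P Q)}
    (h : Tendsto (fun ε => unfold τ Q hp.out ε (u ε).2) (𝓝[>] 0) (𝓝 (u₀.2 + χ))) :
    Tendsto (fun ε => oscEnergy τ Q V ε (u ε)) (𝓝[>] 0) (𝓝 (twoScaleEnergy Q V u₀ χ)) := by
  rw [twoScaleEnergy_eq]
  simp_rw [oscEnergy_eq τ hp.out hV]
  exact ((continuous_energy hV).tendsto _).comp h

variable [SecondCountableTopology (Lp ℝ p P)] [SecondCountableTopology (Lp (Space d) p P)]

theorem exists_limit_of_limsup_lt_top [Fact (1 ≤ q)] [ENNReal.HolderConjugate p q] (hq : q ≠ ⊤)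
    [TopologicalSpace.SeparableSpace (Lp ℝ q P)]
    [TopologicalSpace.SeparableSpace (Lp ℝ q (prodMeasure P Q))] (hd : 0 < d)
    (hQ : Bornology.IsBounded Q) (hV : IsConvexIntegrand P Q p V)
    {ε : ℕ → ℝ} (hε : ∀ n, 0 < ε n) (hε0 : Tendsto ε atTop (𝓝 0))
    {u : ℕ → Lp ℝ p (prodMeasure P Q) × Lp (Space d) p (prodMeasure P Q)}
    (hu : ∀ n, u n ∈ randomSobolevZero p Q (⊤ : Submodule ℝ (Lp ℝ p P)))
    (hlim : limsup (fun n => (oscEnergy τ Q V (ε n) (u n) : EReal)) atTop < ⊤) :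
    ∃ u₀ ∈ randomSobolevZero p Q (LpInv τ p), ∃ χ ∈ vectorTensorLp p Q (LpPot τ p),
      ∃ k : ℕ → ℕ, StrictMono k ∧
        WeakTwoScale τ Q hp.out atTop (fun n => ε (k n)) (fun n => (u (k n)).1) u₀.1 ∧
        WeakTwoScale τ Q hp.out atTop (fun n => ε (k n)) (fun n => (u (k n)).2) (u₀.2 + χ) ∧
        (twoScaleEnergy Q V u₀ χ : EReal) ≤
          liminf (fun n => (oscEnergy τ Q V (ε (k n)) (u (k n)) : EReal)) atTop := by
  obtain ⟨M, hM, -⟩ := EReal.lt_iff_exists_real_btwn.1 hlim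
  -- The energy bound holds only from index m on, so compactness is applied to the shifted sequence
  -- and the final subsequence is n ↦ k n + m.
  obtain ⟨m, hm⟩ := eventually_atTop.1 (eventually_lt_of_limsup_lt hM)
  obtain ⟨R, hR0, hR⟩ := exists_norm_unfold_le τ hV M
  -- Poincaré needs one coordinate direction, available because d > 0.
  obtain ⟨K, hK0, hK⟩ := exists_poincare (P := P) (p := p) hQ ⟨0, hd⟩
  have hbd : ∀ n, ‖unfoldPair τ Q p (ε (n + m)) (u (n + m))‖ ≤ max (K * R) R := by
    intro n
    have h1 : ‖(u (n + m)).2‖ ≤ R :=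
      hR _ _ (EReal.coe_le_coe_iff.1 (hm (n + m) (Nat.le_add_left _ _)).le)
    have h2 : ‖(u (n + m)).1‖ ≤ K * R := (hK _ (hu _)).trans
      (mul_le_mul_of_nonneg_left ((norm_coord_le _ _).trans h1) hK0)
    rw [unfoldPair_apply, Prod.norm_mk, LinearIsometry.norm_map, LinearIsometry.norm_map]
    exact max_le_max h2 h1
  obtain ⟨u₀, hu₀, χ, hχ, k, hk, hw⟩ := exists_twoScale_limit τ hq (ε := fun n => ε (n + m))
    (w := fun n => u (n + m)) (fun n => (hε _).ne') ((tendsto_add_atTop_iff_nat m).2 hε0)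
    (fun n => hu _) hbd
  refine ⟨u₀, hu₀, χ, hχ, fun n => k n + m, fun a b hab => Nat.add_lt_add_right (hk hab) m,
    hw.map (ContinuousLinearMap.fst ℝ _ _), hw.map (ContinuousLinearMap.snd ℝ _ _), ?_⟩
  rw [twoScaleEnergy_eq]
  simp_rw [oscEnergy_eq τ hp.out hV]
  exact le_liminf_of_weakTendsto (convexOn_energy hV) (continuous_energy hV)
    (hw.map (ContinuousLinearMap.snd ℝ _ _))

theorem exists_recovery [Fact (1 ≤ q)] [ENNReal.HolderConjugate q p] (hq : q ≠ ⊤)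
    (hQ : IsOpen Q) {u₀ : Lp ℝ p (prodMeasure P Q) × Lp (Space d) p (prodMeasure P Q)}
    (hu₀ : u₀ ∈ randomSobolevZero p Q (LpInv τ p)) {χ : Lp (Space d) p (prodMeasure P Q)}
    (hχ : χ ∈ vectorTensorLp p Q (LpPot τ p)) :
    ∃ u : ℝ → Lp ℝ p (prodMeasure P Q) × Lp (Space d) p (prodMeasure P Q),
      (∀ ε, u ε ∈ randomSobolevZero p Q (⊤ : Submodule ℝ (Lp ℝ p P))) ∧
      Tendsto (fun ε => unfoldPair τ Q p ε (u ε)) (𝓝[>] 0) (𝓝 (u₀.1, u₀.2 + χ)) := by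
  set W := randomSobolevZero p Q (⊤ : Submodule ℝ (Lp ℝ p P)) with hW
  set s : ℝ → Set (Lp ℝ p (prodMeasure P Q) × Lp (Space d) p (prodMeasure P Q)) :=
    fun ε => unfoldPair τ Q p ε '' (W : Set _) with hs
  have hne : ∀ ε, (s ε).Nonempty := fun ε => ⟨_, 0, W.zero_mem, rfl⟩
  -- The distance from (0, χ) to the unfolded space tends to zero, so near-minimisers can be chosen
  -- separately for each ε and no diagonal sequence is needed.
  have h1 : Tendsto (fun ε => Metric.infDist (0, χ) (s ε)) (𝓝[>] 0) (𝓝 0) := by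
    rw [Metric.tendsto_nhds]
    intro δ hδ
    filter_upwards [vectorTensorLp_le_correctable τ (q := q) hq hQ hχ δ hδ] with ε hε
    obtain ⟨v, hv, hvδ⟩ := hε
    rw [Real.dist_0_eq_abs, abs_of_nonneg Metric.infDist_nonneg]
    refine (Metric.infDist_le_dist_of_mem (Set.mem_image_of_mem (unfoldPair τ Q p ε) hv)).trans_lt ?_
    rwa [dist_comm, dist_eq_norm]
  -- The slack must be positive for every real ε so that a choice exists; the extra 1 at ε = 0
  -- disappears along ε → 0⁺.
  have h2 : ∀ ε : ℝ, ∃ v ∈ W, dist (0, χ) (unfoldPair τ Q p ε v) <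
      Metric.infDist (0, χ) (s ε) + (|ε| + if ε = 0 then 1 else 0) := by
    intro ε
    have h3 : Metric.infDist (0, χ) (s ε) <
        Metric.infDist (0, χ) (s ε) + (|ε| + if ε = 0 then 1 else 0) := by
      split_ifs with h
      · linarith [abs_nonneg ε]
      · linarith [abs_pos.2 h]
    obtain ⟨_, ⟨v, hv, rfl⟩, h4⟩ := (Metric.infDist_lt_iff (hne ε)).1 h3
    exact ⟨v, hv, h4⟩
  choose v hvW hv using h2
  have h3 : Tendsto (fun ε => unfoldPair τ Q p ε (v ε)) (𝓝[>] 0) (𝓝 (0, χ)) := by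
    rw [tendsto_iff_dist_tendsto_zero]
    have h4 : Tendsto (fun ε : ℝ => Metric.infDist (0, χ) (s ε) + |ε|) (𝓝[>] 0) (𝓝 0) := by
      have h5 : Tendsto (fun ε : ℝ => |ε|) (𝓝[>] 0) (𝓝 0) := by
        simpa using (continuous_abs.tendsto (0 : ℝ)).mono_left nhdsWithin_le_nhds
      simpa using h1.add h5
    refine squeeze_zero' (Eventually.of_forall fun ε => dist_nonneg) ?_ h4
    filter_upwards [self_mem_nhdsWithin] with ε hε
    have h6 := hv ε
    rw [if_neg (ne_of_gt hε), add_zero] at h6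
    rw [dist_comm]
    exact h6.le
  refine ⟨fun ε => u₀ + v ε, fun ε => add_mem (randomSobolevZero_mono le_top hu₀) (hvW ε), ?_⟩
  have h4 : ((u₀.1, u₀.2 + χ) : Lp ℝ p (prodMeasure P Q) × Lp (Space d) p (prodMeasure P Q)) =
      u₀ + (0, χ) := Prod.ext (add_zero _).symm rfl
  rw [h4]
  refine (h3.const_add u₀).congr fun ε => ?_
  rw [(unfoldPair τ Q p ε).map_add, unfoldPair_of_mem_inv τ ε hu₀]

end Homogenization

/-- Transported through `slice` from L^q(Y; L^q(Ω)), a Bochner space over a separable measure with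
separable values. -/
theorem separableSpace_Lp_prod {Ω Y : Type*} [MeasurableSpace Ω] [MeasurableSpace Y]
    (P : Measure Ω) (ν : Measure Y) [SFinite P] [SFinite ν] [MeasureTheory.IsSeparable P]
    [MeasureTheory.IsSeparable ν] (q : ℝ≥0∞) [Fact (1 ≤ q)] [Fact (q ≠ ⊤)] :
    TopologicalSpace.SeparableSpace (Lp ℝ q (P.prod ν)) :=
  (slice (E := ℝ) (P := P) (ν := ν) (p := q)).symm.surjective.denseRange.separableSpace
    (slice (E := ℝ) (P := P) (ν := ν) (p := q)).symm.continuous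

end TwoScale

theorem theorem4p1 {d : ℕ} (hd : 0 < d)
    {Ω : Type*} [MeasurableSpace Ω] (P : Measure Ω) [IsProbabilityMeasure P] [P.IsComplete]
    [MeasureTheory.IsSeparable P] (τ : ShiftGroup d P)
    (p : ℝ≥0∞) [Fact (1 ≤ p)] (hp1 : 1 < p) (hp : p ≠ ⊤)
    (Q : Set (Space d)) (hQ : IsOpen Q) (hQb : Bornology.IsBounded Q)
    (V : Ω → Space d → Space d → ℝ) (hV : IsConvexIntegrand P Q p V) :
    -- the energies are integrals of integrable functions
    ((∀ ε : ℝ, 0 < ε → ∀ u ∈ randomSobolevZero p Q (⊤ : Submodule ℝ (Lp ℝ p P)),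
        Integrable (oscDensity τ V ε u.2) (prodMeasure P Q)) ∧
      (∀ u ∈ randomSobolevZero p Q (LpInv τ p), ∀ χ ∈ vectorTensorLp p Q (LpPot τ p),
        Integrable (twoScaleDensity V u.2 χ) (prodMeasure P Q))) ∧
    -- compactness and liminf inequality
    (∀ ε : ℕ → ℝ, (∀ n, 0 < ε n) → Tendsto ε atTop (𝓝 0) →
      ∀ u : ℕ → Lp ℝ p (prodMeasure P Q) × Lp (Space d) p (prodMeasure P Q),
        (∀ n, u n ∈ randomSobolevZero p Q (⊤ : Submodule ℝ (Lp ℝ p P))) →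
        limsup (fun n => (oscEnergy τ Q V (ε n) (u n) : EReal)) atTop < ⊤ →
        ∃ u₀ ∈ randomSobolevZero p Q (LpInv τ p), ∃ χ ∈ vectorTensorLp p Q (LpPot τ p),
          ∃ k : ℕ → ℕ, StrictMono k ∧
            WeakTwoScale τ Q hp atTop (fun n => ε (k n)) (fun n => (u (k n)).1) u₀.1 ∧
            WeakTwoScale τ Q hp atTop (fun n => ε (k n)) (fun n => (u (k n)).2) (u₀.2 + χ) ∧
            (twoScaleEnergy Q V u₀ χ : EReal) ≤
              liminf (fun n => (oscEnergy τ Q V (ε (k n)) (u (k n)) : EReal)) atTop) ∧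
    -- recovery sequences with convergence of the energy
    (∀ u₀ ∈ randomSobolevZero p Q (LpInv τ p), ∀ χ ∈ vectorTensorLp p Q (LpPot τ p),
      ∃ u : ℝ → Lp ℝ p (prodMeasure P Q) × Lp (Space d) p (prodMeasure P Q),
        (∀ ε, 0 < ε → u ε ∈ randomSobolevZero p Q (⊤ : Submodule ℝ (Lp ℝ p P))) ∧
        StrongTwoScale τ Q hp (𝓝[>] 0) (fun ε => ε) (fun ε => (u ε).1) u₀.1 ∧
        StrongTwoScale τ Q hp (𝓝[>] 0) (fun ε => ε) (fun ε => (u ε).2) (u₀.2 + χ) ∧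
        limsup (fun ε => (oscEnergy τ Q V ε (u ε) : EReal)) (𝓝[>] 0) ≤
          (twoScaleEnergy Q V u₀ χ : EReal) ∧
        Tendsto (fun ε => oscEnergy τ Q V ε (u ε)) (𝓝[>] 0) (𝓝 (twoScaleEnergy Q V u₀ χ))) := by
  have hpt : Fact (p ≠ ⊤) := ⟨hp⟩
  have hfin : IsFiniteMeasure (volume.restrict Q) :=
    ⟨by rw [Measure.restrict_apply_univ]; exact hQb.measure_lt_top⟩
  have hpq : ENNReal.HolderConjugate p p.conjExponent :=
    ENNReal.HolderConjugate.conjExponent hp1.le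
  have hqp : ENNReal.HolderConjugate p.conjExponent p := hpq.symm
  have hq1 : Fact (1 ≤ p.conjExponent) := ⟨hqp.one_le⟩
  -- This is where p > 1 enters: a finite conjugate exponent makes the predual L^q separable and the
  -- Riesz representation available in both directions.
  have hq : p.conjExponent ≠ ⊤ :=
    (ENNReal.HolderConjugate.ne_top_iff_ne_one p.conjExponent p).2 hp1.ne'
  have hqt : Fact (p.conjExponent ≠ ⊤) := ⟨hq⟩
  have hsep := separableSpace_Lp_prod P (volume.restrict Q) p.conjExponent
  refine ⟨⟨fun ε _ u _ => integrable_oscDensity τ hp hV ε u.2,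
    fun u _ χ _ => integrable_twoScaleDensity hV u.2 χ⟩,
    fun ε hε hε0 u hu hlim => exists_limit_of_limsup_lt_top τ hq hd hQb hV hε hε0 hu hlim,
    fun u₀ hu₀ χ hχ => ?_⟩
  obtain ⟨u, hu, hlim⟩ := exists_recovery τ hq hQ hu₀ hχ
  have h1 : StrongTwoScale τ Q hp (𝓝[>] 0) (fun ε => ε) (fun ε => (u ε).1) u₀.1 := hlim.fst_nhds
  have h2 : StrongTwoScale τ Q hp (𝓝[>] 0) (fun ε => ε) (fun ε => (u ε).2) (u₀.2 + χ) :=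
    hlim.snd_nhds
  have h3 := tendsto_oscEnergy τ hV h2
  exact ⟨u, fun ε _ => hu ε, h1, h2,
    ((continuous_coe_real_ereal.tendsto _).comp h3).limsup_eq.le, h3⟩
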